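/- **Setting.** Let $\mathbf k$ be a field of characteristic $p>0$ and $A=\mathbf k[x]/x^p$, graded with $|x|=2$. For a graded space $M$ put $M[s]^i=M^{i+s}$ and let $M^*$ be the graded dual, $(M^*)^n=(M^{-n})^*$. As graded $A$-modules, $A^*\cong A[2(p-1)]$. Graded spaces are $\mathbf Z$-graded and finite dimensional in each degree; they form a graded category, a morphism being a finite sum of homogeneous linear maps, possibly of non-zero degree. Let $\mathcal V$ be the category of finite dimensional $\mathbf k$-spaces, with all morphisms in degree $0$, and let $\mathcal V_A$ have as objects the graded $A$-modules $V\otimes A$, $V\in\mathcal V$, with $\mathrm{Hom}(V\otimes A,W\otimes A)=\mathrm{Hom}(V,W)\otimes A$. For $d\ge 0$ and a graded $\mathbf k$-linear category $\mathcal C$, let $\Gamma^d\mathcal C$ have the objects of $\mathcal C$ and $\mathrm{Hom}_{\Gamma^d\mathcal C}(X,Y)=\Gamma^d(\mathrm{Hom}_{\mathcal C}(X,Y))$, where $\Gamma^d(H)=(H^{\otimes d})^{\Sigma_d}$. Let $\widetilde{\mathcal P}_d$ and $\widetilde{\mathcal P}^{af}_d$ be the categories of graded $\mathbf k$-linear functors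 (those preserving the degrees of morphisms) from $\Gamma^d\mathcal V$, respectively $\Gamma^d\mathcal V_A$, to graded spaces, with all natural transformations as morphisms; let $\mathcal P_d^{f+}$ and $\mathcal P_d^{af}$ be their full subcategories of functors with bounded below values. The category $\mathcal P_d$ of strict polynomial functors of degree $d$ is the part of $\mathcal P_d^{f+}$ concentrated in degree $0$. Such a functor $F$ on $\Gamma^d\mathcal C$ extends to $F^{gr}$ on $\Gamma^d$ of the category of graded objects $\bigoplus_j X_j$ of $\mathcal C$ (finite sums, with $X_j$ placed in degree $j$): the underlying space is $F(\bigoplus_j X_j)$, and its part of degree $s$ in $F$ and of multidegree $\gamma$ in the $X_j$ (so $\sum_j\gamma_j=d$) is given degree $s+\sum_j j\gamma_j$. Define, naturally in $F$: * $z^*(F)(V\otimes A)=F^{gr}(V\otimes A)$, where $V\otimes A$ is viewed as a graded space; * $t^*(F)(V)=F(V\otimes A)$, and $F(V\otimes A^*):=F^{gr}((V\otimes A)[2(p-1)])$; * the Kuhn duality $F^{\#}(V)=F(V^*)^*$ on $\widetilde{\mathcal P}_d$; * the affine Kuhn duality $F^{\#}(V\otimes A)=F^{gr}((V^*\otimes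 A)[2(p-1)])^*$ on $\widetilde{\mathcal P}^{af}_d$, where $f\otimes a\in\mathrm{Hom}(V,W)\otimes A$ acts through $f^*\otimes a$. (These dualities exchange bounded below and bounded above functors.) For $U\in\mathcal V$ let $h^{U\otimes A}(V\otimes A)=\mathrm{Hom}_{\Gamma^d\mathcal V_A}(U\otimes A,V\otimes A)$ and $c^*_{U\otimes A}(V\otimes A)=\mathrm{Hom}_{\Gamma^d\mathcal V_A}(V\otimes A,U\otimes A)^*$. Let $c^*_{U\otimes A^*}(V\otimes A)$ be the graded dual of the space of morphisms from $V\otimes A$ (placed in degree $0$) to $(U\otimes A)[2(p-1)]$ in $\Gamma^d$ of the category of graded objects of $\mathcal V_A$. For $0\le j\le p-1$ let $\chi_j(V\otimes A)=x^j(V\otimes A)/x^{j+1}(V\otimes A)$, a functor in $\mathcal P_1^{af}$. **Proposition 2.4.** All isomorphisms of functors below are homogeneous of degree $0$; $d\ge 0$ is arbitrary. 1. For every $U\in\mathcal V$, $(h^{U\otimes A})^{\#}\simeq c^*_{U^*\otimes A^*}\simeq c^*_{U^*\otimes A}[-2(p-1)d]$ as functors on $\Gamma^d\mathcal V_A$.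 2. $\chi_j^{\#}\simeq\chi_{p-1-j}$ for $0\le j\le p-1$. 3. $z^*(F^{\#})\simeq(z^*(F))^{\#}$, naturally in $F\in\widetilde{\mathcal P}_d$; in particular for $F\in\mathcal P_d$. 4. Let $h^*:=(-)^{\#}\circ t^*\circ(-)^{\#}$. It takes $\mathcal P_d^{af}$ to $\mathcal P_d^{f+}$, and $h^*:\mathcal P_d^{af}\to\mathcal P_d^{f+}$ is left adjoint to $z^*:\mathcal P_d^{f+}\to\mathcal P_d^{af}$; the adjunction bijections $\mathrm{Hom}(h^*F,G)\cong\mathrm{Hom}(F,z^*G)$ can be chosen to match morphisms of degree $i$ with morphisms of degree $i$, for every $i$. 5. $h^*(F)(V)\simeq F(V\otimes A^*)$, naturally in $F\in\widetilde{\mathcal P}^{af}_d$ and in $V$; and $h^*\simeq t^*[2(p-1)d]$. -/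

import Mathlib

open CategoryTheory TensorProduct

universe u v w

noncomputable section

namespace AffineStrict

/-! ### Gradings and projections -/

section Grading

variable {k : Type u} [Field k] {M : Type v} [AddCommGroup M] [Module k M]

/-- A family of submodules with compatible projections is an internal direct sum decomposition. -/
theorem isInternal_of_proj (A : ℤ → Submodule k M) (P : ℤ → M →ₗ[k] M)
    (hmem : ∀ n x, P n x ∈ A n) (hsame : ∀ n, ∀ x ∈ A n, P n x = x)
    (hne : ∀ m n, m ≠ n → ∀ x ∈ A n, P m x = 0)
    (hsum : ∀ x, ∃ T : Finset ℤ, x = ∑ n ∈ T, P n x) : DirectSum.IsInternal A := by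
  classical
  refine DirectSum.isInternal_submodule_of_iSupIndep_of_iSup_eq_top ?_ ?_
  · intro n
    rw [Submodule.disjoint_def]
    intro x hx hx'
    have h0 : ∀ y ∈ ⨆ j, ⨆ (_ : j ≠ n), A j, P n y = 0 := by
      intro y hy
      have : (⨆ j, ⨆ (_ : j ≠ n), A j) ≤ LinearMap.ker (P n) := by
        refine iSup₂_le fun j hj y hy => ?_
        exact hne n j hj.symm y hy
      exact this hy
    rw [← hsame n x hx, h0 x hx']
  · rw [eq_top_iff]
    intro x _
    obtain ⟨T, hT⟩ := hsum x
    rw [hT]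
    exact Submodule.sum_mem _ fun n _ => Submodule.mem_iSup_of_mem n (hmem n x)

/-- The projection onto the degree `n` summand of an internal decomposition. -/
def proj {A : ℤ → Submodule k M} (h : DirectSum.IsInternal A) (n : ℤ) : M →ₗ[k] M :=
  (A n).subtype ∘ₗ DirectSum.component k ℤ (fun i => A i) n ∘ₗ
    (LinearEquiv.ofBijective (DirectSum.coeLinearMap A) h).symm.toLinearMap

variable {A : ℤ → Submodule k M} (h : DirectSum.IsInternal A)

theorem proj_mem (n : ℤ) (x : M) : proj h n x ∈ A n := by
  simp [proj]

theorem proj_same (n : ℤ) (x : M) (hx : x ∈ A n) : proj h n x = x := by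
  exact congrArg Subtype.val (h.ofBijective_coeLinearMap_of_mem hx)

theorem proj_ne (m n : ℤ) (hmn : m ≠ n) (x : M) (hx : x ∈ A n) : proj h m x = 0 := by
  exact congrArg Subtype.val (h.ofBijective_coeLinearMap_of_mem_ne hmn.symm hx)

theorem proj_sum (x : M) : ∃ T : Finset ℤ, ∀ T', T ⊆ T' → x = ∑ n ∈ T', proj h n x := by
  classical
  have hx : x ∈ ⨆ n, A n := by rw [h.submodule_iSup_eq_top]; trivial
  induction hx using Submodule.iSup_induction' with
  | mem n x hx =>
    refine ⟨{n}, fun T' hT' => ?_⟩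
    rw [Finset.sum_eq_single n, proj_same h n x hx]
    · intro m _ hm; exact proj_ne h m n hm x hx
    · intro hn; exact absurd (hT' (Finset.mem_singleton_self n)) hn
  | zero => exact ⟨∅, by simp⟩
  | add x y _ _ ihx ihy =>
    obtain ⟨T, hT⟩ := ihx
    obtain ⟨S, hS⟩ := ihy
    refine ⟨T ∪ S, fun T' hT' => ?_⟩
    simp only [map_add, Finset.sum_add_distrib]
    rw [← hT T' (Finset.union_subset_left hT'), ← hS T' (Finset.union_subset_right hT')]

theorem proj_sum' (x : M) : ∃ T : Finset ℤ, x = ∑ n ∈ T, proj h n x :=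
  (proj_sum h x).imp fun T hT => hT T subset_rfl

/-- In finite dimension only finitely many degrees occur. -/
theorem proj_sum_fin [Module.Finite k M] :
    ∃ T : Finset ℤ, ∀ T', T ⊆ T' → ∀ x, x = ∑ n ∈ T', proj h n x := by
  classical
  obtain ⟨s, hs⟩ := (Module.Finite.fg_top : (⊤ : Submodule k M).FG)
  choose T hT using fun x : M => proj_sum h x
  refine ⟨s.biUnion T, fun T' hT' x => ?_⟩
  have hx : x ∈ Submodule.span k (s : Set M) := by rw [hs]; trivial
  induction hx using Submodule.span_induction with
  | mem x hx => exact hT x T' ((Finset.subset_biUnion_of_mem T hx).trans hT')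
  | zero => simp
  | add x y _ _ ihx ihy =>
    simp only [map_add, Finset.sum_add_distrib]; rw [← ihx, ← ihy]
  | smul a x _ ih => simp only [map_smul, ← Finset.smul_sum]; rw [← ih]

end Grading

/-! ### Graded vector spaces, finite dimensional in each degree -/

/-- A `ℤ`-graded `k`-vector space which is finite dimensional in each degree. -/
structure GrVect (k : Type u) [Field k] where
  carrier : Type u
  [addCommGroup : AddCommGroup carrier]
  [module : Module k carrier]
  gr : ℤ → Submodule k carrier
  internal : DirectSum.IsInternal gr
  finite : ∀ n, Module.Finite k (gr n)

attribute [instance] GrVect.addCommGroup GrVect.module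

namespace GrVect

variable {k : Type u} [Field k]

/-- Linear maps that are homogeneous of degree `j`. -/
def degHom (M N : GrVect k) (j : ℤ) : Submodule k (M.carrier →ₗ[k] N.carrier) where
  carrier := {f | ∀ n, ∀ x ∈ M.gr n, f x ∈ N.gr (n + j)}
  add_mem' hf hg n x hx := (N.gr (n + j)).add_mem (hf n x hx) (hg n x hx)
  zero_mem' n _ _ := (N.gr (n + j)).zero_mem
  smul_mem' a _ hf n x hx := (N.gr (n + j)).smul_mem a (hf n x hx)

/-- The graded morphism space `⨁ j, Hom^j(M, N)`, as a space of linear maps: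
finite sums of homogeneous maps. -/
def grHom (M N : GrVect k) : Submodule k (M.carrier →ₗ[k] N.carrier) := ⨆ j, degHom M N j

theorem degHom_le (M N : GrVect k) (j : ℤ) : degHom M N j ≤ grHom M N := le_iSup (degHom M N) j

theorem id_mem_degHom (M : GrVect k) : LinearMap.id ∈ degHom M M 0 := by
  intro n x hx; simpa using hx

theorem comp_mem_degHom {M N L : GrVect k} {i j : ℤ} {g : N.carrier →ₗ[k] L.carrier}
    {f : M.carrier →ₗ[k] N.carrier} (hf : f ∈ degHom M N i) (hg : g ∈ degHom N L j) :
    g ∘ₗ f ∈ degHom M L (i + j) := by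
  intro n x hx
  rw [← add_assoc]
  exact hg _ _ (hf _ _ hx)

theorem comp_mem_grHom {M N L : GrVect k} {g : N.carrier →ₗ[k] L.carrier}
    {f : M.carrier →ₗ[k] N.carrier} (hf : f ∈ grHom M N) (hg : g ∈ grHom N L) :
    g ∘ₗ f ∈ grHom M L := by
  induction hf using Submodule.iSup_induction' with
  | mem i f hf =>
    induction hg using Submodule.iSup_induction' with
    | mem j g hg => exact degHom_le _ _ _ (comp_mem_degHom hf hg)
    | zero => rw [LinearMap.zero_comp]; exact Submodule.zero_mem _
    | add g g' _ _ h h' => rw [LinearMap.add_comp]; exact Submodule.add_mem _ h h'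
  | zero => rw [LinearMap.comp_zero]; exact Submodule.zero_mem _
  | add f f' _ _ h h' => rw [LinearMap.comp_add]; exact Submodule.add_mem _ h h'

/-- A morphism of graded spaces: an element of `⨁ j, Hom^j(M, N)`. -/
@[ext] structure Hom (M N : GrVect k) where
  lin : M.carrier →ₗ[k] N.carrier
  mem : lin ∈ grHom M N

instance : Category (GrVect k) where
  Hom := Hom
  id M := ⟨LinearMap.id, degHom_le _ _ 0 (id_mem_degHom M)⟩
  comp f g := ⟨g.lin ∘ₗ f.lin, comp_mem_grHom f.mem g.mem⟩

@[ext] theorem hom_ext {M N : GrVect k} {f g : M ⟶ N} (h : f.lin = g.lin) : f = g := Hom.ext h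

@[simp] theorem id_lin (M : GrVect k) : (𝟙 M : M ⟶ M).lin = LinearMap.id := rfl

@[simp] theorem comp_lin {M N L : GrVect k} (f : M ⟶ N) (g : N ⟶ L) :
    (f ≫ g).lin = g.lin ∘ₗ f.lin := rfl

/-- Bounded below: the graded pieces vanish in all sufficiently small degrees. -/
def BddBelow (M : GrVect k) : Prop := ∃ N : ℤ, ∀ n < N, M.gr n = ⊥

/-- Bounded above: the graded pieces vanish in all sufficiently large degrees. -/
def BddAbove (M : GrVect k) : Prop := ∃ N : ℤ, ∀ n, N < n → M.gr n = ⊥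

/-- The shift `M[s]`, with `M[s]^i = M^(i+s)`. -/
def shiftObj (s : ℤ) (M : GrVect k) : GrVect k where
  carrier := M.carrier
  gr i := M.gr (i + s)
  internal := by
    refine isInternal_of_proj _ (fun n => proj M.internal (n + s)) (fun n x => proj_mem _ _ _)
      (fun n x hx => proj_same _ _ _ hx) (fun m n hmn x hx => proj_ne _ _ (n + s) (by simpa) _ hx) ?_
    intro x
    obtain ⟨T, hT⟩ := proj_sum' M.internal x
    refine ⟨T.map (Equiv.addRight (-s)).toEmbedding, ?_⟩
    rw [Finset.sum_map]
    simpa using hT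
  finite n := M.finite (n + s)

theorem shift_mem_degHom {M N : GrVect k} {s j : ℤ} {f : M.carrier →ₗ[k] N.carrier}
    (hf : f ∈ degHom M N j) :
    (f : (shiftObj s M).carrier →ₗ[k] (shiftObj s N).carrier) ∈
      degHom (shiftObj s M) (shiftObj s N) j := by
  intro n x hx
  have := hf (n + s) x hx
  have e : n + s + j = n + j + s := by ring
  rw [e] at this
  exact this

/-- The shift functor; it is the identity on underlying linear maps. -/
def shift (s : ℤ) : GrVect k ⥤ GrVect k where
  obj M := shiftObj s M
  map {M N} f := ⟨f.lin, by
    have h : grHom M N ≤ grHom (shiftObj s M) (shiftObj s N) :=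
      iSup_mono fun j _ hf => shift_mem_degHom hf
    exact h f.mem⟩

/-- Underlying space of the graded dual: the functionals vanishing on all but finitely many
homogeneous components. -/
def dualCarrier (M : GrVect k) : Submodule k (M.carrier →ₗ[k] k) where
  carrier := {ξ | ∃ T : Finset ℤ, ∀ n ∉ T, ∀ x ∈ M.gr n, ξ x = 0}
  add_mem' := by
    classical
    rintro ξ η ⟨T, hT⟩ ⟨S, hS⟩
    refine ⟨T ∪ S, fun n hn x hx => ?_⟩
    rw [Finset.notMem_union] at hn
    simp [hT n hn.1 x hx, hS n hn.2 x hx]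
  zero_mem' := ⟨∅, by simp⟩
  smul_mem' := by
    rintro a ξ ⟨T, hT⟩
    exact ⟨T, fun n hn x hx => by simp [hT n hn x hx]⟩

/-- The graded dual of `M`, as a vector space. -/
def GrDual (M : GrVect k) : Type u := dualCarrier M

instance (M : GrVect k) : AddCommGroup (GrDual M) := inferInstanceAs (AddCommGroup (dualCarrier M))

instance (M : GrVect k) : Module k (GrDual M) := inferInstanceAs (Module k (dualCarrier M))

/-- The functional underlying an element of the graded dual. -/
def evalDual (M : GrVect k) : GrDual M →ₗ[k] (M.carrier →ₗ[k] k) := (dualCarrier M).subtype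

theorem evalDual_injective (M : GrVect k) : Function.Injective (evalDual M) :=
  Subtype.val_injective

/-- The functionals of degree `n`: those vanishing on `M^m` for all `m ≠ -n`. -/
def dualGr (M : GrVect k) (n : ℤ) : Submodule k (GrDual M) where
  carrier := {ξ | ∀ m, m ≠ -n → ∀ x ∈ M.gr m, evalDual M ξ x = 0}
  add_mem' h h' m hm x hx := by simp [h m hm x hx, h' m hm x hx]
  zero_mem' m hm x hx := by simp
  smul_mem' a ξ h m hm x hx := by simp [h m hm x hx]

/-- Precomposition of functionals with the projection onto `M^(-n)`. -/
def dualProj (M : GrVect k) (n : ℤ) : GrDual M →ₗ[k] GrDual M where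
  toFun ξ := ⟨evalDual M ξ ∘ₗ proj M.internal (-n), {-n}, fun m h x hx => by
    have : m ≠ -n := by simpa using h
    simp [proj_ne M.internal (-n) m this.symm x hx]⟩
  map_add' ξ η := rfl
  map_smul' a ξ := rfl

theorem dualProj_apply (M : GrVect k) (n : ℤ) (ξ : GrDual M) (x : M.carrier) :
    evalDual M (dualProj M n ξ) x = evalDual M ξ (proj M.internal (-n) x) := rfl

theorem dual_ext {M : GrVect k} {ξ η : GrDual M} (h : ∀ x, evalDual M ξ x = evalDual M η x) :
    ξ = η := evalDual_injective M (LinearMap.ext h)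

theorem dualGr_internal (M : GrVect k) : DirectSum.IsInternal (dualGr M) := by
  classical
  refine isInternal_of_proj (dualGr M) (dualProj M) ?_ ?_ ?_ ?_
  · intro n ξ m hm x hx
    rw [dualProj_apply, proj_ne M.internal (-n) m hm.symm x hx, map_zero]
  · intro n ξ h
    refine dual_ext fun x => ?_
    obtain ⟨T, hT⟩ := proj_sum' M.internal x
    rw [dualProj_apply]
    conv_lhs => rw [hT]
    conv_rhs => rw [hT]
    rw [map_sum, map_sum, map_sum]
    refine Finset.sum_congr rfl fun j _ => ?_
    by_cases hj : j = -n
    · rw [hj, proj_same M.internal _ _ (proj_mem _ _ _)]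
    · rw [proj_ne M.internal (-n) j (Ne.symm hj) _ (proj_mem _ _ _), h j hj _ (proj_mem _ _ _),
        map_zero]
  · intro m n hmn ξ h
    refine dual_ext fun x => ?_
    rw [dualProj_apply]
    exact h (-m) (by simpa using hmn) _ (proj_mem _ _ _)
  · intro ξ
    obtain ⟨T, hT⟩ := ξ.2
    refine ⟨T.map (Equiv.neg ℤ).toEmbedding, dual_ext fun x => ?_⟩
    rw [map_sum, Finset.sum_map, LinearMap.sum_apply]
    simp only [dualProj_apply, Equiv.coe_toEmbedding, Equiv.neg_apply, neg_neg]
    obtain ⟨S, hS⟩ := proj_sum M.internal x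
    have h1 := hS (S ∪ T) Finset.subset_union_left
    conv_lhs => rw [h1]
    rw [map_sum]
    symm
    exact Finset.sum_subset Finset.subset_union_right fun n _ hn => hT n hn _ (proj_mem _ _ _)

theorem dualGr_finite (M : GrVect k) (n : ℤ) : Module.Finite k (dualGr M n) := by
  have := M.finite (-n)
  let φ : dualGr M n →ₗ[k] (M.gr (-n) →ₗ[k] k) :=
    (LinearMap.lcomp k k (M.gr (-n)).subtype) ∘ₗ evalDual M ∘ₗ (dualGr M n).subtype
  refine Module.Finite.of_injective φ ?_
  refine (injective_iff_map_eq_zero φ).2 ?_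
  rintro ⟨ξ, hξ⟩ h0
  refine Subtype.ext (dual_ext fun x => ?_)
  obtain ⟨T, hT⟩ := proj_sum' M.internal x
  change evalDual M ξ x = 0
  rw [hT, map_sum]
  refine Finset.sum_eq_zero fun j _ => ?_
  by_cases hj : j = -n
  · subst hj; exact LinearMap.congr_fun h0 ⟨_, proj_mem M.internal (-n) x⟩
  · exact hξ j hj _ (proj_mem _ _ _)

/-- The graded dual `M^*`, with `(M^*)^n = (M^(-n))^*`. -/
def dualObj (M : GrVect k) : GrVect k where
  carrier := GrDual M
  gr := dualGr M
  internal := dualGr_internal M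
  finite := dualGr_finite M

theorem dual_exists {M N : GrVect k} {f : M.carrier →ₗ[k] N.carrier} (hf : f ∈ grHom M N) :
    ∃ g : GrDual N →ₗ[k] GrDual M, g ∈ grHom (dualObj N) (dualObj M) ∧
      ∀ ξ, evalDual M (g ξ) = evalDual N ξ ∘ₗ f := by
  induction hf using Submodule.iSup_induction' with
  | mem j f hf =>
    let g : GrDual N →ₗ[k] GrDual M :=
      { toFun := fun ξ => ⟨evalDual N ξ ∘ₗ f, by
          obtain ⟨T, hT⟩ := ξ.2
          refine ⟨T.map (Equiv.addRight (-j)).toEmbedding, fun n hn x hx => ?_⟩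
          refine hT (n + j) (fun h => hn ?_) _ (hf n x hx)
          exact Finset.mem_map.2 ⟨n + j, h, by simp⟩⟩
        map_add' := fun ξ η => rfl
        map_smul' := fun a ξ => rfl }
    refine ⟨g, degHom_le _ _ j ?_, fun ξ => rfl⟩
    intro n ξ hξ m hm x hx
    refine hξ (m + j) (fun h => hm ?_) _ (hf m x hx)
    omega
  | zero => exact ⟨0, Submodule.zero_mem _, fun ξ => by
      rw [LinearMap.comp_zero, LinearMap.zero_apply, map_zero]⟩
  | add f f' _ _ h h' =>
    obtain ⟨g, hg, hg'⟩ := h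
    obtain ⟨g₁, hg₁, hg₁'⟩ := h'
    refine ⟨g + g₁, Submodule.add_mem _ hg hg₁, fun ξ => ?_⟩
    rw [LinearMap.comp_add, ← hg' ξ, ← hg₁' ξ, LinearMap.add_apply, map_add]

/-- The transpose `ξ ↦ ξ ∘ f` between graded duals. -/
def dualLin {M N : GrVect k} (f : M ⟶ N) : GrDual N →ₗ[k] GrDual M where
  toFun ξ := ⟨evalDual N ξ ∘ₗ f.lin, by
    obtain ⟨g, _, hg⟩ := dual_exists f.mem
    rw [← hg ξ]
    exact (g ξ).2⟩
  map_add' ξ η := rfl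
  map_smul' a ξ := rfl

theorem dualLin_mem {M N : GrVect k} (f : M ⟶ N) :
    dualLin f ∈ grHom (dualObj N) (dualObj M) := by
  obtain ⟨g, hg, hg'⟩ := dual_exists f.mem
  have : dualLin f = g := LinearMap.ext fun ξ => evalDual_injective M (hg' ξ).symm
  rw [this]
  exact hg

/-- The graded dual of a morphism. -/
def dualMap {M N : GrVect k} (f : M ⟶ N) : dualObj N ⟶ dualObj M := ⟨dualLin f, dualLin_mem f⟩

theorem dualMap_id (M : GrVect k) : dualMap (𝟙 M) = 𝟙 (dualObj M) := rfl

theorem dualMap_comp {M N L : GrVect k} (f : M ⟶ N) (g : N ⟶ L) :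
    dualMap (f ≫ g) = dualMap g ≫ dualMap f := rfl

theorem dualLin_mem_degHom {M N : GrVect k} {f : M ⟶ N} {j : ℤ} (hf : f.lin ∈ degHom M N j) :
    (dualMap f).lin ∈ degHom (dualObj N) (dualObj M) j := by
  intro n ξ hξ m hm x hx
  refine hξ (m + j) (fun h => hm ?_) _ (hf m x hx)
  omega

end GrVect

/-! ### Symmetric tensors -/

section Gam

variable (k : Type u) [Field k] (d : ℕ)

/-- The tensors in `H^{⊗ d}` invariant under all permutations of the factors. -/
def symTensors (H : Type u) [AddCommGroup H] [Module k H] :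
    Submodule k (PiTensorProduct k fun _ : Fin d => H) where
  carrier := {t | ∀ σ : Equiv.Perm (Fin d), PiTensorProduct.reindex k (fun _ => H) σ t = t}
  add_mem' hs ht σ := by rw [map_add, hs σ, ht σ]
  zero_mem' σ := map_zero _
  smul_mem' a t ht σ := by rw [map_smul, ht σ]

/-- `Γ^d(H) = (H^{⊗ d})^{Σ_d}`. -/
def Gam (H : Type u) [AddCommGroup H] [Module k H] : Type u := symTensors k d H

variable {H H' H'' H₁ H₂ H₃ : Type u} [AddCommGroup H] [Module k H] [AddCommGroup H'] [Module k H']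
  [AddCommGroup H''] [Module k H'']
  [AddCommGroup H₁] [Module k H₁] [AddCommGroup H₂] [Module k H₂] [AddCommGroup H₃] [Module k H₃]

instance : AddCommGroup (Gam k d H) := inferInstanceAs (AddCommGroup (symTensors k d H))

instance : Module k (Gam k d H) := inferInstanceAs (Module k (symTensors k d H))

variable {k d}

/-- The inclusion `Γ^d(H) ⊆ H^{⊗ d}`. -/
def Gam.val : Gam k d H →ₗ[k] (PiTensorProduct k fun _ : Fin d => H) := (symTensors k d H).subtype

theorem Gam.val_injective : Function.Injective (Gam.val (k := k) (d := d) (H := H)) :=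
  Subtype.val_injective

theorem Gam.ext {s t : Gam k d H} (h : Gam.val s = Gam.val t) : s = t := Gam.val_injective h

instance [Module.Finite k H] : Module.Finite k (Gam k d H) :=
  Module.Finite.of_injective (Gam.val (k := k) (d := d) (H := H)) Gam.val_injective

/-- `h ⊗ ⋯ ⊗ h`. -/
def gamDiag (h : H) : Gam k d H :=
  ⟨PiTensorProduct.tprod k fun _ => h, fun σ => by rw [PiTensorProduct.reindex_tprod]⟩

theorem gamDiag_val (h : H) :
    Gam.val (gamDiag (k := k) (d := d) h) = PiTensorProduct.tprod k fun _ => h := rfl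

/-- `φ^{⊗ d}`. -/
def tenMap (φ : H →ₗ[k] H') : (PiTensorProduct k fun _ : Fin d => H) →ₗ[k]
    (PiTensorProduct k fun _ : Fin d => H') := PiTensorProduct.map fun _ => φ

@[simp] theorem tenMap_tprod (φ : H →ₗ[k] H') (x : Fin d → H) :
    tenMap φ (PiTensorProduct.tprod k x) = PiTensorProduct.tprod k fun i => φ (x i) :=
  PiTensorProduct.map_tprod _ _

/-- The bilinear map `(x₁ ⊗ ⋯ ⊗ x_d, y₁ ⊗ ⋯ ⊗ y_d) ↦ c(x₁, y₁) ⊗ ⋯ ⊗ c(x_d, y_d)`. -/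
def tenMap₂ (c : H₁ →ₗ[k] H₂ →ₗ[k] H₃) : (PiTensorProduct k fun _ : Fin d => H₁) →ₗ[k]
    (PiTensorProduct k fun _ : Fin d => H₂) →ₗ[k] (PiTensorProduct k fun _ : Fin d => H₃) :=
  PiTensorProduct.map₂ fun _ => c

@[simp] theorem tenMap₂_tprod (c : H₁ →ₗ[k] H₂ →ₗ[k] H₃) (x : Fin d → H₁) (y : Fin d → H₂) :
    tenMap₂ c (PiTensorProduct.tprod k x) (PiTensorProduct.tprod k y) =
      PiTensorProduct.tprod k fun i => c (x i) (y i) :=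
  PiTensorProduct.map₂_tprod_tprod _ _ _

theorem ten_induction {P : (PiTensorProduct k fun _ : Fin d => H) → Prop}
    (tprod : ∀ x, P (PiTensorProduct.tprod k x)) (add : ∀ s t, P s → P t → P (s + t))
    (smul : ∀ (a : k) t, P t → P (a • t)) (t) : P t :=
  PiTensorProduct.induction_on t (fun a x => smul a _ (tprod x)) add

theorem tenMap_reindex (φ : H →ₗ[k] H') (σ : Equiv.Perm (Fin d))
    (t : PiTensorProduct k fun _ : Fin d => H) :
    PiTensorProduct.reindex k (fun _ => H') σ (tenMap φ t) =
      tenMap φ (PiTensorProduct.reindex k (fun _ => H) σ t) := by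
  induction t using ten_induction with
  | tprod x => simp
  | add s t hs ht => simp only [map_add, hs, ht]
  | smul a t ht => simp only [map_smul, ht]

theorem tenMap₂_reindex (c : H₁ →ₗ[k] H₂ →ₗ[k] H₃) (σ : Equiv.Perm (Fin d))
    (s : PiTensorProduct k fun _ : Fin d => H₁) (t : PiTensorProduct k fun _ : Fin d => H₂) :
    PiTensorProduct.reindex k (fun _ => H₃) σ (tenMap₂ c s t) =
      tenMap₂ c (PiTensorProduct.reindex k (fun _ => H₁) σ s)
        (PiTensorProduct.reindex k (fun _ => H₂) σ t) := by
  induction s using ten_induction with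
  | tprod x =>
    induction t using ten_induction with
    | tprod y => simp
    | add s t hs ht => simp only [map_add, hs, ht]
    | smul a t ht => simp only [map_smul, ht]
  | add s t hs ht => simp only [map_add, LinearMap.add_apply, hs, ht]
  | smul a t ht => simp only [map_smul, LinearMap.smul_apply, ht]

/-- `Γ^d(φ)`. -/
def gamMap (φ : H →ₗ[k] H') : Gam k d H →ₗ[k] Gam k d H' where
  toFun t := ⟨tenMap φ (Gam.val t), fun σ => by rw [tenMap_reindex]; congr 1; exact t.2 σ⟩
  map_add' s t := Gam.ext (map_add (tenMap φ) _ _)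
  map_smul' a t := Gam.ext (map_smul (tenMap φ) a _)

theorem gamMap_val (φ : H →ₗ[k] H') (t : Gam k d H) :
    Gam.val (gamMap φ t) = tenMap φ (Gam.val t) := rfl

/-- The map `Γ^d(H₁) × Γ^d(H₂) → Γ^d(H₃)` induced by a bilinear map `H₁ × H₂ → H₃`. -/
def gamMap₂ (c : H₁ →ₗ[k] H₂ →ₗ[k] H₃) : Gam k d H₁ →ₗ[k] Gam k d H₂ →ₗ[k] Gam k d H₃ :=
  LinearMap.mk₂ k
    (fun s t => ⟨tenMap₂ c (Gam.val s) (Gam.val t), fun σ => by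
      rw [tenMap₂_reindex]; congr 1
      · congr 1; exact s.2 σ
      · exact t.2 σ⟩)
    (fun s s' t => Gam.ext (LinearMap.map_add₂ (tenMap₂ c) _ _ _))
    (fun a s t => Gam.ext (LinearMap.map_smul₂ (tenMap₂ c) a _ _))
    (fun s t t' => Gam.ext (map_add (tenMap₂ c (Gam.val s)) _ _))
    (fun a s t => Gam.ext (map_smul (tenMap₂ c (Gam.val s)) a _))

theorem gamMap₂_val (c : H₁ →ₗ[k] H₂ →ₗ[k] H₃) (s : Gam k d H₁) (t : Gam k d H₂) :
    Gam.val (gamMap₂ c s t) = tenMap₂ c (Gam.val s) (Gam.val t) := rfl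

/-! #### The grading of `Γ^d` of a graded space -/

/-- The degree `n` part of `H^{⊗ d}` for a graded space `H`. -/
def tenDeg (A : ℤ → Submodule k H) (n : ℤ) : Submodule k (PiTensorProduct k fun _ : Fin d => H) :=
  Submodule.span k {t | ∃ (m : Fin d → ℤ) (x : Fin d → H), ∑ i, m i = n ∧ (∀ i, x i ∈ A (m i)) ∧
    t = PiTensorProduct.tprod k x}

/-- The degree `n` part of `Γ^d(H)` for a graded space `H`. -/
def gamDeg (A : ℤ → Submodule k H) (n : ℤ) : Submodule k (Gam k d H) :=
  (tenDeg A n).comap Gam.val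

theorem tprod_mem_tenDeg {A : ℤ → Submodule k H} {n : ℤ} (m : Fin d → ℤ) (x : Fin d → H)
    (hm : ∑ i, m i = n) (hx : ∀ i, x i ∈ A (m i)) : PiTensorProduct.tprod k x ∈ tenDeg A n :=
  Submodule.subset_span ⟨m, x, hm, hx, rfl⟩

theorem tenMap_mem {A : ℤ → Submodule k H} {B : ℤ → Submodule k H'} {φ : H →ₗ[k] H'}
    (hφ : ∀ n, ∀ x ∈ A n, φ x ∈ B n) (n : ℤ) (t : PiTensorProduct k fun _ : Fin d => H)
    (ht : t ∈ tenDeg A n) : tenMap φ t ∈ tenDeg B n := by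
  induction ht using Submodule.span_induction with
  | mem t h =>
    obtain ⟨m, x, hm, hx, rfl⟩ := h
    rw [tenMap_tprod]
    exact tprod_mem_tenDeg m _ hm fun i => hφ _ _ (hx i)
  | zero => rw [map_zero]; exact Submodule.zero_mem _
  | add s t _ _ hs ht => rw [map_add]; exact Submodule.add_mem _ hs ht
  | smul a t _ ht => rw [map_smul]; exact Submodule.smul_mem _ a ht

theorem gamMap_mem {A : ℤ → Submodule k H} {B : ℤ → Submodule k H'} {φ : H →ₗ[k] H'}
    (hφ : ∀ n, ∀ x ∈ A n, φ x ∈ B n) (n : ℤ) (t : Gam k d H) (ht : t ∈ gamDeg A n) :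
    gamMap φ t ∈ gamDeg B n := tenMap_mem hφ n _ ht

theorem tenMap₂_mem {A : ℤ → Submodule k H₁} {B : ℤ → Submodule k H₂} {C : ℤ → Submodule k H₃}
    {c : H₁ →ₗ[k] H₂ →ₗ[k] H₃} (hc : ∀ m n, ∀ x ∈ A m, ∀ y ∈ B n, c x y ∈ C (m + n)) (m n : ℤ)
    (s : PiTensorProduct k fun _ : Fin d => H₁) (hs : s ∈ tenDeg A m)
    (t : PiTensorProduct k fun _ : Fin d => H₂) (ht : t ∈ tenDeg B n) :
    tenMap₂ c s t ∈ tenDeg C (m + n) := by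
  induction hs using Submodule.span_induction with
  | mem s h =>
    obtain ⟨a, x, ha, hx, rfl⟩ := h
    induction ht using Submodule.span_induction with
    | mem t h =>
      obtain ⟨b, y, hb, hy, rfl⟩ := h
      rw [tenMap₂_tprod]
      refine tprod_mem_tenDeg (fun i => a i + b i) _ ?_ fun i => hc _ _ _ (hx i) _ (hy i)
      rw [Finset.sum_add_distrib, ha, hb]
    | zero => rw [map_zero]; exact Submodule.zero_mem _
    | add s t _ _ hs ht => rw [map_add]; exact Submodule.add_mem _ hs ht
    | smul a t _ ht => rw [map_smul]; exact Submodule.smul_mem _ a ht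
  | zero => rw [map_zero]; exact Submodule.zero_mem _
  | add s t _ _ hs ht => rw [map_add]; exact Submodule.add_mem _ hs ht
  | smul a t _ ht => rw [map_smul]; exact Submodule.smul_mem _ a ht

/-- The multi-indices with entries in `S` and total `n`. -/
def multiIdx (d : ℕ) (S : Finset ℤ) (n : ℤ) : Finset (Fin d → ℤ) :=
  (Fintype.piFinset fun _ => S).filter fun a => ∑ i, a i = n

theorem mem_multiIdx {S : Finset ℤ} {n : ℤ} {a : Fin d → ℤ} :
    a ∈ multiIdx d S n ↔ (∀ i, a i ∈ S) ∧ ∑ i, a i = n := by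
  simp [multiIdx]

/-- The possible totals of multi-indices with entries in `S`. -/
def totals (d : ℕ) (S : Finset ℤ) : Finset ℤ :=
  (Fintype.piFinset fun _ : Fin d => S).image fun a => ∑ i, a i

theorem multiIdx_of_notMem {S : Finset ℤ} {n : ℤ} (h : n ∉ totals d S) : multiIdx d S n = ∅ := by
  refine Finset.eq_empty_of_forall_notMem fun a ha => h ?_
  rw [mem_multiIdx] at ha
  exact Finset.mem_image.2 ⟨a, Fintype.mem_piFinset.2 ha.1, ha.2⟩

theorem sum_totals {E : Type*} [AddCommMonoid E] (S : Finset ℤ) (f : (Fin d → ℤ) → E) :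
    ∑ n ∈ totals d S, ∑ a ∈ multiIdx d S n, f a = ∑ a ∈ Fintype.piFinset (fun _ : Fin d => S), f a :=
  Finset.sum_fiberwise_of_maps_to (fun _ ha => Finset.mem_image_of_mem _ ha) f

theorem sum_multiIdx_perm {E : Type*} [AddCommMonoid E] (S : Finset ℤ) (n : ℤ)
    (f : (Fin d → ℤ) → E) (σ : Equiv.Perm (Fin d)) :
    ∑ a ∈ multiIdx d S n, f (fun i => a (σ.symm i)) = ∑ a ∈ multiIdx d S n, f a := by
  refine Finset.sum_bij' (fun a _ i => a (σ.symm i)) (fun a _ i => a (σ i)) ?_ ?_ ?_ ?_ ?_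
  · intro a ha
    rw [mem_multiIdx] at ha ⊢
    exact ⟨fun i => ha.1 _, by rw [← ha.2]; exact Equiv.sum_comp σ.symm a⟩
  · intro a ha
    rw [mem_multiIdx] at ha ⊢
    exact ⟨fun i => ha.1 _, by rw [← ha.2]; exact Equiv.sum_comp σ a⟩
  · intro a _; funext i; simp
  · intro a _; funext i; simp
  · intro a _; rfl

/-- The projection of `H^{⊗ d}` onto its degree `n` part. -/
def tenProj (P : ℤ → H →ₗ[k] H) (S : Finset ℤ) (n : ℤ) :
    (PiTensorProduct k fun _ : Fin d => H) →ₗ[k] (PiTensorProduct k fun _ : Fin d => H) :=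
  ∑ a ∈ multiIdx d S n, PiTensorProduct.map fun i => P (a i)

theorem tenProj_tprod (P : ℤ → H →ₗ[k] H) (S : Finset ℤ) (n : ℤ) (x : Fin d → H) :
    tenProj P S n (PiTensorProduct.tprod k x) =
      ∑ a ∈ multiIdx d S n, PiTensorProduct.tprod k fun i => P (a i) (x i) := by
  simp [tenProj, LinearMap.sum_apply, PiTensorProduct.map_tprod]

theorem tenProj_reindex (P : ℤ → H →ₗ[k] H) (S : Finset ℤ) (n : ℤ) (σ : Equiv.Perm (Fin d))
    (t : PiTensorProduct k fun _ : Fin d => H) :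
    PiTensorProduct.reindex k (fun _ => H) σ (tenProj P S n t) =
      tenProj P S n (PiTensorProduct.reindex k (fun _ => H) σ t) := by
  induction t using ten_induction with
  | tprod x =>
    rw [PiTensorProduct.reindex_tprod, tenProj_tprod, tenProj_tprod, map_sum]
    simp only [PiTensorProduct.reindex_tprod]
    exact sum_multiIdx_perm S n
      (fun a => PiTensorProduct.tprod k fun i => P (a i) (x (σ.symm i))) σ
  | add s t hs ht => simp only [map_add, hs, ht]
  | smul a t ht => simp only [map_smul, ht]

/-- The projection of `Γ^d(H)` onto its degree `n` part. -/
def gamProj (P : ℤ → H →ₗ[k] H) (S : Finset ℤ) (n : ℤ) : Gam k d H →ₗ[k] Gam k d H where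
  toFun t := ⟨tenProj P S n (Gam.val t), fun σ => by rw [tenProj_reindex]; congr 1; exact t.2 σ⟩
  map_add' s t := Gam.ext (map_add (tenProj P S n) _ _)
  map_smul' a t := Gam.ext (map_smul (tenProj P S n) a _)

theorem gamDeg_internal [Module.Finite k H] {A : ℤ → Submodule k H} (h : DirectSum.IsInternal A) :
    DirectSum.IsInternal (gamDeg (d := d) A) := by
  classical
  obtain ⟨S, hS⟩ := proj_sum_fin h
  have hS := hS S subset_rfl
  have h0 : ∀ n ∉ S, ∀ x ∈ A n, x = 0 := by
    intro n hn x hx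
    rw [hS x]
    refine Finset.sum_eq_zero fun m hm => proj_ne h m n (fun e => hn (e ▸ hm)) x hx
  have key : ∀ n m, ∀ t ∈ tenDeg (d := d) A n,
      tenProj (proj h) S m t = if m = n then t else 0 := by
    intro n m t ht
    induction ht using Submodule.span_induction with
    | mem t ht =>
      obtain ⟨b, x, hb, hx, rfl⟩ := ht
      rw [tenProj_tprod]
      by_cases hbS : ∀ i, b i ∈ S
      · have hz : ∀ a ∈ multiIdx d S m, a ≠ b →
            (PiTensorProduct.tprod k fun i => proj h (a i) (x i)) = 0 := by
          intro a _ hab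
          obtain ⟨i, hi⟩ := Function.ne_iff.1 hab
          exact MultilinearMap.map_coord_zero _ i (proj_ne h _ _ hi _ (hx i))
        split_ifs with hmn
        · rw [Finset.sum_eq_single_of_mem b (mem_multiIdx.2 ⟨hbS, hb.trans hmn.symm⟩) hz]
          congr 1
          funext i
          exact proj_same h _ _ (hx i)
        · refine Finset.sum_eq_zero fun a ha => hz a ha ?_
          rintro rfl
          exact hmn ((mem_multiIdx.1 ha).2.symm.trans hb)
      · push Not at hbS
        obtain ⟨i, hi⟩ := hbS
        have hxi := h0 _ hi _ (hx i)
        have e : PiTensorProduct.tprod k x = 0 := MultilinearMap.map_coord_zero _ i hxi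
        rw [e, ite_self]
        refine Finset.sum_eq_zero fun a _ => MultilinearMap.map_coord_zero _ i ?_
        rw [hxi, map_zero]
    | zero => simp
    | add s t _ _ hs ht => rw [map_add, hs, ht]; split_ifs <;> simp
    | smul a t _ ht => rw [map_smul, ht]; split_ifs <;> simp
  have hmem : ∀ n (t : PiTensorProduct k fun _ : Fin d => H),
      tenProj (proj h) S n t ∈ tenDeg A n := by
    intro n t
    induction t using ten_induction with
    | tprod x =>
      rw [tenProj_tprod]
      exact Submodule.sum_mem _ fun a ha =>
        tprod_mem_tenDeg a _ (mem_multiIdx.1 ha).2 fun i => proj_mem h _ _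
    | add s t hs ht => rw [map_add]; exact Submodule.add_mem _ hs ht
    | smul a t ht => rw [map_smul]; exact Submodule.smul_mem _ a ht
  have hsum : ∀ t : PiTensorProduct k fun _ : Fin d => H,
      t = ∑ n ∈ totals d S, tenProj (proj h) S n t := by
    intro t
    induction t using ten_induction with
    | tprod x =>
      simp only [tenProj_tprod]
      rw [sum_totals S fun a => PiTensorProduct.tprod k fun i => proj h (a i) (x i)]
      rw [← MultilinearMap.map_sum_finset (PiTensorProduct.tprod k) (fun i j => proj h j (x i))]
      congr 1
      funext i
      exact hS (x i)
    | add s t hs ht => simp only [map_add, Finset.sum_add_distrib]; rw [← hs, ← ht]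
    | smul a t ht => simp only [map_smul, ← Finset.smul_sum]; rw [← ht]
  refine isInternal_of_proj _ (gamProj (proj h) S) (fun n t => hmem n _) ?_ ?_ ?_
  · intro n t ht
    refine Gam.ext ((key n n _ ht).trans (if_pos rfl))
  · intro m n hmn t ht
    refine Gam.ext ((key n m _ ht).trans (if_neg hmn))
  · intro t
    refine ⟨totals d S, Gam.ext ?_⟩
    rw [map_sum]
    exact hsum _

end Gam


/-! ### Graded linear categories and the categories `Γ^d C` -/

/-- A graded `k`-linear category (with finite dimensional morphism spaces): the morphism spaces
are graded, identities have degree zero and composition adds degrees. -/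
class GradedCat (k : Type u) [Field k] (C : Type v) [Category.{u} C] [Preadditive C]
    [Linear k C] where
  deg (X Y : C) : ℤ → Submodule k (X ⟶ Y)
  internal (X Y : C) : DirectSum.IsInternal (deg X Y)
  finite (X Y : C) : Module.Finite k (X ⟶ Y)
  id_mem (X : C) : 𝟙 X ∈ deg X X 0
  comp_mem {X Y Z : C} {m n : ℤ} {f : X ⟶ Y} {g : Y ⟶ Z} :
    f ∈ deg X Y m → g ∈ deg Y Z n → f ≫ g ∈ deg X Z (m + n)

/-- A `k`-linear functor between graded categories that preserves the degrees of morphisms. -/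
structure IsGradedLinear (k : Type u) [Field k] {C : Type v} [Category.{u} C] [Preadditive C]
    [Linear k C] [GradedCat k C] {E : Type w} [Category.{u} E] [Preadditive E] [Linear k E]
    [GradedCat k E] (G : C ⥤ E) : Prop where
  map_add {X Y : C} (f g : X ⟶ Y) : G.map (f + g) = G.map f + G.map g
  map_smul {X Y : C} (a : k) (f : X ⟶ Y) : G.map (a • f) = a • G.map f
  map_deg {X Y : C} (n : ℤ) (f : X ⟶ Y) :
    f ∈ GradedCat.deg (k := k) X Y n → G.map f ∈ GradedCat.deg (k := k) (G.obj X) (G.obj Y) n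

/-- A contravariant `k`-linear functor between graded categories that preserves the degrees of
morphisms. -/
structure IsGradedContra (k : Type u) [Field k] {C : Type v} [Category.{u} C] [Preadditive C]
    [Linear k C] [GradedCat k C] {E : Type w} [Category.{u} E] [Preadditive E] [Linear k E]
    [GradedCat k E] (G : Cᵒᵖ ⥤ E) : Prop where
  map_add {X Y : C} (f g : X ⟶ Y) : G.map (f + g).op = G.map f.op + G.map g.op
  map_smul {X Y : C} (a : k) (f : X ⟶ Y) : G.map (a • f).op = a • G.map f.op
  map_deg {X Y : C} (n : ℤ) (f : X ⟶ Y) : f ∈ GradedCat.deg (k := k) X Y n →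
    G.map f.op ∈ GradedCat.deg (k := k) (G.obj (Opposite.op Y)) (G.obj (Opposite.op X)) n

/-- A graded `k`-linear functor from a graded category to graded vector spaces. -/
structure IsGraded (k : Type u) [Field k] {C : Type v} [Category.{u} C] [Preadditive C]
    [Linear k C] [GradedCat k C] (F : C ⥤ GrVect k) : Prop where
  map_add {X Y : C} (f g : X ⟶ Y) : (F.map (f + g)).lin = (F.map f).lin + (F.map g).lin
  map_smul {X Y : C} (a : k) (f : X ⟶ Y) : (F.map (a • f)).lin = a • (F.map f).lin
  map_deg {X Y : C} (n : ℤ) (f : X ⟶ Y) : f ∈ GradedCat.deg (k := k) X Y n →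
    (F.map f).lin ∈ GrVect.degHom (F.obj X) (F.obj Y) n

/-- The category `Γ^d C`: the objects are those of `C`, and
`Hom_{Γ^d C}(X, Y) = Γ^d (Hom_C(X, Y))`. -/
structure GamCat (k : Type u) (d : ℕ) (C : Type v) where
  obj : C

section

variable {k : Type u} [Field k] {d : ℕ} {C : Type v} [Category.{u} C] [Preadditive C] [Linear k C]

theorem tenMap₂_assoc {X Y Z W : C} (s : PiTensorProduct k fun _ : Fin d => (X ⟶ Y))
    (t : PiTensorProduct k fun _ : Fin d => (Y ⟶ Z))
    (u : PiTensorProduct k fun _ : Fin d => (Z ⟶ W)) :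
    tenMap₂ (Linear.comp X Z W) (tenMap₂ (Linear.comp X Y Z) s t) u =
      tenMap₂ (Linear.comp X Y W) s (tenMap₂ (Linear.comp Y Z W) t u) := by
  induction s using ten_induction with
  | tprod x =>
    induction t using ten_induction with
    | tprod y =>
      induction u using ten_induction with
      | tprod z => simp
      | add s t hs ht => simp only [map_add, hs, ht]
      | smul a t ht => simp only [map_smul, ht]
    | add s t hs ht => simp only [map_add, LinearMap.add_apply, hs, ht]
    | smul a t ht => simp only [map_smul, LinearMap.smul_apply, ht]
  | add s t hs ht => simp only [map_add, LinearMap.add_apply, hs, ht]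
  | smul a t ht => simp only [map_smul, LinearMap.smul_apply, ht]

theorem tenMap₂_id_left {X Y : C} (s : PiTensorProduct k fun _ : Fin d => (X ⟶ Y)) :
    tenMap₂ (Linear.comp X X Y) (PiTensorProduct.tprod k fun _ => 𝟙 X) s = s := by
  induction s using ten_induction with
  | tprod x => simp
  | add s t hs ht => simp only [map_add, hs, ht]
  | smul a t ht => simp only [map_smul, ht]

theorem tenMap₂_id_right {X Y : C} (s : PiTensorProduct k fun _ : Fin d => (X ⟶ Y)) :
    tenMap₂ (Linear.comp X Y Y) s (PiTensorProduct.tprod k fun _ => 𝟙 Y) = s := by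
  induction s using ten_induction with
  | tprod x => simp
  | add s t hs ht => simp only [map_add, LinearMap.add_apply, hs, ht]
  | smul a t ht => simp only [map_smul, LinearMap.smul_apply, ht]

instance : Category.{u} (GamCat k d C) where
  Hom X Y := Gam k d (X.obj ⟶ Y.obj)
  id X := gamDiag (𝟙 X.obj)
  comp {X Y Z} f g := gamMap₂ (Linear.comp X.obj Y.obj Z.obj) f g
  id_comp _ := Gam.ext (tenMap₂_id_left _)
  comp_id _ := Gam.ext (tenMap₂_id_right _)
  assoc _ _ _ := Gam.ext (tenMap₂_assoc _ _ _)

/-- The symmetric tensor underlying a morphism of `Γ^d C`. -/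
def GamCat.ten {X Y : GamCat k d C} (f : X ⟶ Y) : Gam k d (X.obj ⟶ Y.obj) := f

theorem GamCat.comp_eq {X Y Z : GamCat k d C} (f : X ⟶ Y) (g : Y ⟶ Z) :
    f ≫ g = gamMap₂ (Linear.comp X.obj Y.obj Z.obj) (GamCat.ten f) (GamCat.ten g) := rfl

instance : Preadditive (GamCat k d C) where
  homGroup X Y := inferInstanceAs (AddCommGroup (Gam k d (X.obj ⟶ Y.obj)))
  add_comp X Y Z f f' g := LinearMap.map_add₂ (gamMap₂ (Linear.comp X.obj Y.obj Z.obj))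
    (GamCat.ten f) (GamCat.ten f') (GamCat.ten g)
  comp_add X Y Z f g g' := map_add (gamMap₂ (Linear.comp X.obj Y.obj Z.obj) (GamCat.ten f))
    (GamCat.ten g) (GamCat.ten g')

instance : Linear k (GamCat k d C) where
  homModule X Y := inferInstanceAs (Module k (Gam k d (X.obj ⟶ Y.obj)))
  smul_comp X Y Z a f g := LinearMap.map_smul₂ (gamMap₂ (Linear.comp X.obj Y.obj Z.obj))
    a (GamCat.ten f) (GamCat.ten g)
  comp_smul X Y Z f a g := map_smul (gamMap₂ (Linear.comp X.obj Y.obj Z.obj) (GamCat.ten f))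
    a (GamCat.ten g)

variable [GradedCat k C]

instance : GradedCat k (GamCat k d C) where
  deg X Y n := gamDeg (GradedCat.deg (k := k) X.obj Y.obj) n
  internal X Y := by
    have := GradedCat.finite (k := k) X.obj Y.obj
    exact gamDeg_internal (GradedCat.internal X.obj Y.obj)
  finite X Y := by
    have := GradedCat.finite (k := k) X.obj Y.obj
    exact inferInstanceAs (Module.Finite k (Gam k d (X.obj ⟶ Y.obj)))
  id_mem X := tprod_mem_tenDeg (fun _ => 0) _ (by simp) fun _ => GradedCat.id_mem X.obj
  comp_mem {X Y Z m n f g} hf hg :=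
    tenMap₂_mem (A := GradedCat.deg X.obj Y.obj) (B := GradedCat.deg Y.obj Z.obj)
      (C := GradedCat.deg X.obj Z.obj) (c := Linear.comp X.obj Y.obj Z.obj)
      (fun _ _ _ hx _ hy => GradedCat.comp_mem hx hy) m n _ hf _ hg

variable {E : Type w} [Category.{u} E] [Preadditive E] [Linear k E] [GradedCat k E]

/-- The linear map on morphism spaces given by a linear functor. -/
def IsGradedLinear.lin {G : C ⥤ E} (hG : IsGradedLinear k G) (X Y : C) :
    (X ⟶ Y) →ₗ[k] (G.obj X ⟶ G.obj Y) where
  toFun f := G.map f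
  map_add' := hG.map_add
  map_smul' := hG.map_smul

/-- The linear map on morphism spaces given by a contravariant linear functor. -/
def IsGradedContra.lin {G : Cᵒᵖ ⥤ E} (hG : IsGradedContra k G) (X Y : C) :
    (X ⟶ Y) →ₗ[k] (G.obj (Opposite.op Y) ⟶ G.obj (Opposite.op X)) where
  toFun f := G.map f.op
  map_add' := hG.map_add
  map_smul' := hG.map_smul

/-- The functor `Γ^d C ⥤ Γ^d E` induced by a linear functor `C ⥤ E`. -/
def gamFunctor (d : ℕ) (G : C ⥤ E) (hG : IsGradedLinear k G) : GamCat k d C ⥤ GamCat k d E where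
  obj X := ⟨G.obj X.obj⟩
  map {X Y} f := gamMap (hG.lin X.obj Y.obj) (GamCat.ten f)
  map_id X := Gam.ext <| (tenMap_tprod _ _).trans <| by
    change (PiTensorProduct.tprod k fun _ => G.map (𝟙 X.obj)) = _
    rw [G.map_id]
    rfl
  map_comp {X Y Z} f g := Gam.ext <| by
    change tenMap (hG.lin X.obj Z.obj) (tenMap₂ (Linear.comp X.obj Y.obj Z.obj)
        (Gam.val (GamCat.ten f)) (Gam.val (GamCat.ten g))) =
      tenMap₂ (Linear.comp _ _ _) (tenMap (hG.lin X.obj Y.obj) (Gam.val (GamCat.ten f)))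
        (tenMap (hG.lin Y.obj Z.obj) (Gam.val (GamCat.ten g)))
    generalize Gam.val (GamCat.ten f) = s
    generalize Gam.val (GamCat.ten g) = t
    induction s using ten_induction with
    | tprod x =>
      induction t using ten_induction with
      | tprod y => simp [IsGradedLinear.lin]
      | add s t hs ht => simp only [map_add, hs, ht]
      | smul a t ht => simp only [map_smul, ht]
    | add s t hs ht => simp only [map_add, LinearMap.add_apply, hs, ht]
    | smul a t ht => simp only [map_smul, LinearMap.smul_apply, ht]

theorem gamFunctor_isGradedLinear (d : ℕ) (G : C ⥤ E) (hG : IsGradedLinear k G) :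
    IsGradedLinear k (gamFunctor d G hG) where
  map_add {X Y} f g := map_add (gamMap (hG.lin X.obj Y.obj)) f g
  map_smul {X Y} a f := map_smul (gamMap (hG.lin X.obj Y.obj)) a f
  map_deg {X Y} n f hf :=
    gamMap_mem (φ := hG.lin X.obj Y.obj) (fun m x hx => hG.map_deg m x hx) n f hf

/-- The contravariant functor from `Γ^d C` to `Γ^d E` induced by a contravariant linear functor
from `C` to `E`. -/
def gamFunctorOp (d : ℕ) (G : Cᵒᵖ ⥤ E) (hG : IsGradedContra k G) :
    (GamCat k d C)ᵒᵖ ⥤ GamCat k d E where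
  obj X := ⟨G.obj (Opposite.op X.unop.obj)⟩
  map {X Y} f := gamMap (hG.lin Y.unop.obj X.unop.obj) (GamCat.ten f.unop)
  map_id X := Gam.ext <| (tenMap_tprod _ _).trans <| by
    change (PiTensorProduct.tprod k fun _ => G.map (𝟙 (Opposite.op X.unop.obj))) = _
    rw [G.map_id]
    rfl
  map_comp {X Y Z} f g := Gam.ext <| by
    change tenMap (hG.lin Z.unop.obj X.unop.obj)
        (tenMap₂ (Linear.comp Z.unop.obj Y.unop.obj X.unop.obj)
          (Gam.val (GamCat.ten g.unop)) (Gam.val (GamCat.ten f.unop))) =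
      tenMap₂ (Linear.comp _ _ _)
        (tenMap (hG.lin Y.unop.obj X.unop.obj) (Gam.val (GamCat.ten f.unop)))
        (tenMap (hG.lin Z.unop.obj Y.unop.obj) (Gam.val (GamCat.ten g.unop)))
    generalize Gam.val (GamCat.ten f.unop) = s
    generalize Gam.val (GamCat.ten g.unop) = t
    induction s using ten_induction with
    | tprod x =>
      induction t using ten_induction with
      | tprod y => simp [IsGradedContra.lin]
      | add s t hs ht => simp only [map_add, LinearMap.add_apply, hs, ht]
      | smul a t ht => simp only [map_smul, LinearMap.smul_apply, ht]
    | add s t hs ht => simp only [map_add, LinearMap.add_apply, hs, ht]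
    | smul a t ht => simp only [map_smul, LinearMap.smul_apply, ht]

theorem gamFunctorOp_isGradedContra (d : ℕ) (G : Cᵒᵖ ⥤ E) (hG : IsGradedContra k G) :
    IsGradedContra k (gamFunctorOp d G hG) where
  map_add {X Y} f g := map_add (gamMap (hG.lin X.obj Y.obj)) f g
  map_smul {X Y} a f := map_smul (gamMap (hG.lin X.obj Y.obj)) a f
  map_deg {X Y} n f hf :=
    gamMap_mem (φ := hG.lin X.obj Y.obj) (fun m x hx => hG.map_deg m x hx) n f hf

end


/-! ### Graded objects of a graded category, and graded extensions of functors -/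

section

variable {k : Type u} [Field k] {C : Type v} [Category.{u} C] [Preadditive C]
  [Linear k C] [GradedCat k C]

/-- A graded object of a graded category `C`: an object decomposed into finitely many pieces
labelled by integers. The piece with label `j` is given by the idempotent `π j`, and is thought
of as placed in degree `j`. For `C` the category of finite dimensional spaces this is a graded
finite dimensional space. -/
structure GrObj (k : Type u) [Field k] (C : Type v) [Category.{u} C] [Preadditive C]
    [Linear k C] [GradedCat k C] where
  obj : C
  labels : Finset ℤ
  π : ℤ → (obj ⟶ obj)
  π_zero : ∀ j ∉ labels, π j = 0
  π_same : ∀ j, π j ≫ π j = π j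
  π_ne : ∀ i j, i ≠ j → π i ≫ π j = 0
  π_sum : ∑ j ∈ labels, π j = 𝟙 obj
  π_deg : ∀ j, π j ∈ GradedCat.deg (k := k) obj obj 0

namespace GrObj

instance : Category.{u} (GrObj k C) where
  Hom X Y := X.obj ⟶ Y.obj
  id X := 𝟙 X.obj
  comp {X Y Z} f g := CategoryStruct.comp (X := X.obj) (Y := Y.obj) (Z := Z.obj) f g
  id_comp {X Y} f := Category.id_comp (X := X.obj) (Y := Y.obj) f
  comp_id {X Y} f := Category.comp_id (X := X.obj) (Y := Y.obj) f
  assoc {X Y Z W} f g h :=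
    Category.assoc (W := X.obj) (X := Y.obj) (Y := Z.obj) (Z := W.obj) f g h

instance : Preadditive (GrObj k C) where
  homGroup X Y := inferInstanceAs (AddCommGroup (X.obj ⟶ Y.obj))
  add_comp X Y Z f f' g := Preadditive.add_comp X.obj Y.obj Z.obj f f' g
  comp_add X Y Z f g g' := Preadditive.comp_add X.obj Y.obj Z.obj f g g'

instance : Linear k (GrObj k C) where
  homModule X Y := inferInstanceAs (Module k (X.obj ⟶ Y.obj))
  smul_comp X Y Z a f g := Linear.smul_comp X.obj Y.obj Z.obj a f g
  comp_smul X Y Z f a g := Linear.comp_smul X.obj Y.obj Z.obj f a g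

/-- Morphisms of degree `n` between graded objects: the component from the piece with label `i`
to the piece with label `j` has degree `n + i - j` in `C`. -/
def deg (X Y : GrObj k C) (n : ℤ) : Submodule k (X.obj ⟶ Y.obj) where
  carrier := {f | ∀ i j, X.π i ≫ f ≫ Y.π j ∈ GradedCat.deg (k := k) X.obj Y.obj (n + i - j)}
  add_mem' {f g} hf hg i j := by
    rw [Preadditive.add_comp, Preadditive.comp_add]; exact Submodule.add_mem _ (hf i j) (hg i j)
  zero_mem' i j := by
    rw [Limits.zero_comp, Limits.comp_zero]; exact Submodule.zero_mem _
  smul_mem' a f hf i j := by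
    rw [Linear.smul_comp, Linear.comp_smul]; exact Submodule.smul_mem _ a (hf i j)

theorem decomp (X Y : GrObj k C) (f : X.obj ⟶ Y.obj) :
    f = ∑ i ∈ X.labels, ∑ j ∈ Y.labels, X.π i ≫ f ≫ Y.π j := by
  have h1 : ∀ i, ∑ j ∈ Y.labels, X.π i ≫ f ≫ Y.π j = X.π i ≫ f := by
    intro i
    rw [← Preadditive.comp_sum, ← Preadditive.comp_sum, Y.π_sum, Category.comp_id]
  simp only [h1]
  rw [← Preadditive.sum_comp, X.π_sum, Category.id_comp]

/-- Composition with the idempotents `π i` and `π j`, as a linear map. -/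
def corner (X Y : GrObj k C) (i j : ℤ) : (X.obj ⟶ Y.obj) →ₗ[k] (X.obj ⟶ Y.obj) where
  toFun f := X.π i ≫ f ≫ Y.π j
  map_add' f g := by rw [Preadditive.add_comp, Preadditive.comp_add]
  map_smul' a f := by rw [Linear.smul_comp, Linear.comp_smul]; rfl

theorem corner_apply (X Y : GrObj k C) (i j : ℤ) (f : X.obj ⟶ Y.obj) :
    corner X Y i j f = X.π i ≫ f ≫ Y.π j := rfl

theorem corner_corner (X Y : GrObj k C) (i j i' j' : ℤ) (f : X.obj ⟶ Y.obj) :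
    corner X Y i j (corner X Y i' j' f) = if i = i' ∧ j = j' then corner X Y i j f else 0 := by
  simp only [corner_apply]
  by_cases hi : i = i'
  · subst hi
    rw [← Category.assoc, ← Category.assoc, X.π_same]
    by_cases hj : j = j'
    · subst hj
      simp [Category.assoc, Y.π_same]
    · rw [if_neg fun h => hj h.2]
      simp [Category.assoc, Y.π_ne j' j (Ne.symm hj)]
  · rw [if_neg fun h => hi h.1, ← Category.assoc, ← Category.assoc, X.π_ne i i' hi]
    simp

theorem corner_deg (X Y : GrObj k C) (i j n : ℤ) (f : X.obj ⟶ Y.obj)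
    (hf : f ∈ GradedCat.deg (k := k) X.obj Y.obj n) :
    corner X Y i j f ∈ GradedCat.deg (k := k) X.obj Y.obj n := by
  have := GradedCat.comp_mem (X.π_deg i) (GradedCat.comp_mem hf (Y.π_deg j))
  simpa [corner_apply] using this

/-- The projection onto the morphisms of degree `n`. -/
def degProj (X Y : GrObj k C) (n : ℤ) : (X.obj ⟶ Y.obj) →ₗ[k] (X.obj ⟶ Y.obj) :=
  ∑ i ∈ X.labels, ∑ j ∈ Y.labels,
    corner X Y i j ∘ₗ proj (GradedCat.internal (k := k) X.obj Y.obj) (n + i - j)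

theorem degProj_apply (X Y : GrObj k C) (n : ℤ) (f : X.obj ⟶ Y.obj) :
    degProj X Y n f = ∑ i ∈ X.labels, ∑ j ∈ Y.labels,
      corner X Y i j (proj (GradedCat.internal (k := k) X.obj Y.obj) (n + i - j) f) := by
  simp [degProj, LinearMap.sum_apply]

theorem corner_proj (X Y : GrObj k C) (i j n : ℤ) (f : X.obj ⟶ Y.obj) :
    corner X Y i j (proj (GradedCat.internal (k := k) X.obj Y.obj) n f) =
      proj (GradedCat.internal (k := k) X.obj Y.obj) n (corner X Y i j f) := by
  obtain ⟨T, hT⟩ := proj_sum' (GradedCat.internal (k := k) X.obj Y.obj) f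
  conv_lhs => rw [hT]
  conv_rhs => rw [hT]
  simp only [map_sum]
  refine Finset.sum_congr rfl fun m _ => ?_
  by_cases h : n = m
  · subst h
    rw [proj_same _ n (proj _ n f) (proj_mem _ _ _),
      proj_same _ n _ (corner_deg X Y i j n _ (proj_mem _ _ _))]
  · rw [proj_ne _ n m h (proj _ m f) (proj_mem _ _ _),
      proj_ne _ n m h _ (corner_deg X Y i j m _ (proj_mem _ _ _)), map_zero]

theorem deg_internal (X Y : GrObj k C) : DirectSum.IsInternal (deg X Y) := by
  classical
  refine isInternal_of_proj (deg X Y) (degProj X Y) ?_ ?_ ?_ ?_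
  · intro n f i j
    rw [← corner_apply, degProj_apply]
    simp only [map_sum]
    refine Submodule.sum_mem _ fun i' _ => Submodule.sum_mem _ fun j' _ => ?_
    rw [corner_corner]
    split_ifs with h
    · obtain ⟨rfl, rfl⟩ := h
      exact corner_deg X Y _ _ _ _ (proj_mem _ _ _)
    · exact Submodule.zero_mem _
  · intro n f hf
    rw [degProj_apply]
    conv_rhs => rw [decomp X Y f]
    refine Finset.sum_congr rfl fun i _ => Finset.sum_congr rfl fun j _ => ?_
    rw [corner_proj]
    exact proj_same _ _ _ (hf i j)
  · intro m n hmn f hf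
    rw [degProj_apply]
    refine Finset.sum_eq_zero fun i _ => Finset.sum_eq_zero fun j _ => ?_
    rw [corner_proj]
    exact proj_ne _ _ (n + i - j) (by omega) _ (hf i j)
  · intro f
    obtain ⟨S, hS⟩ := proj_sum (GradedCat.internal (k := k) X.obj Y.obj) f
    let T : Finset ℤ := (X.labels ×ˢ Y.labels).biUnion fun q =>
      S.map (Equiv.addRight (q.2 - q.1)).toEmbedding
    refine ⟨T, ?_⟩
    simp only [degProj_apply]
    rw [Finset.sum_comm]
    conv_lhs => rw [decomp X Y f]
    refine Finset.sum_congr rfl fun i hi => ?_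
    rw [Finset.sum_comm]
    refine Finset.sum_congr rfl fun j hj => ?_
    rw [← corner_apply, ← map_sum]
    congr 1
    have : ∑ n ∈ T, proj (GradedCat.internal (k := k) X.obj Y.obj) (n + i - j) f =
        ∑ n ∈ T.map (Equiv.addRight (i - j)).toEmbedding,
          proj (GradedCat.internal (k := k) X.obj Y.obj) n f := by
      rw [Finset.sum_map]
      refine Finset.sum_congr rfl fun n _ => ?_
      simp [add_sub_assoc]
    rw [this]
    refine hS _ fun n hn => Finset.mem_map.2 ⟨n + (j - i), ?_, by simp; ring⟩
    exact Finset.mem_biUnion.2 ⟨(i, j), Finset.mk_mem_product hi hj,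
      Finset.mem_map.2 ⟨n, hn, by simp⟩⟩

theorem deg_comp {X Y Z : GrObj k C} {m n : ℤ} {f : X.obj ⟶ Y.obj} {g : Y.obj ⟶ Z.obj}
    (hf : f ∈ deg X Y m) (hg : g ∈ deg Y Z n) : f ≫ g ∈ deg X Z (m + n) := by
  intro i j
  have e : X.π i ≫ (f ≫ g) ≫ Z.π j =
      ∑ l ∈ Y.labels, (X.π i ≫ f ≫ Y.π l) ≫ (Y.π l ≫ g ≫ Z.π j) := by
    have : ∀ l, (X.π i ≫ f ≫ Y.π l) ≫ (Y.π l ≫ g ≫ Z.π j) =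
        (X.π i ≫ f) ≫ Y.π l ≫ (g ≫ Z.π j) := by
      intro l
      simp only [Category.assoc]
      rw [← Category.assoc (Y.π l) (Y.π l), Y.π_same]
    simp only [this]
    rw [← Preadditive.comp_sum, ← Preadditive.sum_comp, Y.π_sum]
    simp
  rw [e]
  refine Submodule.sum_mem _ fun l _ => ?_
  have := GradedCat.comp_mem (hf i l) (hg l j)
  have e' : m + i - l + (n + l - j) = m + n + i - j := by ring
  rwa [e'] at this

instance : GradedCat k (GrObj k C) where
  deg X Y := deg X Y
  internal X Y := deg_internal X Y
  finite X Y := GradedCat.finite (k := k) X.obj Y.obj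
  id_mem X i j := by
    change X.π i ≫ 𝟙 X.obj ≫ X.π j ∈ _
    rw [Category.id_comp]
    by_cases h : i = j
    · subst h
      rw [X.π_same]
      simpa using X.π_deg i
    · rw [X.π_ne i j h]
      exact Submodule.zero_mem _
  comp_mem hf hg := deg_comp hf hg

/-- The object underlying a graded object. -/
def forget (k : Type u) [Field k] (C : Type v) [Category.{u} C] [Preadditive C]
    [Linear k C] [GradedCat k C] : GrObj k C ⥤ C where
  obj X := X.obj
  map f := f

/-- An object of `C`, placed in degree `n`. For `n = -s` this is the shift `X[s]`. -/
def single (n : ℤ) (X : C) : GrObj k C where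
  obj := X
  labels := {n}
  π j := if j = n then 𝟙 X else 0
  π_zero j hj := if_neg (by simpa using hj)
  π_same j := by split_ifs <;> simp
  π_ne i j hij := by
    by_cases hi : i = n
    · have : j ≠ n := fun h => hij (hi.trans h.symm)
      simp [this]
    · simp [hi]
  π_sum := by simp
  π_deg j := by
    split_ifs
    · exact GradedCat.id_mem X
    · exact Submodule.zero_mem _

/-- The functor placing objects of `C` in degree `n`. -/
def singleFunctor (k : Type u) [Field k] (C : Type v) [Category.{u} C] [Preadditive C]
    [Linear k C] [GradedCat k C] (n : ℤ) : C ⥤ GrObj k C where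
  obj X := single n X
  map f := f

theorem singleFunctor_isGradedLinear (n : ℤ) : IsGradedLinear k (singleFunctor k C n) where
  map_add _ _ := rfl
  map_smul _ _ := rfl
  map_deg {X Y} m f hf i j := by
    change (if i = n then 𝟙 X else 0) ≫ f ≫ (if j = n then 𝟙 Y else 0) ∈ _
    by_cases hi : i = n
    · by_cases hj : j = n
      · subst hi; subst hj
        rw [if_pos rfl, if_pos rfl, Category.comp_id, Category.id_comp, add_sub_cancel_right]
        exact hf
      · rw [if_neg hj, Limits.comp_zero, Limits.comp_zero]; exact Submodule.zero_mem _
    · rw [if_neg hi, Limits.zero_comp]; exact Submodule.zero_mem _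

end GrObj

end

/-! #### Regrading by weights -/

/-- A weight decomposition of a graded space `M`: commuting with the grading, with finitely many
weights. -/
structure Weights {k : Type u} [Field k] (M : GrVect k) where
  T : Finset ℤ
  ε : ℤ → M.carrier →ₗ[k] M.carrier
  ε_zero : ∀ m ∉ T, ε m = 0
  ε_same : ∀ m x, ε m (ε m x) = ε m x
  ε_ne : ∀ m l, m ≠ l → ∀ x, ε m (ε l x) = 0
  ε_sum : ∀ x, ∑ m ∈ T, ε m x = x
  ε_deg : ∀ m, ε m ∈ GrVect.degHom M M 0

namespace Weights

variable {k : Type u} [Field k] {M : GrVect k} (W : Weights M)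

/-- The new grading: the piece of weight `m` and degree `s` is put in degree `s + m`. So `x` has
degree `n` if and only if its component of weight `m` has old degree `n - m`, for all `m`. -/
def gr (n : ℤ) : Submodule k M.carrier := ⨅ m, (M.gr (n - m)).comap (W.ε m)

theorem mem_gr {n : ℤ} {x : M.carrier} : x ∈ W.gr n ↔ ∀ m, W.ε m x ∈ M.gr (n - m) := by
  simp [gr, Submodule.mem_iInf]

theorem ε_ite (m l : ℤ) (x : M.carrier) : W.ε m (W.ε l x) = if m = l then W.ε m x else 0 := by
  split_ifs with h
  · subst h; exact W.ε_same m x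
  · exact W.ε_ne m l h x

theorem ε_proj (m n : ℤ) (x : M.carrier) :
    W.ε m (proj M.internal n x) = proj M.internal n (W.ε m x) := by
  have hd : ∀ l, W.ε m (proj M.internal l x) ∈ M.gr l := fun l => by
    simpa using W.ε_deg m l _ (proj_mem M.internal l x)
  obtain ⟨T, hT⟩ := proj_sum' M.internal x
  conv_lhs => rw [hT]
  conv_rhs => rw [hT]
  simp only [map_sum]
  refine Finset.sum_congr rfl fun l _ => ?_
  by_cases h : n = l
  · subst h
    rw [proj_same M.internal n (proj _ n x) (proj_mem _ _ _), proj_same M.internal n _ (hd n)]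
  · rw [proj_ne M.internal n l h (proj _ l x) (proj_mem _ _ _), proj_ne M.internal n l h _ (hd l),
      map_zero]

/-- The projection onto the new degree `n` part. -/
def projW (n : ℤ) : M.carrier →ₗ[k] M.carrier :=
  ∑ m ∈ W.T, W.ε m ∘ₗ proj M.internal (n - m)

theorem projW_apply (n : ℤ) (x : M.carrier) :
    W.projW n x = ∑ m ∈ W.T, W.ε m (proj M.internal (n - m) x) := by
  simp [projW, LinearMap.sum_apply]

theorem gr_internal : DirectSum.IsInternal W.gr := by
  classical
  refine isInternal_of_proj W.gr W.projW ?_ ?_ ?_ ?_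
  · intro n x
    rw [mem_gr]
    intro m
    rw [projW_apply, map_sum]
    refine Submodule.sum_mem _ fun l _ => ?_
    rw [ε_ite]
    split_ifs with h
    · subst h
      simpa using W.ε_deg m _ _ (proj_mem M.internal (n - m) x)
    · exact Submodule.zero_mem _
  · intro n x hx
    rw [mem_gr] at hx
    rw [projW_apply]
    conv_rhs => rw [← W.ε_sum x]
    refine Finset.sum_congr rfl fun m _ => ?_
    rw [ε_proj, proj_same M.internal _ _ (hx m)]
  · intro n l hnl x hx
    rw [mem_gr] at hx
    rw [projW_apply]
    refine Finset.sum_eq_zero fun m _ => ?_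
    rw [ε_proj]
    exact proj_ne M.internal _ (l - m) (by omega) _ (hx m)
  · intro x
    obtain ⟨S, hS⟩ := proj_sum M.internal x
    let T' : Finset ℤ := W.T.biUnion fun m => S.map (Equiv.addRight m).toEmbedding
    refine ⟨T', ?_⟩
    simp only [projW_apply]
    rw [Finset.sum_comm]
    conv_lhs => rw [← W.ε_sum x]
    refine Finset.sum_congr rfl fun m hm => ?_
    rw [← map_sum]
    congr 1
    have : ∑ n ∈ T', proj M.internal (n - m) x =
        ∑ n ∈ T'.map (Equiv.addRight (-m)).toEmbedding, proj M.internal n x := by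
      rw [Finset.sum_map]
      rfl
    rw [this]
    refine hS _ fun n hn => Finset.mem_map.2 ⟨n + m, ?_, by simp⟩
    exact Finset.mem_biUnion.2 ⟨m, hm, Finset.mem_map.2 ⟨n, hn, by simp⟩⟩

theorem gr_finite (n : ℤ) : Module.Finite k (W.gr n) := by
  have := fun m => M.finite m
  let φ : W.gr n →ₗ[k] ((m : W.T) → M.gr (n - m)) :=
    LinearMap.pi fun m => (W.ε m).restrict fun x hx => (W.mem_gr.1 hx) m
  refine Module.Finite.of_injective φ ((injective_iff_map_eq_zero φ).2 ?_)
  intro x hx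
  refine Subtype.ext ?_
  change x.1 = 0
  rw [← W.ε_sum x.1]
  refine Finset.sum_eq_zero fun m hm => ?_
  exact congrArg Subtype.val (congrFun hx ⟨m, hm⟩)

/-- The graded space with the new grading. -/
def regrade : GrVect k where
  carrier := M.carrier
  gr := W.gr
  internal := W.gr_internal
  finite := W.gr_finite

variable {N : GrVect k} (W' : Weights N)

theorem corner_mem {j : ℤ} {f : M.carrier →ₗ[k] N.carrier} (hf : f ∈ GrVect.degHom M N j)
    (m l : ℤ) : W'.ε l ∘ₗ f ∘ₗ W.ε m ∈ GrVect.degHom W.regrade W'.regrade (j + l - m) := by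
  intro n x hx
  have hx := W.mem_gr.1 hx m
  refine W'.mem_gr.2 fun l' => ?_
  change W'.ε l' (W'.ε l (f (W.ε m x))) ∈ _
  rw [ε_ite]
  split_ifs with h
  · subst h
    have := W'.ε_deg l' _ _ (hf _ _ hx)
    have e : n - m + j + 0 = n + (j + l' - m) - l' := by ring
    rwa [e] at this
  · exact Submodule.zero_mem _

theorem sum_corner (f : M.carrier →ₗ[k] N.carrier) :
    f = ∑ m ∈ W.T, ∑ l ∈ W'.T, W'.ε l ∘ₗ f ∘ₗ W.ε m := by
  refine LinearMap.ext fun x => ?_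
  simp only [LinearMap.sum_apply, LinearMap.comp_apply, W'.ε_sum]
  rw [← map_sum, W.ε_sum]

theorem mem_grHom {f : M.carrier →ₗ[k] N.carrier} (hf : f ∈ GrVect.grHom M N) :
    f ∈ GrVect.grHom W.regrade W'.regrade := by
  induction hf using Submodule.iSup_induction' with
  | mem j f hf =>
    rw [sum_corner W W' f]
    exact Submodule.sum_mem _ fun m _ => Submodule.sum_mem _ fun l _ =>
      GrVect.degHom_le _ _ _ (corner_mem W W' hf m l)
  | zero => exact Submodule.zero_mem _
  | add f g _ _ hf hg => exact Submodule.add_mem _ hf hg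

/-- A map is homogeneous of degree `n` for the new gradings as soon as its components from weight
`m` to weight `l` are homogeneous of degree `n + m - l` for the old ones. -/
theorem mem_degHom {n : ℤ} {f : M.carrier →ₗ[k] N.carrier}
    (hf : ∀ m l, W'.ε l ∘ₗ f ∘ₗ W.ε m ∈ GrVect.degHom M N (n + m - l)) :
    f ∈ GrVect.degHom W.regrade W'.regrade n := by
  rw [sum_corner W W' f]
  refine Submodule.sum_mem _ fun m _ => Submodule.sum_mem _ fun l _ => ?_
  have h := corner_mem W W' (hf m l) m l
  have e : n + m - l + l - m = n := by ring
  rw [e] at h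
  have e' : W'.ε l ∘ₗ (W'.ε l ∘ₗ f ∘ₗ W.ε m) ∘ₗ W.ε m = W'.ε l ∘ₗ f ∘ₗ W.ε m :=
    LinearMap.ext fun x => by simp [W.ε_same, W'.ε_same]
  rwa [e'] at h

end Weights


section

variable {k : Type u} [Field k] {d : ℕ} {C : Type v} [Category.{u} C] [Preadditive C]
  [Linear k C] [GradedCat k C]

/-- The tensor `∑ π_{a₁} ⊗ ⋯ ⊗ π_{a_d}` over all `a` with `a₁ + ⋯ + a_d = m`. -/
def weightTen (d : ℕ) (X : GrObj k C) (m : ℤ) : PiTensorProduct k fun _ : Fin d => (X.obj ⟶ X.obj) :=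
  ∑ a ∈ multiIdx d X.labels m, PiTensorProduct.tprod k fun i => X.π (a i)

/-- The idempotent in `Γ^d (End X)` onto the part of total weight `m`: if `X = ⨁ X_j` with `X_j`
placed in degree `j`, it projects onto the sum of the parts of multidegree `γ` in the `X_j`
over all `γ` with `∑ j γ_j = m`. -/
def weight (d : ℕ) (X : GrObj k C) (m : ℤ) : Gam k d (X.obj ⟶ X.obj) :=
  ⟨weightTen d X m, fun σ => by
    rw [weightTen, map_sum]
    simp only [PiTensorProduct.reindex_tprod]
    exact sum_multiIdx_perm X.labels m (fun a => PiTensorProduct.tprod k fun i => X.π (a i)) σ⟩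

/-- `weight`, as an endomorphism in `Γ^d C`. -/
def weightHom (X : GrObj k C) (m : ℤ) :
    (⟨X.obj⟩ : GamCat k d C) ⟶ (⟨X.obj⟩ : GamCat k d C) := weight d X m

theorem weightHom_zero (X : GrObj k C) (m : ℤ) (hm : m ∉ totals d X.labels) :
    weightHom (d := d) X m = 0 := Gam.ext <| by
  change weightTen d X m = _
  rw [weightTen, multiIdx_of_notMem hm, Finset.sum_empty]
  rfl

theorem weightHom_sum (X : GrObj k C) :
    ∑ m ∈ totals d X.labels, weightHom (d := d) X m = 𝟙 (⟨X.obj⟩ : GamCat k d C) := by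
  have h : ∑ m ∈ totals d X.labels, weightTen d X m = PiTensorProduct.tprod k fun _ => 𝟙 X.obj := by
    simp only [weightTen]
    rw [sum_totals X.labels fun a => PiTensorProduct.tprod k fun i => X.π (a i),
      ← MultilinearMap.map_sum_finset (PiTensorProduct.tprod k) (fun _ j => X.π j)]
    congr 1
    funext i
    exact X.π_sum
  refine Gam.ext (Eq.trans ?_ h)
  exact map_sum (Gam.val (k := k) (d := d) (H := (X.obj ⟶ X.obj))) (fun m => weight d X m) _

theorem weightHom_comp (X : GrObj k C) (m l : ℤ) :
    weightHom (d := d) X m ≫ weightHom X l = if m = l then weightHom X m else 0 := by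
  classical
  have h : tenMap₂ (Linear.comp X.obj X.obj X.obj) (weightTen d X m) (weightTen d X l) =
      if m = l then weightTen d X m else 0 := by
    have hz : ∀ a b : Fin d → ℤ, a ≠ b →
        (PiTensorProduct.tprod k fun i => X.π (a i) ≫ X.π (b i)) = 0 := by
      intro a b hab
      obtain ⟨i, hi⟩ := Function.ne_iff.1 hab
      exact MultilinearMap.map_coord_zero _ i (X.π_ne _ _ hi)
    simp only [weightTen, map_sum, LinearMap.sum_apply, tenMap₂_tprod]
    change (∑ x ∈ multiIdx d X.labels l, ∑ a ∈ multiIdx d X.labels m,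
      PiTensorProduct.tprod k fun i => X.π (a i) ≫ X.π (x i)) = _
    rw [Finset.sum_comm]
    split_ifs with hml
    · subst hml
      refine Finset.sum_congr rfl fun a ha => ?_
      rw [Finset.sum_eq_single_of_mem a ha fun b _ hb => hz a b (Ne.symm hb)]
      simp only [X.π_same]
    · refine Finset.sum_eq_zero fun a ha => Finset.sum_eq_zero fun b hb => hz a b ?_
      rintro rfl
      exact hml ((mem_multiIdx.1 ha).2.symm.trans (mem_multiIdx.1 hb).2)
  split_ifs with hml
  · exact Gam.ext (h.trans (if_pos hml))
  · exact Gam.ext (h.trans (if_neg hml))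

theorem weightTen_deg (X : GrObj k C) (m : ℤ) :
    weightTen d X m ∈ tenDeg (GradedCat.deg (k := k) X.obj X.obj) 0 :=
  Submodule.sum_mem _ fun a _ =>
    tprod_mem_tenDeg (fun _ => 0) _ (by simp) fun i => X.π_deg (a i)

theorem weightHom_deg (X : GrObj k C) (m : ℤ) :
    weightHom (d := d) X m ∈
      GradedCat.deg (k := k) (⟨X.obj⟩ : GamCat k d C) (⟨X.obj⟩ : GamCat k d C) 0 :=
  weightTen_deg X m

/-- The morphism of `Γ^d C` underlying a morphism of `Γ^d` of the category of graded objects. -/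
def underHom {X Y : GamCat k d (GrObj k C)} (f : X ⟶ Y) :
    (⟨X.obj.obj⟩ : GamCat k d C) ⟶ (⟨Y.obj.obj⟩ : GamCat k d C) := f

theorem underHom_id (X : GamCat k d (GrObj k C)) : underHom (𝟙 X) = 𝟙 _ := rfl

theorem underHom_comp {X Y Z : GamCat k d (GrObj k C)} (f : X ⟶ Y) (g : Y ⟶ Z) :
    underHom (f ≫ g) = underHom f ≫ underHom g := rfl

theorem weightTen_corner (X Y : GrObj k C) (n m l : ℤ)
    (t : PiTensorProduct k fun _ : Fin d => (X.obj ⟶ Y.obj)) (ht : t ∈ tenDeg (GrObj.deg X Y) n) :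
    tenMap₂ (Linear.comp X.obj X.obj Y.obj) (weightTen d X m)
      (tenMap₂ (Linear.comp X.obj Y.obj Y.obj) t (weightTen d Y l)) ∈
      tenDeg (GradedCat.deg (k := k) X.obj Y.obj) (n + m - l) := by
  induction ht using Submodule.span_induction with
  | mem t h =>
    obtain ⟨b, x, hb, hx, rfl⟩ := h
    simp only [weightTen, map_sum, LinearMap.sum_apply, tenMap₂_tprod]
    refine Submodule.sum_mem _ fun c hc => Submodule.sum_mem _ fun a ha => ?_
    refine tprod_mem_tenDeg (fun i => b i + a i - c i) _ ?_ fun i => hx i (a i) (c i)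
    rw [Finset.sum_sub_distrib, Finset.sum_add_distrib, hb, (mem_multiIdx.1 ha).2,
      (mem_multiIdx.1 hc).2]
  | zero => simp
  | add s t _ _ hs ht =>
    simp only [map_add, LinearMap.add_apply]; exact Submodule.add_mem _ hs ht
  | smul a t _ ht =>
    simp only [map_smul, LinearMap.smul_apply]; exact Submodule.smul_mem _ a ht

theorem weight_corner_deg {X Y : GamCat k d (GrObj k C)} (f : X ⟶ Y) (n m l : ℤ)
    (hf : f ∈ GradedCat.deg (k := k) X Y n) :
    weightHom X.obj m ≫ underHom f ≫ weightHom Y.obj l ∈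
      GradedCat.deg (k := k) (⟨X.obj.obj⟩ : GamCat k d C) (⟨Y.obj.obj⟩ : GamCat k d C)
        (n + m - l) :=
  weightTen_corner X.obj Y.obj n m l (Gam.val (GamCat.ten f)) hf

/-- The weight decomposition of `F(X)` for a graded object `X`. -/
def weights {F : GamCat k d C ⥤ GrVect k} (hF : IsGraded k F) (X : GrObj k C) :
    Weights (F.obj ⟨X.obj⟩) where
  T := totals d X.labels
  ε m := (F.map (weightHom X m)).lin
  ε_zero m hm := by
    rw [weightHom_zero X m hm]
    have := hF.map_smul (0 : k) (𝟙 (⟨X.obj⟩ : GamCat k d C))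
    rwa [zero_smul, zero_smul] at this
  ε_same m x := by
    rw [← LinearMap.comp_apply, ← GrVect.comp_lin, ← F.map_comp, weightHom_comp, if_pos rfl]
  ε_ne m l hml x := by
    rw [← LinearMap.comp_apply, ← GrVect.comp_lin, ← F.map_comp, weightHom_comp,
      if_neg (Ne.symm hml)]
    have := hF.map_smul (0 : k) (𝟙 (⟨X.obj⟩ : GamCat k d C))
    rw [zero_smul, zero_smul] at this
    rw [this]
    rfl
  ε_sum x := by
    let φ : ((⟨X.obj⟩ : GamCat k d C) ⟶ (⟨X.obj⟩ : GamCat k d C)) →ₗ[k]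
        ((F.obj ⟨X.obj⟩).carrier →ₗ[k] (F.obj ⟨X.obj⟩).carrier) :=
      { toFun := fun f => (F.map f).lin, map_add' := hF.map_add, map_smul' := hF.map_smul }
    change ∑ m ∈ totals d X.labels, φ (weightHom X m) x = x
    rw [← LinearMap.sum_apply, ← map_sum, weightHom_sum]
    change (F.map (𝟙 _)).lin x = x
    rw [F.map_id]
    rfl
  ε_deg m := hF.map_deg 0 _ (weightHom_deg X m)

/-- The graded extension `F^gr : Γ^d C^gr ⥤ GrVect` of a graded functor `F : Γ^d C ⥤ GrVect`.
The underlying space of `F^gr(X)` is that of `F(X)`; the part of degree `s` in `F(X)` and of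
multidegree `γ` in the pieces `X_j` of `X` is put in degree `s + ∑ j γ_j`. -/
def grExt (F : GamCat k d C ⥤ GrVect k) (hF : IsGraded k F) : GamCat k d (GrObj k C) ⥤ GrVect k where
  obj X := (weights hF X.obj).regrade
  map {X Y} f := ⟨(F.map (underHom f)).lin,
    Weights.mem_grHom (weights hF X.obj) (weights hF Y.obj) (F.map (underHom f)).mem⟩
  map_id X := GrVect.hom_ext <| by
    change (F.map (underHom (𝟙 X))).lin = LinearMap.id
    rw [underHom_id, F.map_id]
    rfl
  map_comp {X Y Z} f g := GrVect.hom_ext <| by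
    change (F.map (underHom (f ≫ g))).lin = (F.map (underHom g)).lin ∘ₗ (F.map (underHom f)).lin
    rw [underHom_comp, F.map_comp]
    rfl

theorem grExt_isGraded (F : GamCat k d C ⥤ GrVect k) (hF : IsGraded k F) :
    IsGraded k (grExt F hF) where
  map_add f g := hF.map_add (underHom f) (underHom g)
  map_smul a f := hF.map_smul a (underHom f)
  map_deg {X Y} n f hf := by
    refine Weights.mem_degHom (weights hF X.obj) (weights hF Y.obj) fun m l => ?_
    change (F.map (weightHom Y.obj l)).lin ∘ₗ (F.map (underHom f)).lin ∘ₗ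
      (F.map (weightHom X.obj m)).lin ∈ _
    rw [← GrVect.comp_lin, ← GrVect.comp_lin, ← F.map_comp, ← F.map_comp, Category.assoc]
    exact hF.map_deg _ _ (weight_corner_deg f n m l hf)

end


/-! ### Categories of graded functors -/

section

variable (k : Type u) [Field k] (d : ℕ) (C : Type v) [Category.{u} C] [Preadditive C]
  [Linear k C] [GradedCat k C]

/-- The graded `k`-linear functors from `Γ^d C` to graded spaces of finite dimension in each
degree. -/
def grFun : ObjectProperty (GamCat k d C ⥤ GrVect k) := fun F => IsGraded k F

/-- The category of graded `k`-linear functors from `Γ^d C` to graded spaces of finite dimension in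
each degree, and natural transformations. -/
abbrev GrFun := (grFun k d C).FullSubcategory

/-- The graded `k`-linear functors from `Γ^d C` to bounded below graded spaces of finite dimension
in each degree. -/
def grFunPlus : ObjectProperty (GamCat k d C ⥤ GrVect k) :=
  fun F => IsGraded k F ∧ ∀ X, (F.obj X).BddBelow

/-- The category of graded `k`-linear functors from `Γ^d C` to bounded below graded spaces of finite
dimension in each degree, and natural transformations. -/
abbrev GrFunPlus := (grFunPlus k d C).FullSubcategory

theorem grFunPlus_le : grFunPlus k d C ≤ grFun k d C := fun _ h => h.1

/-- The inclusion of the bounded below functors. -/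
def inclPlus : GrFunPlus k d C ⥤ GrFun k d C := ObjectProperty.ιOfLE (grFunPlus_le k d C)

end

section

variable {k : Type u} [Field k] {d : ℕ} {C : Type v} [Category.{u} C] [Preadditive C]
  [Linear k C] [GradedCat k C] {E : Type w} [Category.{u} E] [Preadditive E] [Linear k E]
  [GradedCat k E]

/-- A natural transformation is homogeneous of degree `j` if all its components are. -/
def HasDegree (j : ℤ) {F G : GamCat k d C ⥤ GrVect k} (α : F ⟶ G) : Prop :=
  ∀ X, (α.app X).lin ∈ GrVect.degHom (F.obj X) (G.obj X) j

/-- `F` and `G` are isomorphic by an isomorphism of degree zero. -/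
def DegZeroIso (F G : GrFun k d C) : Prop := ∃ e : F ≅ G, HasDegree 0 e.hom.hom

/-- Two functors with values in graded functors are naturally isomorphic, by isomorphisms of degree
zero. -/
def NatDegZeroIso {D : Type*} [Category* D] (Φ Ψ : D ⥤ GrFun k d C) : Prop :=
  ∃ e : Φ ≅ Ψ, ∀ X, HasDegree 0 (e.hom.app X).hom

/-- The functor `L` is left adjoint to `R` in the graded sense: there is an adjunction whose
bijections `Hom(L F, G) ≃ Hom(F, R G)` preserve and reflect the degrees of morphisms. -/
def GradedLeftAdjoint (L : GrFunPlus k d C ⥤ GrFunPlus k d E)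
    (R : GrFunPlus k d E ⥤ GrFunPlus k d C) : Prop :=
  ∃ adj : L ⊣ R, ∀ (F : GrFunPlus k d C) (G : GrFunPlus k d E) (j : ℤ) (α : L.obj F ⟶ G),
    HasDegree j α.hom ↔ HasDegree j (adj.homEquiv F G α).hom

/-- `G^* : F ↦ F ∘ Γ^d(G)`, for a graded linear functor `G : C ⥤ E`. -/
def pullback (d : ℕ) (G : C ⥤ E) (hG : IsGradedLinear k G) : GrFun k d E ⥤ GrFun k d C where
  obj F := ⟨gamFunctor d G hG ⋙ F.obj,
    { map_add := fun f g => by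
        have h := (gamFunctor_isGradedLinear d G hG).map_add f g
        rw [Functor.comp_map, h]; exact F.property.map_add _ _
      map_smul := fun a f => by
        have h := (gamFunctor_isGradedLinear d G hG).map_smul a f
        rw [Functor.comp_map, h]; exact F.property.map_smul _ _
      map_deg := fun n f hf =>
        F.property.map_deg n _ ((gamFunctor_isGradedLinear d G hG).map_deg n f hf) }⟩
  map α := ObjectProperty.homMk (Functor.whiskerLeft _ α.hom)

/-- The graded extension `F ↦ F^gr`. -/
def grExtFunctor (k : Type u) [Field k] (d : ℕ) (C : Type v) [Category.{u} C] [Preadditive C]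
    [Linear k C] [GradedCat k C] : GrFun k d C ⥤ GrFun k d (GrObj k C) where
  obj F := ⟨grExt F.obj F.property, grExt_isGraded F.obj F.property⟩
  map {F G} α := ObjectProperty.homMk
    { app := fun X => ⟨(α.hom.app ⟨X.obj.obj⟩).lin,
        Weights.mem_grHom (weights F.property X.obj) (weights G.property X.obj)
          (α.hom.app ⟨X.obj.obj⟩).mem⟩
      naturality := fun X Y f => GrVect.hom_ext <| by
        have h := congrArg GrVect.Hom.lin (α.hom.naturality (underHom f))
        exact h }

/-- The shift `F ↦ F[s]` of graded functors. -/
def shiftFun (k : Type u) [Field k] (d : ℕ) (C : Type v) [Category.{u} C] [Preadditive C]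
    [Linear k C] [GradedCat k C] (s : ℤ) : GrFun k d C ⥤ GrFun k d C where
  obj F := ⟨F.obj ⋙ GrVect.shift s,
    { map_add := fun f g => F.property.map_add f g
      map_smul := fun a f => F.property.map_smul a f
      map_deg := fun n f hf => GrVect.shift_mem_degHom (F.property.map_deg n f hf) }⟩
  map α := ObjectProperty.homMk (Functor.whiskerRight α.hom _)

theorem dualMap_add {M N : GrVect k} {f g h : M ⟶ N} (e : h.lin = f.lin + g.lin) :
    (GrVect.dualMap h).lin = (GrVect.dualMap f).lin + (GrVect.dualMap g).lin := by
  refine LinearMap.ext fun (ξ : GrVect.GrDual N) => GrVect.dual_ext fun x => ?_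
  change GrVect.evalDual N ξ (h.lin x) = GrVect.evalDual N ξ (f.lin x) +
    GrVect.evalDual N ξ (g.lin x)
  rw [e, LinearMap.add_apply, map_add]

theorem dualMap_smul {M N : GrVect k} {f h : M ⟶ N} {a : k} (e : h.lin = a • f.lin) :
    (GrVect.dualMap h).lin = a • (GrVect.dualMap f).lin := by
  refine LinearMap.ext fun (ξ : GrVect.GrDual N) => GrVect.dual_ext fun x => ?_
  change GrVect.evalDual N ξ (h.lin x) = a • GrVect.evalDual N ξ (f.lin x)
  rw [e, LinearMap.smul_apply, map_smul]

/-- For a contravariant graded linear functor `D` from `C` to `E`, the contravariant functor taking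
`F` to `X ↦ F(D(X))^*`. -/
def dualAlong (d : ℕ) (D : Cᵒᵖ ⥤ E) (hD : IsGradedContra k D) : (GrFun k d E)ᵒᵖ ⥤ GrFun k d C where
  obj F := ⟨
    { obj := fun X => GrVect.dualObj (F.unop.obj.obj ((gamFunctorOp d D hD).obj (Opposite.op X)))
      map := fun f => GrVect.dualMap (F.unop.obj.map ((gamFunctorOp d D hD).map f.op))
      map_id := fun X => by
        rw [op_id, CategoryTheory.Functor.map_id, CategoryTheory.Functor.map_id, GrVect.dualMap_id]
      map_comp := fun f g => by
        rw [op_comp, CategoryTheory.Functor.map_comp, CategoryTheory.Functor.map_comp,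
          GrVect.dualMap_comp] },
    { map_add := fun f g => dualMap_add <| by
        rw [(gamFunctorOp_isGradedContra d D hD).map_add f g]
        exact F.unop.property.map_add _ _
      map_smul := fun a f => dualMap_smul <| by
        rw [(gamFunctorOp_isGradedContra d D hD).map_smul a f]
        exact F.unop.property.map_smul _ _
      map_deg := fun n f hf => GrVect.dualLin_mem_degHom
        (F.unop.property.map_deg n _ ((gamFunctorOp_isGradedContra d D hD).map_deg n f hf)) }⟩
  map {F G} α := ObjectProperty.homMk
    { app := fun X => GrVect.dualMap (α.unop.hom.app ((gamFunctorOp d D hD).obj (Opposite.op X)))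
      naturality := fun X Y f => by
        have h := α.unop.hom.naturality ((gamFunctorOp d D hD).map f.op)
        exact congrArg GrVect.dualMap h.symm }
  map_id F := rfl
  map_comp f g := rfl

/-! ### Boundedness -/

theorem grExt_bddBelow {F : GamCat k d C ⥤ GrVect k} (hF : IsGraded k F)
    (h : ∀ X, (F.obj X).BddBelow) (X) : ((grExt F hF).obj X).BddBelow := by
  obtain ⟨N, hN⟩ := h ⟨X.obj.obj⟩
  let W := weights hF X.obj
  obtain ⟨B, hB⟩ : ∃ B : ℤ, ∀ m ∈ W.T, B ≤ m := by
    obtain ⟨B, hB⟩ := W.T.bddBelow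
    exact ⟨B, fun m hm => hB hm⟩
  refine ⟨N + B, fun n hn => ?_⟩
  rw [eq_bot_iff]
  intro x hx
  have hx : ∀ m, W.ε m x ∈ (F.obj ⟨X.obj.obj⟩).gr (n - m) := W.mem_gr.1 hx
  change x = 0
  rw [← W.ε_sum x]
  refine Finset.sum_eq_zero fun m hm => ?_
  have := hx m
  rw [hN (n - m) (by have := hB m hm; omega)] at this
  exact this

theorem grExt_bddAbove {F : GamCat k d C ⥤ GrVect k} (hF : IsGraded k F)
    (h : ∀ X, (F.obj X).BddAbove) (X) : ((grExt F hF).obj X).BddAbove := by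
  obtain ⟨N, hN⟩ := h ⟨X.obj.obj⟩
  let W := weights hF X.obj
  obtain ⟨B, hB⟩ : ∃ B : ℤ, ∀ m ∈ W.T, m ≤ B := by
    obtain ⟨B, hB⟩ := W.T.bddAbove
    exact ⟨B, fun m hm => hB hm⟩
  refine ⟨N + B, fun n hn => ?_⟩
  rw [eq_bot_iff]
  intro x hx
  have hx : ∀ m, W.ε m x ∈ (F.obj ⟨X.obj.obj⟩).gr (n - m) := W.mem_gr.1 hx
  change x = 0
  rw [← W.ε_sum x]
  refine Finset.sum_eq_zero fun m hm => ?_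
  have := hx m
  rw [hN (n - m) (by have := hB m hm; omega)] at this
  exact this

theorem dual_bddAbove {M : GrVect k} (h : M.BddBelow) : (GrVect.dualObj M).BddAbove := by
  obtain ⟨N, hN⟩ := h
  refine ⟨-N, fun n hn => ?_⟩
  rw [eq_bot_iff]
  intro ξ hξ
  refine GrVect.dual_ext fun x => ?_
  obtain ⟨T, hT⟩ := proj_sum' M.internal x
  rw [hT, map_sum, map_sum]
  refine Finset.sum_congr rfl fun j _ => ?_
  have hp := proj_mem M.internal j x
  by_cases hj : j = -n
  · rw [hN j (by omega)] at hp
    rw [(Submodule.mem_bot k).1 hp, map_zero, map_zero]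
  · rw [hξ j hj _ hp]; rfl

theorem dual_bddBelow {M : GrVect k} (h : M.BddAbove) : (GrVect.dualObj M).BddBelow := by
  obtain ⟨N, hN⟩ := h
  refine ⟨-N, fun n hn => ?_⟩
  rw [eq_bot_iff]
  intro ξ hξ
  refine GrVect.dual_ext fun x => ?_
  obtain ⟨T, hT⟩ := proj_sum' M.internal x
  rw [hT, map_sum, map_sum]
  refine Finset.sum_congr rfl fun j _ => ?_
  have hp := proj_mem M.internal j x
  by_cases hj : j = -n
  · rw [hN j (by omega)] at hp
    rw [(Submodule.mem_bot k).1 hp, map_zero, map_zero]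
  · rw [hξ j hj _ hp]; rfl

/-! ### Representable and corepresentable functors -/

/-- The graded space of morphisms from `X` to `Y`. -/
def homObj (X Y : GamCat k d C) : GrVect k where
  carrier := X ⟶ Y
  gr := GradedCat.deg (k := k) X Y
  internal := GradedCat.internal X Y
  finite n := by
    have := GradedCat.finite (k := k) X Y
    infer_instance

theorem hom_induction {X Y : GamCat k d C} {P : (X ⟶ Y) → Prop} (f : X ⟶ Y)
    (deg : ∀ n, ∀ f ∈ GradedCat.deg (k := k) X Y n, P f) (zero : P 0)
    (add : ∀ f g, P f → P g → P (f + g)) : P f := by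
  have hf : f ∈ ⨆ n, GradedCat.deg (k := k) X Y n := by
    rw [(GradedCat.internal (k := k) X Y).submodule_iSup_eq_top]; trivial
  induction hf using Submodule.iSup_induction' with
  | mem n f hf => exact deg n f hf
  | zero => exact zero
  | add f g _ _ hf hg => exact add f g hf hg

/-- Postcomposition with `f`, as a linear map. -/
def postLin (U : GamCat k d C) {X Y : GamCat k d C} (f : X ⟶ Y) : (U ⟶ X) →ₗ[k] (U ⟶ Y) :=
  (Linear.comp U X Y).flip f

/-- Precomposition with `f`, as a linear map. -/
def preLin (U : GamCat k d C) {X Y : GamCat k d C} (f : X ⟶ Y) : (Y ⟶ U) →ₗ[k] (X ⟶ U) :=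
  Linear.comp X Y U f

theorem postLin_degHom (U : GamCat k d C) {X Y : GamCat k d C} {n : ℤ} {f : X ⟶ Y}
    (hf : f ∈ GradedCat.deg (k := k) X Y n) :
    postLin U f ∈ GrVect.degHom (homObj U X) (homObj U Y) n :=
  fun _ _ hx => GradedCat.comp_mem hx hf

theorem preLin_degHom (U : GamCat k d C) {X Y : GamCat k d C} {n : ℤ} {f : X ⟶ Y}
    (hf : f ∈ GradedCat.deg (k := k) X Y n) :
    preLin U f ∈ GrVect.degHom (homObj Y U) (homObj X U) n :=
  fun m x hx => by
    rw [add_comm m n]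
    exact GradedCat.comp_mem hf hx

/-- Postcomposition with `f`. -/
def postcomp (U : GamCat k d C) {X Y : GamCat k d C} (f : X ⟶ Y) : homObj U X ⟶ homObj U Y :=
  ⟨postLin U f, by
    refine hom_induction (k := k) f (fun n f hf => GrVect.degHom_le _ _ _ (postLin_degHom U hf))
      ?_ fun f g hf hg => ?_
    · have : postLin U (0 : X ⟶ Y) = 0 := map_zero (Linear.comp U X Y).flip
      rw [this]; exact Submodule.zero_mem _
    · have : postLin U (f + g) = postLin U f + postLin U g := map_add (Linear.comp U X Y).flip f g
      rw [this]; exact Submodule.add_mem _ hf hg⟩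

/-- Precomposition with `f`. -/
def precomp (U : GamCat k d C) {X Y : GamCat k d C} (f : X ⟶ Y) : homObj Y U ⟶ homObj X U :=
  ⟨preLin U f, by
    refine hom_induction (k := k) f (fun n f hf => GrVect.degHom_le _ _ _ (preLin_degHom U hf))
      ?_ fun f g hf hg => ?_
    · have : preLin U (0 : X ⟶ Y) = 0 := map_zero (Linear.comp X Y U)
      rw [this]; exact Submodule.zero_mem _
    · have : preLin U (f + g) = preLin U f + preLin U g := map_add (Linear.comp X Y U) f g
      rw [this]; exact Submodule.add_mem _ hf hg⟩

theorem precomp_id (U X : GamCat k d C) : precomp (k := k) U (𝟙 X) = 𝟙 (homObj X U) :=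
  GrVect.hom_ext <| LinearMap.ext fun (x : X ⟶ U) => by
    change 𝟙 X ≫ x = x
    rw [Category.id_comp]

theorem precomp_comp (U : GamCat k d C) {X Y Z : GamCat k d C} (f : X ⟶ Y) (g : Y ⟶ Z) :
    precomp (k := k) U (f ≫ g) = precomp U g ≫ precomp U f :=
  GrVect.hom_ext <| LinearMap.ext fun (x : Z ⟶ U) => by
    change (f ≫ g) ≫ x = f ≫ g ≫ x
    rw [Category.assoc]

theorem postcomp_id (U X : GamCat k d C) : postcomp (k := k) U (𝟙 X) = 𝟙 (homObj U X) :=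
  GrVect.hom_ext <| LinearMap.ext fun (x : U ⟶ X) => by
    change x ≫ 𝟙 X = x
    rw [Category.comp_id]

theorem postcomp_comp (U : GamCat k d C) {X Y Z : GamCat k d C} (f : X ⟶ Y) (g : Y ⟶ Z) :
    postcomp (k := k) U (f ≫ g) = postcomp U f ≫ postcomp U g :=
  GrVect.hom_ext <| LinearMap.ext fun (x : U ⟶ X) => by
    change x ≫ f ≫ g = (x ≫ f) ≫ g
    rw [Category.assoc]

/-- The representable functor `X ↦ Hom_{Γ^d C}(U, X)`. -/
def rep (d : ℕ) (U : C) : GrFun k d C :=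
  ⟨{ obj := fun X => homObj ⟨U⟩ X
     map := fun f => postcomp ⟨U⟩ f
     map_id := postcomp_id _
     map_comp := postcomp_comp _ },
   { map_add := fun {X Y} f g => map_add (Linear.comp (⟨U⟩ : GamCat k d C) X Y).flip f g
     map_smul := fun {X Y} a f => map_smul (Linear.comp (⟨U⟩ : GamCat k d C) X Y).flip a f
     map_deg := fun _ _ hf => postLin_degHom _ hf }⟩

/-- The corepresentable functor `X ↦ Hom_{Γ^d C}(X, U)^*`. -/
def corep (d : ℕ) (U : C) : GrFun k d C :=
  ⟨{ obj := fun X => GrVect.dualObj (homObj X ⟨U⟩)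
     map := fun f => GrVect.dualMap (precomp ⟨U⟩ f)
     map_id := fun X => by rw [precomp_id, GrVect.dualMap_id]
     map_comp := fun f g => by rw [precomp_comp, GrVect.dualMap_comp] },
   { map_add := fun {X Y} f g => dualMap_add (map_add (Linear.comp X Y ⟨U⟩) f g)
     map_smul := fun {X Y} a f => dualMap_smul (map_smul (Linear.comp X Y ⟨U⟩) a f)
     map_deg := fun _ _ hf => GrVect.dualLin_mem_degHom (preLin_degHom _ hf) }⟩

end


/-! ### The algebra `A = k[x]/x^p` and the category `V_A` -/

section

variable (k : Type u) [Field k] (p : ℕ)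

/-- The algebra `A = k[x]/x^p`. -/
abbrev TruncPoly : Type u := AdjoinRoot (Polynomial.X ^ p : Polynomial k)

namespace TruncPoly

/-- The generator of `A`. -/
def x : TruncPoly k p := AdjoinRoot.root _

/-- The grading of `A`, with `x` in degree `2`. -/
def deg (n : ℤ) : Submodule k (TruncPoly k p) :=
  Submodule.span k {a | ∃ i : ℕ, 2 * (i : ℤ) = n ∧ a = x k p ^ i}

theorem monic : (Polynomial.X ^ p : Polynomial k).Monic := Polynomial.monic_X_pow p

instance : Module.Finite k (TruncPoly k p) := (monic k p).finite_adjoinRoot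

theorem x_pow_eq_zero (i : ℕ) (hi : p ≤ i) : x k p ^ i = 0 := by
  have h : x k p ^ p = 0 := by
    have := AdjoinRoot.eval₂_root (Polynomial.X ^ p : Polynomial k)
    simpa [x] using this
  rw [← Nat.add_sub_cancel' hi, pow_add, h, zero_mul]

/-- The monomial basis of `A`. -/
def basis : Module.Basis (Fin (AdjoinRoot.powerBasis' (monic k p)).dim) k (TruncPoly k p) :=
  (AdjoinRoot.powerBasis' (monic k p)).basis

theorem dim_eq : (AdjoinRoot.powerBasis' (monic k p)).dim = p := by
  rw [AdjoinRoot.powerBasis'_dim, Polynomial.natDegree_X_pow]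

theorem basis_apply (i) : basis k p i = x k p ^ (i : ℕ) := by
  rw [basis, PowerBasis.basis_eq_pow, AdjoinRoot.powerBasis'_gen, x]

/-- The projection of `A` onto its degree `n` part. -/
def degProj (n : ℤ) : TruncPoly k p →ₗ[k] TruncPoly k p :=
  ∑ i : Fin (AdjoinRoot.powerBasis' (monic k p)).dim,
    if 2 * ((i : ℕ) : ℤ) = n then ((basis k p).coord i).smulRight (basis k p i) else 0

theorem degProj_pow (n : ℤ) (i : ℕ) :
    degProj k p n (x k p ^ i) = if 2 * (i : ℤ) = n then x k p ^ i else 0 := by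
  by_cases hi : i < p
  · have e : x k p ^ i = basis k p ⟨i, by rw [dim_eq]; exact hi⟩ := by rw [basis_apply]
    rw [e, degProj, LinearMap.sum_apply, Finset.sum_eq_single ⟨i, by rw [dim_eq]; exact hi⟩]
    · split_ifs <;> simp
    · intro j _ hj
      split_ifs
      · simp [Ne.symm hj]
      · rfl
    · simp
  · rw [x_pow_eq_zero k p i (by omega)]; simp

theorem deg_internal : DirectSum.IsInternal (deg k p) := by
  classical
  have key : ∀ m n, ∀ a ∈ deg k p n, degProj k p m a = if m = n then a else 0 := by
    intro m n a ha
    induction ha using Submodule.span_induction with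
    | mem a h =>
      obtain ⟨i, hi, rfl⟩ := h
      rw [degProj_pow, hi]
      by_cases h : n = m
      · rw [if_pos h, if_pos h.symm]
      · rw [if_neg h, if_neg (Ne.symm h)]
    | zero => simp
    | add a b _ _ ha hb => rw [map_add, ha, hb]; split_ifs <;> simp
    | smul c a _ ha => rw [map_smul, ha]; split_ifs <;> simp
  refine isInternal_of_proj _ (degProj k p) ?_ (fun n a ha => (key n n a ha).trans (if_pos rfl))
    (fun m n hmn a ha => (key m n a ha).trans (if_neg hmn)) ?_
  · intro n a
    rw [degProj, LinearMap.sum_apply]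
    refine Submodule.sum_mem _ fun i _ => ?_
    split_ifs with h
    · refine Submodule.smul_mem _ _ (Submodule.subset_span ⟨i, h, basis_apply k p i⟩)
    · exact Submodule.zero_mem _
  · intro a
    refine ⟨Finset.univ.image fun i : Fin (AdjoinRoot.powerBasis' (monic k p)).dim =>
      2 * ((i : ℕ) : ℤ), ?_⟩
    refine LinearMap.congr_fun (f := LinearMap.id)
      (g := ∑ n ∈ Finset.univ.image fun i : Fin (AdjoinRoot.powerBasis' (monic k p)).dim =>
        2 * ((i : ℕ) : ℤ), degProj k p n) ((basis k p).ext fun i => ?_) a |>.trans ?_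
    · rw [LinearMap.sum_apply, basis_apply]
      simp only [degProj_pow]
      rw [Finset.sum_ite_eq, if_pos (Finset.mem_image_of_mem _ (Finset.mem_univ i))]
      rfl
    · rw [LinearMap.sum_apply]

theorem one_mem : (1 : TruncPoly k p) ∈ deg k p 0 :=
  Submodule.subset_span ⟨0, by simp, by simp⟩

theorem mul_mem {m n : ℤ} {a b : TruncPoly k p} (ha : a ∈ deg k p m) (hb : b ∈ deg k p n) :
    a * b ∈ deg k p (m + n) := by
  induction ha using Submodule.span_induction with
  | mem a h =>
    obtain ⟨i, hi, rfl⟩ := h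
    induction hb using Submodule.span_induction with
    | mem b h =>
      obtain ⟨j, hj, rfl⟩ := h
      exact Submodule.subset_span ⟨i + j, by push_cast; omega, (pow_add _ _ _).symm⟩
    | zero => rw [mul_zero]; exact Submodule.zero_mem _
    | add a b _ _ ha hb => rw [mul_add]; exact Submodule.add_mem _ ha hb
    | smul c a _ ha => rw [mul_smul_comm]; exact Submodule.smul_mem _ c ha
  | zero => rw [zero_mul]; exact Submodule.zero_mem _
  | add a b _ _ ha hb => rw [add_mul]; exact Submodule.add_mem _ ha hb
  | smul c a _ ha => rw [smul_mul_assoc]; exact Submodule.smul_mem _ c ha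

/-- The degrees that occur in `A`. -/
def degrees : Finset ℤ := (Finset.range p).image fun i : ℕ => 2 * (i : ℤ)

theorem deg_eq_bot (n : ℤ) (hn : n ∉ degrees p) : deg k p n = ⊥ := by
  rw [deg, Submodule.span_eq_bot]
  rintro a ⟨i, hi, rfl⟩
  by_cases h : i < p
  · exact absurd (Finset.mem_image.2 ⟨i, Finset.mem_range.2 h, hi⟩) hn
  · exact x_pow_eq_zero k p i (by omega)

/-- The degree `n` part of `H ⊗ A`, for an ungraded space `H`. -/
def tensorDeg (H : Type u) [AddCommGroup H] [Module k H] (n : ℤ) :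
    Submodule k (H ⊗[k] TruncPoly k p) :=
  LinearMap.range (LinearMap.lTensor H (deg k p n).subtype)

variable {k p}

theorem tmul_mem {H : Type u} [AddCommGroup H] [Module k H] {n : ℤ} (h : H) {a : TruncPoly k p}
    (ha : a ∈ deg k p n) : h ⊗ₜ[k] a ∈ tensorDeg k p H n := ⟨h ⊗ₜ[k] ⟨a, ha⟩, rfl⟩

theorem tensorDeg_induction {H : Type u} [AddCommGroup H] [Module k H] {n : ℤ}
    {P : H ⊗[k] TruncPoly k p → Prop} (tmul : ∀ (h : H), ∀ a ∈ deg k p n, P (h ⊗ₜ[k] a))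
    (zero : P 0) (add : ∀ s t, P s → P t → P (s + t)) (t) (ht : t ∈ tensorDeg k p H n) : P t := by
  obtain ⟨s, rfl⟩ := ht
  induction s using TensorProduct.induction_on with
  | zero => rw [map_zero]; exact zero
  | tmul h a => exact tmul h a.1 a.2
  | add s t hs ht => rw [map_add]; exact add _ _ hs ht

variable (k p)

/-- The projection of `H ⊗ A` onto its degree `n` part. -/
def tensorProj (H : Type u) [AddCommGroup H] [Module k H] (n : ℤ) :
    H ⊗[k] TruncPoly k p →ₗ[k] H ⊗[k] TruncPoly k p :=
  LinearMap.lTensor H (proj (deg_internal k p) n)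

section

variable {H : Type u} [AddCommGroup H] [Module k H]

theorem tensorProj_mem (n : ℤ) (t : H ⊗[k] TruncPoly k p) :
    tensorProj k p H n t ∈ tensorDeg k p H n := by
  induction t using TensorProduct.induction_on with
  | zero => rw [map_zero]; exact Submodule.zero_mem _
  | tmul h a => exact tmul_mem h (proj_mem _ _ _)
  | add s t hs ht => rw [map_add]; exact Submodule.add_mem _ hs ht

theorem tensorProj_same (n : ℤ) (t : H ⊗[k] TruncPoly k p) (ht : t ∈ tensorDeg k p H n) :
    tensorProj k p H n t = t := by
  refine tensorDeg_induction (P := fun t => tensorProj k p H n t = t) (fun h a ha => ?_)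
    (LinearMap.map_zero (tensorProj k p H n))
    (fun s t hs ht => ?_) t ht
  · rw [tensorProj, LinearMap.lTensor_tmul, proj_same _ _ _ ha]
  · rw [map_add, hs, ht]

theorem tensorProj_ne (m n : ℤ) (hmn : m ≠ n) (t : H ⊗[k] TruncPoly k p)
    (ht : t ∈ tensorDeg k p H n) : tensorProj k p H m t = 0 := by
  refine tensorDeg_induction (P := fun t => tensorProj k p H m t = 0) (fun h a ha => ?_)
    (LinearMap.map_zero (tensorProj k p H m))
    (fun s t hs ht => ?_) t ht
  · rw [tensorProj, LinearMap.lTensor_tmul, proj_ne _ _ _ hmn _ ha, TensorProduct.tmul_zero]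
  · rw [map_add, hs, ht, add_zero]

theorem proj_eq_zero (n : ℤ) (hn : n ∉ degrees p) : proj (deg_internal k p) n = 0 := by
  refine LinearMap.ext fun a => ?_
  have := proj_mem (deg_internal k p) n a
  rw [deg_eq_bot k p n hn] at this
  exact this

theorem tensorProj_eq_zero (n : ℤ) (hn : n ∉ degrees p) : tensorProj k p H n = 0 := by
  rw [tensorProj, proj_eq_zero k p n hn, LinearMap.lTensor_zero]

theorem proj_total (a : TruncPoly k p) : ∑ n ∈ degrees p, proj (deg_internal k p) n a = a := by
  classical
  obtain ⟨T, hT⟩ := proj_sum (deg_internal k p) a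
  conv_rhs => rw [hT (T ∪ degrees p) Finset.subset_union_left]
  refine Finset.sum_subset Finset.subset_union_right fun n _ hn => ?_
  rw [proj_eq_zero k p n hn, LinearMap.zero_apply]

theorem tensorProj_sum (t : H ⊗[k] TruncPoly k p) :
    ∑ n ∈ degrees p, tensorProj k p H n t = t := by
  induction t using TensorProduct.induction_on with
  | zero => simp
  | tmul h a =>
    simp only [tensorProj, LinearMap.lTensor_tmul]
    rw [← TensorProduct.tmul_sum, proj_total]
  | add s t hs ht => simp only [map_add, Finset.sum_add_distrib, hs, ht]

theorem tensorDeg_internal : DirectSum.IsInternal (tensorDeg k p H) :=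
  isInternal_of_proj _ (tensorProj k p H) (tensorProj_mem k p) (tensorProj_same k p)
    (tensorProj_ne k p) fun t => ⟨degrees p, (tensorProj_sum k p t).symm⟩

end

end TruncPoly

end


/-! ### The isomorphism of graded `A`-modules `A^* ≅ A[2(p-1)]` -/

namespace TruncPoly

variable (k : Type u) [Field k] (p : ℕ)

/-- The coefficient of `x^(p-1)`. -/
def top (hp : 0 < p) : TruncPoly k p →ₗ[k] k :=
  (basis k p).coord ⟨p - 1, by rw [dim_eq]; omega⟩

theorem top_pow (hp : 0 < p) (i : ℕ) : top k p hp (x k p ^ i) = if i = p - 1 then 1 else 0 := by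
  by_cases hi : i < p
  · have e : x k p ^ i = basis k p ⟨i, by rw [dim_eq]; exact hi⟩ := by rw [basis_apply]
    rw [e, top, Module.Basis.coord_apply, Module.Basis.repr_self, Finsupp.single_apply]
    simp [Fin.ext_iff]
  · rw [x_pow_eq_zero k p i (by omega), map_zero, if_neg (by omega)]

/-- The form `(a, b) ↦ (coefficient of x^(p-1) in ab)` identifies `A[2(p-1)]` with the graded dual
of `A`, as graded `A`-modules. -/
theorem exists_dual_equiv (hp : 0 < p) :
    ∃ e : TruncPoly k p ≃ₗ[k] Module.Dual k (TruncPoly k p),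
      (∀ a b c, e (a * b) c = e b (a * c)) ∧
      ∀ m n, ∀ a ∈ deg k p m, ∀ b ∈ deg k p n, m + n ≠ 2 * ((p : ℤ) - 1) → e a b = 0 := by
  let φ : TruncPoly k p →ₗ[k] Module.Dual k (TruncPoly k p) :=
    (LinearMap.mul k (TruncPoly k p)).compr₂ (top k p hp)
  have hφ : ∀ a b, φ a b = top k p hp (a * b) := fun _ _ => rfl
  have hs : Function.Surjective φ := by
    rw [← LinearMap.range_eq_top, eq_top_iff, ← (basis k p).dualBasis.span_eq, Submodule.span_le]
    rintro _ ⟨j, rfl⟩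
    refine ⟨x k p ^ (p - 1 - (j : ℕ)), (basis k p).ext fun l => ?_⟩
    have hj : (j : ℕ) < p := lt_of_lt_of_eq j.2 (dim_eq k p)
    rw [hφ, basis_apply, ← pow_add, top_pow, ← basis_apply, Module.Basis.dualBasis_apply_self]
    by_cases h : j = l
    · subst h; rw [if_pos (by omega), if_pos rfl]
    · have h' : (j : ℕ) ≠ l := fun e => h (Fin.ext e)
      rw [if_neg (by omega), if_neg (fun e => h e.symm)]
  have hi : Function.Injective φ :=
    (LinearMap.injective_iff_surjective_of_finrank_eq_finrank
      (Subspace.dual_finrank_eq (K := k) (V := TruncPoly k p)).symm).2 hs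
  refine ⟨LinearEquiv.ofBijective φ ⟨hi, hs⟩, fun a b c => ?_, fun m n a ha b hb hmn => ?_⟩
  · change top k p hp (a * b * c) = top k p hp (b * (a * c))
    rw [mul_comm a b, mul_assoc]
  · change top k p hp (a * b) = 0
    have key : ∀ t ∈ deg k p (m + n), top k p hp t = 0 := by
      intro t ht
      induction ht using Submodule.span_induction with
      | mem t h =>
        obtain ⟨i, h, rfl⟩ := h
        rw [top_pow, if_neg (by omega)]
      | zero => exact map_zero _
      | add s t _ _ hs ht => rw [map_add, hs, ht, add_zero]
      | smul a t _ ht => rw [map_smul, ht, smul_zero]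
    exact key _ (mul_mem k p ha hb)

end TruncPoly


/-! ### The categories `V` and `V_A`, and the functors between them -/

section

variable (k : Type u) [Field k] (p : ℕ)

/-- The category `V` of finite dimensional spaces is graded, with all morphisms in degree zero. -/
instance : GradedCat k (FGModuleCat.{u} k) where
  deg _ _ n := if n = 0 then ⊤ else ⊥
  internal X Y := by
    refine isInternal_of_proj _ (fun n => if n = 0 then LinearMap.id else 0) ?_ ?_ ?_ ?_
    · intro n f; split_ifs <;> simp
    · intro n f hf
      split_ifs at hf ⊢
      · rfl
      · exact ((Submodule.mem_bot k).1 hf).symm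
    · intro m n hmn f hf
      split_ifs at hf ⊢ with h1 h2
      · exact absurd (h1.trans h2.symm) hmn
      · exact (Submodule.mem_bot k).1 hf
      · rfl
      · rfl
    · intro f; exact ⟨{0}, by simp⟩
  finite X Y := inferInstance
  id_mem X := by simp
  comp_mem {X Y Z m n f g} hf hg := by
    by_cases hm : m = 0
    · by_cases hn : n = 0
      · simp [hm, hn]
      · rw [if_neg hn, Submodule.mem_bot] at hg
        rw [hg, Limits.comp_zero]; exact Submodule.zero_mem _
    · rw [if_neg hm, Submodule.mem_bot] at hf
      rw [hf, Limits.zero_comp]; exact Submodule.zero_mem _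

theorem mem_deg_zero {X Y : FGModuleCat.{u} k} (f : X ⟶ Y) : f ∈ GradedCat.deg (k := k) X Y 0 := by
  simp [GradedCat.deg]

theorem eq_zero_of_mem_deg {X Y : FGModuleCat.{u} k} {n : ℤ} (hn : n ≠ 0) {f : X ⟶ Y}
    (hf : f ∈ GradedCat.deg (k := k) X Y n) : f = 0 := by
  simpa [GradedCat.deg, hn] using hf

theorem ofHom_sum {M N : Type u} [AddCommGroup M] [Module k M] [Module.Finite k M]
    [AddCommGroup N] [Module k N] [Module.Finite k N] (f : ℤ → M →ₗ[k] N) (T : Finset ℤ) :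
    ∑ n ∈ T, FGModuleCat.ofHom (f n) = FGModuleCat.ofHom (∑ n ∈ T, f n) := by
  let φ : (M →ₗ[k] N) →+ (FGModuleCat.of k M ⟶ FGModuleCat.of k N) :=
    { toFun := fun f => FGModuleCat.ofHom f
      map_zero' := rfl
      map_add' := fun f g => rfl }
  exact (map_sum φ f T).symm

/-- The category `V_A`. An object is a finite dimensional space `V`, standing for the graded
`A`-module `V ⊗ A`; the morphisms are
`Hom_{V_A}(V ⊗ A, W ⊗ A) = Hom(V, W) ⊗ A = Hom_A(V ⊗ A, W ⊗ A)`. -/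
structure VA (k : Type u) [Field k] (p : ℕ) where
  obj : FGModuleCat.{u} k

namespace VA

variable {k p}

/-- `Hom(V, W) ⊗ A`. -/
abbrev HomA (V W : VA k p) : Type u := (V.obj →ₗ[k] W.obj) ⊗[k] TruncPoly k p

/-- The composition `(f ⊗ a, g ⊗ b) ↦ (g ∘ f) ⊗ ab`. -/
def comp (U V W : VA k p) : HomA U V →ₗ[k] HomA V W →ₗ[k] HomA U W :=
  TensorProduct.map₂ (LinearMap.llcomp k U.obj V.obj W.obj).flip (LinearMap.mul k (TruncPoly k p))

theorem comp_tmul (U V W : VA k p) (f : U.obj →ₗ[k] V.obj) (a : TruncPoly k p)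
    (g : V.obj →ₗ[k] W.obj) (b : TruncPoly k p) :
    comp U V W (f ⊗ₜ a) (g ⊗ₜ b) = (g ∘ₗ f) ⊗ₜ (a * b) := rfl

instance : Category.{u} (VA k p) where
  Hom V W := HomA V W
  id V := (LinearMap.id : V.obj →ₗ[k] V.obj) ⊗ₜ 1
  comp {U V W} f g := comp U V W f g
  id_comp {V W} f := by
    induction f using TensorProduct.induction_on with
    | zero => exact map_zero _
    | tmul f a => rw [comp_tmul, one_mul, LinearMap.comp_id]
    | add s t hs ht => rw [map_add, hs, ht]
  comp_id {V W} f := by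
    induction f using TensorProduct.induction_on with
    | zero => rw [map_zero, LinearMap.zero_apply]
    | tmul f a => rw [comp_tmul, mul_one, LinearMap.id_comp]
    | add s t hs ht => rw [map_add, LinearMap.add_apply, hs, ht]
  assoc {U V W Z} f g h := by
    induction f using TensorProduct.induction_on with
    | zero => simp only [map_zero, LinearMap.zero_apply]
    | tmul f a =>
      induction g using TensorProduct.induction_on with
      | zero => simp only [map_zero, LinearMap.zero_apply]
      | tmul g b =>
        induction h using TensorProduct.induction_on with
        | zero => simp only [map_zero]
        | tmul h c => simp only [comp_tmul, mul_assoc, LinearMap.comp_assoc]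
        | add s t hs ht => simp only [map_add, hs, ht]
      | add s t hs ht => simp only [map_add, LinearMap.add_apply, hs, ht]
    | add s t hs ht => simp only [map_add, LinearMap.add_apply, hs, ht]

/-- The element of `Hom(V, W) ⊗ A` underlying a morphism. -/
def toTen {V W : VA k p} (f : V ⟶ W) : HomA V W := f

instance : Preadditive (VA k p) where
  homGroup V W := inferInstanceAs (AddCommGroup (HomA V W))
  add_comp U V W f f' g := LinearMap.map_add₂ (comp U V W) (toTen f) (toTen f') (toTen g)
  comp_add U V W f g g' := map_add (comp U V W (toTen f)) (toTen g) (toTen g')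

instance : Linear k (VA k p) where
  homModule V W := inferInstanceAs (Module k (HomA V W))
  smul_comp U V W a f g := LinearMap.map_smul₂ (comp U V W) a (toTen f) (toTen g)
  comp_smul U V W f a g := map_smul (comp U V W (toTen f)) a (toTen g)

/-- The morphism `f ⊗ a`. -/
def tmul {V W : VA k p} (f : V.obj →ₗ[k] W.obj) (a : TruncPoly k p) : V ⟶ W := f ⊗ₜ[k] a

instance : GradedCat k (VA k p) where
  deg V W n := TruncPoly.tensorDeg k p (V.obj →ₗ[k] W.obj) n
  internal V W := TruncPoly.tensorDeg_internal k p
  finite V W := inferInstanceAs (Module.Finite k (HomA V W))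
  id_mem V := TruncPoly.tmul_mem _ (TruncPoly.one_mem k p)
  comp_mem {U V W m n f g} hf hg := by
    refine TruncPoly.tensorDeg_induction (P := fun f => comp U V W f g ∈
      TruncPoly.tensorDeg k p (U.obj →ₗ[k] W.obj) (m + n)) (fun f a ha => ?_) ?_ ?_ f hf
    · refine TruncPoly.tensorDeg_induction (P := fun g => comp U V W (f ⊗ₜ a) g ∈
        TruncPoly.tensorDeg k p (U.obj →ₗ[k] W.obj) (m + n)) (fun g b hb => ?_) ?_ ?_ g hg
      · exact TruncPoly.tmul_mem _ (TruncPoly.mul_mem k p ha hb)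
      · rw [map_zero]; exact Submodule.zero_mem _
      · intro s t hs ht; rw [map_add]; exact Submodule.add_mem _ hs ht
    · rw [map_zero]; exact Submodule.zero_mem _
    · intro s t hs ht; rw [map_add]; exact Submodule.add_mem _ hs ht

/-- The action `Hom(V, W) ⊗ A → Hom(V ⊗ A, W ⊗ A)`, `(f ⊗ a)(v ⊗ b) = f(v) ⊗ ab`. -/
def act (V W : VA k p) : HomA V W →ₗ[k]
    (V.obj ⊗[k] TruncPoly k p →ₗ[k] W.obj ⊗[k] TruncPoly k p) :=
  TensorProduct.lift ((TensorProduct.mapBilinear (RingHom.id k) V.obj (TruncPoly k p) W.obj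
    (TruncPoly k p)).compl₂ (LinearMap.mul k (TruncPoly k p)))

theorem act_tmul (V W : VA k p) (f : V.obj →ₗ[k] W.obj) (a : TruncPoly k p) (v : V.obj)
    (b : TruncPoly k p) : act V W (f ⊗ₜ a) (v ⊗ₜ b) = f v ⊗ₜ (a * b) := rfl

theorem act_id (V : VA k p) : act V V ((LinearMap.id : V.obj →ₗ[k] V.obj) ⊗ₜ 1) = LinearMap.id := by
  refine TensorProduct.ext' fun v b => ?_
  rw [act_tmul, one_mul]; rfl

theorem act_comp (U V W : VA k p) (f : HomA U V) (g : HomA V W) :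
    act U W (comp U V W f g) = act V W g ∘ₗ act U V f := by
  induction f using TensorProduct.induction_on with
  | zero => simp only [map_zero, LinearMap.zero_apply, LinearMap.comp_zero]
  | tmul f a =>
    induction g using TensorProduct.induction_on with
    | zero => simp only [map_zero, LinearMap.zero_comp]
    | tmul g b =>
      refine TensorProduct.ext' fun v c => ?_
      change g (f v) ⊗ₜ[k] (a * b * c) = g (f v) ⊗ₜ[k] (b * (a * c))
      rw [← mul_assoc, mul_comm b a]
    | add s t hs ht => simp only [map_add, LinearMap.add_comp, hs, ht]
  | add s t hs ht => simp only [map_add, LinearMap.add_apply, LinearMap.comp_add, hs, ht]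

theorem act_deg (V W : VA k p) (n m : ℤ) (f : HomA V W)
    (hf : f ∈ TruncPoly.tensorDeg k p (V.obj →ₗ[k] W.obj) n) (v)
    (hv : v ∈ TruncPoly.tensorDeg k p V.obj m) :
    act V W f v ∈ TruncPoly.tensorDeg k p W.obj (m + n) := by
  refine TruncPoly.tensorDeg_induction (P := fun f => act V W f v ∈
      TruncPoly.tensorDeg k p W.obj (m + n)) (fun f a ha => ?_) ?_ ?_ f hf
  · refine TruncPoly.tensorDeg_induction (P := fun v => act V W (f ⊗ₜ a) v ∈
      TruncPoly.tensorDeg k p W.obj (m + n)) (fun v b hb => ?_) ?_ ?_ v hv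
    · rw [add_comm m n]
      exact TruncPoly.tmul_mem _ (TruncPoly.mul_mem k p ha hb)
    · rw [map_zero]; exact Submodule.zero_mem _
    · intro s t hs ht; rw [map_add]; exact Submodule.add_mem _ hs ht
  · rw [map_zero]; exact Submodule.zero_mem _
  · intro s t hs ht; rw [map_add]; exact Submodule.add_mem _ hs ht

/-- The graded finite dimensional space `V ⊗ A`, as a graded object of `V`. -/
def grObj (V : VA k p) : GrObj k (FGModuleCat.{u} k) where
  obj := FGModuleCat.of k (V.obj ⊗[k] TruncPoly k p)
  labels := TruncPoly.degrees p
  π n := FGModuleCat.ofHom (TruncPoly.tensorProj k p V.obj n)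
  π_zero n hn := by rw [TruncPoly.tensorProj_eq_zero k p n hn]; rfl
  π_same n := FGModuleCat.hom_ext <| LinearMap.ext fun t =>
    TruncPoly.tensorProj_same k p n _ (TruncPoly.tensorProj_mem k p n t)
  π_ne m n hmn := FGModuleCat.hom_ext <| LinearMap.ext fun t =>
    TruncPoly.tensorProj_ne k p n m (Ne.symm hmn) _ (TruncPoly.tensorProj_mem k p m t)
  π_sum := ofHom_sum k _ _ |>.trans <| FGModuleCat.hom_ext <| LinearMap.ext fun t => by
    change (∑ n ∈ TruncPoly.degrees p, TruncPoly.tensorProj k p V.obj n) t = t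
    rw [LinearMap.sum_apply, TruncPoly.tensorProj_sum]
  π_deg n := mem_deg_zero k _

end VA

/-- The forgetful functor `z`, taking `V ⊗ A` to the underlying graded space. -/
def zFun : VA k p ⥤ GrObj k (FGModuleCat.{u} k) where
  obj V := V.grObj
  map {V W} f := FGModuleCat.ofHom (VA.act V W (VA.toTen f))
  map_id V := FGModuleCat.hom_ext (VA.act_id V)
  map_comp {U V W} f g := FGModuleCat.hom_ext (VA.act_comp U V W f g)

theorem zFun_isGradedLinear : IsGradedLinear k (zFun k p) where
  map_add {V W} f g := FGModuleCat.hom_ext (map_add (VA.act V W) f g)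
  map_smul {V W} a f := FGModuleCat.hom_ext (map_smul (VA.act V W) a f)
  map_deg {V W} n f hf i j := by
    by_cases h : n + i - j = 0
    · rw [h]; exact mem_deg_zero k _
    · have : V.grObj.π i ≫ (zFun k p).map f ≫ W.grObj.π j = 0 := by
        refine FGModuleCat.hom_ext <| LinearMap.ext fun t => ?_
        exact TruncPoly.tensorProj_ne k p j (i + n) (by omega) _
          (VA.act_deg V W n i f hf _ (TruncPoly.tensorProj_mem k p i t))
      exact this.symm ▸ Submodule.zero_mem _

/-- The induction functor `t`, taking `V` to `V ⊗ A`. -/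
def tFun : FGModuleCat.{u} k ⥤ VA k p where
  obj V := ⟨V⟩
  map {V W} f := VA.tmul (V := ⟨V⟩) (W := ⟨W⟩) f.hom.hom 1
  map_id _ := rfl
  map_comp {U V W} f g := by
    change _ = VA.comp ⟨U⟩ ⟨V⟩ ⟨W⟩ (f.hom.hom ⊗ₜ 1) (g.hom.hom ⊗ₜ 1)
    rw [VA.comp_tmul, one_mul]; rfl

theorem tFun_isGradedLinear : IsGradedLinear k (tFun k p) where
  map_add f g := TensorProduct.add_tmul _ _ _
  map_smul a f := (TensorProduct.smul_tmul' _ _ _).symm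
  map_deg {V W} n f hf := by
    by_cases hn : n = 0
    · subst hn
      exact TruncPoly.tmul_mem (k := k) (p := p) f.hom.hom (TruncPoly.one_mem k p)
    · rw [eq_zero_of_mem_deg k hn hf]
      have : (tFun k p).map (0 : V ⟶ W) = 0 := TensorProduct.zero_tmul _ _
      rw [this]; exact Submodule.zero_mem _

/-! ### Duality -/

/-- The dual space functor on `V`. -/
def dualV : (FGModuleCat.{u} k)ᵒᵖ ⥤ FGModuleCat.{u} k where
  obj V := FGModuleCat.of k (Module.Dual k V.unop)
  map f := FGModuleCat.ofHom (Module.Dual.transpose f.unop.hom.hom)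
  map_id _ := rfl
  map_comp _ _ := rfl

theorem dualV_isGradedContra : IsGradedContra k (dualV k) where
  map_add f g := FGModuleCat.hom_ext (map_add Module.Dual.transpose f.hom.hom g.hom.hom)
  map_smul a f := FGModuleCat.hom_ext (map_smul Module.Dual.transpose a f.hom.hom)
  map_deg {V W} n f hf := by
    by_cases hn : n = 0
    · subst hn; exact mem_deg_zero k _
    · rw [eq_zero_of_mem_deg k hn hf]
      have : (dualV k).map (0 : V ⟶ W).op = 0 := 
        FGModuleCat.hom_ext (map_zero Module.Dual.transpose)
      rw [this]; exact Submodule.zero_mem _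

namespace VA

variable {k p}

/-- The transposition `Hom(V, W) ⊗ A → Hom(W^*, V^*) ⊗ A`, `f ⊗ a ↦ f^* ⊗ a`. -/
def transpose (V W : VA k p) : HomA V W →ₗ[k]
    HomA (⟨FGModuleCat.of k (Module.Dual k W.obj)⟩ : VA k p)
      (⟨FGModuleCat.of k (Module.Dual k V.obj)⟩ : VA k p) :=
  LinearMap.rTensor (TruncPoly k p) Module.Dual.transpose

theorem transpose_tmul (V W : VA k p) (f : V.obj →ₗ[k] W.obj) (a : TruncPoly k p) :
    transpose V W (f ⊗ₜ a) = Module.Dual.transpose f ⊗ₜ a := rfl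

theorem transpose_id (V : VA k p) :
    transpose V V ((LinearMap.id : V.obj →ₗ[k] V.obj) ⊗ₜ 1) =
      (LinearMap.id : Module.Dual k V.obj →ₗ[k] Module.Dual k V.obj) ⊗ₜ 1 := rfl

theorem transpose_comp (U V W : VA k p) (f : HomA U V) (g : HomA V W) :
    transpose U W (comp U V W f g) =
      comp (⟨FGModuleCat.of k (Module.Dual k W.obj)⟩ : VA k p)
        (⟨FGModuleCat.of k (Module.Dual k V.obj)⟩ : VA k p)
        (⟨FGModuleCat.of k (Module.Dual k U.obj)⟩ : VA k p)
        (transpose V W g) (transpose U V f) := by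
  induction f using TensorProduct.induction_on with
  | zero => simp only [map_zero, LinearMap.zero_apply]
  | tmul f a =>
    induction g using TensorProduct.induction_on with
    | zero => simp only [map_zero, LinearMap.zero_apply]
    | tmul g b =>
      change _ = (Module.Dual.transpose f ∘ₗ Module.Dual.transpose g) ⊗ₜ[k] (b * a)
      rw [mul_comm b a]
      rfl
    | add s t hs ht => simp only [map_add, LinearMap.add_apply, hs, ht]
  | add s t hs ht => simp only [map_add, LinearMap.add_apply, hs, ht]

theorem transpose_deg (V W : VA k p) (n : ℤ) (f : HomA V W)
    (hf : f ∈ TruncPoly.tensorDeg k p (V.obj →ₗ[k] W.obj) n) :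
    transpose V W f ∈
      TruncPoly.tensorDeg k p (Module.Dual k W.obj →ₗ[k] Module.Dual k V.obj) n := by
  refine TruncPoly.tensorDeg_induction (P := fun f => transpose V W f ∈
      TruncPoly.tensorDeg k p (Module.Dual k W.obj →ₗ[k] Module.Dual k V.obj) n)
    (fun f a ha => TruncPoly.tmul_mem _ ha) ?_ ?_ f hf
  · rw [map_zero]; exact Submodule.zero_mem _
  · intro s t hs ht; rw [map_add]; exact Submodule.add_mem _ hs ht

end VA

/-- The contravariant functor `V ⊗ A ↦ V^* ⊗ A` on `V_A`, with `f ⊗ a ↦ f^* ⊗ a`. -/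
def dualVA : (VA k p)ᵒᵖ ⥤ VA k p where
  obj V := ⟨FGModuleCat.of k (Module.Dual k V.unop.obj)⟩
  map {V W} f := VA.transpose W.unop V.unop (VA.toTen f.unop)
  map_id V := VA.transpose_id V.unop
  map_comp {U V W} f g := VA.transpose_comp W.unop V.unop U.unop (VA.toTen g.unop) (VA.toTen f.unop)

/-- The contravariant functor `V ⊗ A ↦ (V ⊗ A)^*` on `V_A`. As a graded `A`-module, the dual
`A^*` is isomorphic to `A[2(p-1)]`, so `(V ⊗ A)^*` is `(V^* ⊗ A)[2(p-1)]`, that is, `V^* ⊗ A`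
placed in degree `-2(p-1)`; under this isomorphism the dual of `f ⊗ a` is `f^* ⊗ a`. -/
def dualVAgr : (VA k p)ᵒᵖ ⥤ GrObj k (VA k p) :=
  dualVA k p ⋙ GrObj.singleFunctor k (VA k p) (-(2 * ((p : ℤ) - 1)))

theorem dualVAgr_isGradedContra : IsGradedContra k (dualVAgr k p) where
  map_add {V W} f g := map_add (VA.transpose V W) (VA.toTen f) (VA.toTen g)
  map_smul {V W} a f := map_smul (VA.transpose V W) a (VA.toTen f)
  map_deg {V W} n f hf := (GrObj.singleFunctor_isGradedLinear (k := k) (C := VA k p)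
    (-(2 * ((p : ℤ) - 1)))).map_deg n ((dualVA k p).map f.op)
      (VA.transpose_deg V W n (VA.toTen f) hf)

/-- The functor `V ↦ (V ⊗ A)[2(p-1)]`, which is isomorphic to `V ↦ V ⊗ A^*`. -/
def tDualFun : FGModuleCat.{u} k ⥤ GrObj k (VA k p) :=
  tFun k p ⋙ GrObj.singleFunctor k (VA k p) (-(2 * ((p : ℤ) - 1)))

theorem tDualFun_isGradedLinear : IsGradedLinear k (tDualFun k p) where
  map_add f g := (tFun_isGradedLinear k p).map_add f g
  map_smul a f := (tFun_isGradedLinear k p).map_smul a f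
  map_deg n f hf := (GrObj.singleFunctor_isGradedLinear (k := k) (C := VA k p)
    (-(2 * ((p : ℤ) - 1)))).map_deg n _ ((tFun_isGradedLinear k p).map_deg n f hf)

end


/-! ### The functors `χ_j` -/

section

variable {k : Type u} [Field k] {C : Type v} [Category.{u} C] [Preadditive C] [Linear k C]
  [GradedCat k C]

/-- The identification `Γ^1 C ≌ C`, as a functor. -/
def gamOne (k : Type u) [Field k] (C : Type v) [Category.{u} C] [Preadditive C] [Linear k C]
    [GradedCat k C] : GamCat k 1 C ⥤ C where
  obj X := X.obj
  map f := PiTensorProduct.subsingletonEquiv (0 : Fin 1) (Gam.val (GamCat.ten f))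
  map_id X := PiTensorProduct.subsingletonEquiv_apply_tprod _ _
  map_comp {X Y Z} f g := by
    change PiTensorProduct.subsingletonEquiv (0 : Fin 1)
        (tenMap₂ (Linear.comp X.obj Y.obj Z.obj) (Gam.val (GamCat.ten f)) (Gam.val (GamCat.ten g)))
      = _
    generalize Gam.val (GamCat.ten f) = s
    generalize Gam.val (GamCat.ten g) = t
    induction s using ten_induction with
    | tprod x =>
      induction t using ten_induction with
      | tprod y =>
        rw [tenMap₂_tprod]
        simp only [PiTensorProduct.subsingletonEquiv_apply_tprod]
        rfl
      | add s t hs ht => simp only [map_add, Preadditive.comp_add, hs, ht]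
      | smul a t ht => simp only [map_smul, Linear.comp_smul, ht]
    | add s t hs ht => simp only [map_add, LinearMap.add_apply, Preadditive.add_comp, hs, ht]
    | smul a t ht => simp only [map_smul, LinearMap.smul_apply, Linear.smul_comp, ht]

theorem gamOne_map_deg {X Y : GamCat k 1 C} (n : ℤ) (f : X ⟶ Y)
    (hf : f ∈ GradedCat.deg (k := k) X Y n) :
    (gamOne k C).map f ∈ GradedCat.deg (k := k) X.obj Y.obj n := by
  have hf : Gam.val (GamCat.ten f) ∈ tenDeg (GradedCat.deg (k := k) X.obj Y.obj) n := hf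
  change PiTensorProduct.subsingletonEquiv (0 : Fin 1) (Gam.val (GamCat.ten f)) ∈ _
  generalize Gam.val (GamCat.ten f) = s at hf
  induction hf using Submodule.span_induction with
  | mem t h =>
    obtain ⟨m, x, hm, hx, rfl⟩ := h
    rw [PiTensorProduct.subsingletonEquiv_apply_tprod]
    have e : m 0 = n := by simpa using hm
    exact e ▸ hx 0
  | zero => rw [map_zero]; exact Submodule.zero_mem _
  | add s t _ _ hs ht => rw [map_add]; exact Submodule.add_mem _ hs ht
  | smul a t _ ht => rw [map_smul]; exact Submodule.smul_mem _ a ht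

/-- A graded linear functor from `C` to graded spaces, as a functor of degree one. -/
def ofLinear (G : C ⥤ GrVect k) (hG : IsGraded k G) : GrFun k 1 C :=
  ⟨gamOne k C ⋙ G,
   { map_add := fun f g => (congrArg (fun h => (G.map h).lin) (map_add
        (PiTensorProduct.subsingletonEquiv (0 : Fin 1)) (Gam.val (GamCat.ten f))
          (Gam.val (GamCat.ten g)))).trans (hG.map_add _ _)
     map_smul := fun a f => (congrArg (fun h => (G.map h).lin) (map_smul
        (PiTensorProduct.subsingletonEquiv (0 : Fin 1)) a
          (Gam.val (GamCat.ten f)))).trans (hG.map_smul _ _)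
     map_deg := fun n f hf => hG.map_deg n _ (gamOne_map_deg n f hf) }⟩

end

section

variable (k : Type u) [Field k] (p : ℕ)

/-- Multiplication by `x^j` on `H ⊗ A`. -/
def mulXPow (H : Type u) [AddCommGroup H] [Module k H] (j : ℕ) :
    H ⊗[k] TruncPoly k p →ₗ[k] H ⊗[k] TruncPoly k p :=
  LinearMap.lTensor H (LinearMap.mulLeft k (TruncPoly.x k p ^ j))

/-- The subspace `x^j (H ⊗ A)` of `H ⊗ A`. -/
def xPow (H : Type u) [AddCommGroup H] [Module k H] (j : ℕ) :
    Submodule k (H ⊗[k] TruncPoly k p) := LinearMap.range (mulXPow k p H j)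

variable {k p}

theorem map_mem_xPow {H H' : Type u} [AddCommGroup H] [Module k H] [AddCommGroup H'] [Module k H']
    {φ : H ⊗[k] TruncPoly k p →ₗ[k] H' ⊗[k] TruncPoly k p}
    {φ' : H ⊗[k] TruncPoly k p →ₗ[k] H' ⊗[k] TruncPoly k p} {j : ℕ}
    (h : φ ∘ₗ mulXPow k p H j = mulXPow k p H' j ∘ₗ φ') (t) (ht : t ∈ xPow k p H j) :
    φ t ∈ xPow k p H' j := by
  obtain ⟨s, rfl⟩ := ht
  exact ⟨φ' s, (LinearMap.congr_fun h s).symm⟩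

theorem act_xPow {V W : VA k p} (f : VA.HomA V W) (j : ℕ) (t) (ht : t ∈ xPow k p V.obj j) :
    VA.act V W f t ∈ xPow k p W.obj j := by
  refine map_mem_xPow (φ' := VA.act V W f) ?_ t ht
  induction f using TensorProduct.induction_on with
  | zero => rw [map_zero, LinearMap.zero_comp, LinearMap.comp_zero]
  | tmul f a =>
    refine TensorProduct.ext' fun v b => ?_
    change f v ⊗ₜ[k] (a * (TruncPoly.x k p ^ j * b)) = f v ⊗ₜ[k] (TruncPoly.x k p ^ j * (a * b))
    rw [mul_left_comm]
  | add s t hs ht => rw [map_add, LinearMap.add_comp, LinearMap.comp_add, hs, ht]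

theorem proj_xPow {H : Type u} [AddCommGroup H] [Module k H] (n : ℤ) (j : ℕ) (t)
    (ht : t ∈ xPow k p H j) : TruncPoly.tensorProj k p H n t ∈ xPow k p H j := by
  refine map_mem_xPow (φ' := TruncPoly.tensorProj k p H (n - 2 * j)) ?_ t ht
  refine TensorProduct.ext' fun v b => ?_
  change v ⊗ₜ[k] proj (TruncPoly.deg_internal k p) n (TruncPoly.x k p ^ j * b) =
    v ⊗ₜ[k] (TruncPoly.x k p ^ j * proj (TruncPoly.deg_internal k p) (n - 2 * j) b)
  congr 1
  have hj : TruncPoly.x k p ^ j ∈ TruncPoly.deg k p (2 * (j : ℤ)) :=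
    Submodule.subset_span ⟨j, rfl, rfl⟩
  obtain ⟨T, hT⟩ := proj_sum' (TruncPoly.deg_internal k p) b
  conv_lhs => rw [hT]
  conv_rhs => rw [hT]
  simp only [map_sum, Finset.mul_sum]
  refine Finset.sum_congr rfl fun m _ => ?_
  have hm := proj_mem (TruncPoly.deg_internal k p) m b
  have hjm := TruncPoly.mul_mem k p hj hm
  by_cases h : n = 2 * (j : ℤ) + m
  · rw [h, proj_same _ _ _ hjm]
    have e : 2 * (j : ℤ) + m - 2 * j = m := by ring
    rw [e, proj_same _ _ _ hm]
  · rw [proj_ne _ _ _ h _ hjm, proj_ne _ (n - 2 * j) m (by omega) _ hm, mul_zero]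

/-- A linear map preserving `x^j (H ⊗ A)` and `x^(j+1) (H ⊗ A)`, on the quotients. -/
def chiMap {H H' : Type u} [AddCommGroup H] [Module k H] [AddCommGroup H'] [Module k H'] (j : ℕ)
    (φ : H ⊗[k] TruncPoly k p →ₗ[k] H' ⊗[k] TruncPoly k p)
    (h : ∀ i, ∀ t ∈ xPow k p H i, φ t ∈ xPow k p H' i) :
    (xPow k p H j ⧸ (xPow k p H (j + 1)).submoduleOf (xPow k p H j)) →ₗ[k]
      (xPow k p H' j ⧸ (xPow k p H' (j + 1)).submoduleOf (xPow k p H' j)) :=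
  Submodule.mapQ _ _ (φ.restrict (h j)) fun t ht => h (j + 1) t.1 ht

/-- The degree `n` part of `x^j (H ⊗ A) / x^(j+1) (H ⊗ A)`: the classes of the elements of
degree `n`. -/
def chiGr (H : Type u) [AddCommGroup H] [Module k H] (j : ℕ) (n : ℤ) :
    Submodule k (xPow k p H j ⧸ (xPow k p H (j + 1)).submoduleOf (xPow k p H j)) :=
  ((TruncPoly.tensorDeg k p H n).submoduleOf (xPow k p H j)).map (Submodule.mkQ _)

theorem chiGr_internal (H : Type u) [AddCommGroup H] [Module k H] (j : ℕ) :
    DirectSum.IsInternal (chiGr (k := k) (p := p) H j) := by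
  refine isInternal_of_proj _
    (fun n => chiMap j (TruncPoly.tensorProj k p H n) fun i => proj_xPow n i) ?_ ?_ ?_ ?_
  · intro n x
    obtain ⟨t, rfl⟩ := Submodule.mkQ_surjective _ x
    exact ⟨_, TruncPoly.tensorProj_mem k p n t.1, rfl⟩
  · rintro n _ ⟨t, ht, rfl⟩
    exact congrArg (Submodule.mkQ _) (Subtype.ext (TruncPoly.tensorProj_same k p n t.1 ht))
  · rintro m n hmn _ ⟨t, ht, rfl⟩
    have e : TruncPoly.tensorProj k p H m t.1 = 0 := TruncPoly.tensorProj_ne k p m n hmn t.1 ht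
    refine (congrArg (Submodule.mkQ _) (Subtype.ext (a2 := (0 : xPow k p H j)) e)).trans (map_zero _)
  · intro x
    obtain ⟨t, rfl⟩ := Submodule.mkQ_surjective _ x
    refine ⟨TruncPoly.degrees p, ?_⟩
    have e : t = ∑ n ∈ TruncPoly.degrees p,
        (TruncPoly.tensorProj k p H n).restrict (fun t => proj_xPow n j t) t := by
      refine Subtype.ext ?_
      rw [AddSubmonoidClass.coe_finsetSum]
      exact (TruncPoly.tensorProj_sum k p t.1).symm
    conv_lhs => rw [e]
    rw [map_sum]
    rfl

/-- The graded space `x^j (V ⊗ A) / x^(j+1) (V ⊗ A)`. -/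
def chiObj (j : ℕ) (V : VA k p) : GrVect k where
  carrier := xPow k p V.obj j ⧸ (xPow k p V.obj (j + 1)).submoduleOf (xPow k p V.obj j)
  gr := chiGr V.obj j
  internal := chiGr_internal V.obj j
  finite _ := inferInstance

/-- The class of an element of `x^j (V ⊗ A)`. -/
def chiMk (j : ℕ) (V : VA k p) : xPow k p V.obj j →ₗ[k] (chiObj j V).carrier := Submodule.mkQ _

/-- The action of a morphism of `V_A` on `x^j (V ⊗ A) / x^(j+1) (V ⊗ A)`. -/
def chiLin (j : ℕ) {V W : VA k p} (f : V ⟶ W) : (chiObj j V).carrier →ₗ[k] (chiObj j W).carrier :=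
  chiMap j (VA.act V W (VA.toTen f)) fun i => act_xPow (VA.toTen f) i

theorem chiLin_mk (j : ℕ) {V W : VA k p} (f : V ⟶ W) (t : xPow k p V.obj j) :
    chiLin j f (chiMk j V t) = chiMk j W
      ⟨VA.act V W (VA.toTen f) t.1, act_xPow (VA.toTen f) j t.1 t.2⟩ := rfl

theorem chi_ext {j : ℕ} {V W : VA k p} {φ ψ : (chiObj j V).carrier →ₗ[k] (chiObj j W).carrier}
    (h : ∀ t : xPow k p V.obj j, φ (chiMk j V t) = ψ (chiMk j V t)) : φ = ψ :=
  LinearMap.ext fun x => by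
    obtain ⟨t, rfl⟩ := Submodule.mkQ_surjective _ x
    exact h t

theorem chiLin_add (j : ℕ) {V W : VA k p} (f g : V ⟶ W) :
    chiLin j (f + g) = chiLin j f + chiLin j g := chi_ext fun t => by
  rw [LinearMap.add_apply, chiLin_mk, chiLin_mk, chiLin_mk, ← map_add]
  refine congrArg (chiMk j W) (Subtype.ext ?_)
  exact LinearMap.congr_fun (map_add (VA.act V W) (VA.toTen f) (VA.toTen g)) t.1

theorem chiLin_smul (j : ℕ) {V W : VA k p} (a : k) (f : V ⟶ W) :
    chiLin j (a • f) = a • chiLin j f := chi_ext fun t => by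
  rw [LinearMap.smul_apply, chiLin_mk, chiLin_mk, ← map_smul]
  refine congrArg (chiMk j W) (Subtype.ext ?_)
  exact LinearMap.congr_fun (map_smul (VA.act V W) a (VA.toTen f)) t.1

theorem chiLin_deg (j : ℕ) {V W : VA k p} (n : ℤ) (f : V ⟶ W)
    (hf : f ∈ GradedCat.deg (k := k) V W n) :
    chiLin j f ∈ GrVect.degHom (chiObj j V) (chiObj j W) n := by
  rintro m _ ⟨t, ht, rfl⟩
  exact ⟨_, VA.act_deg V W n m (VA.toTen f) hf t.1 ht, rfl⟩

theorem hom_induction_VA {V W : VA k p} {P : (V ⟶ W) → Prop} (f : V ⟶ W)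
    (deg : ∀ n, ∀ f ∈ GradedCat.deg (k := k) V W n, P f) (zero : P 0)
    (add : ∀ f g, P f → P g → P (f + g)) : P f := by
  have hf : f ∈ ⨆ n, GradedCat.deg (k := k) V W n := by
    rw [(GradedCat.internal (k := k) V W).submodule_iSup_eq_top]; trivial
  induction hf using Submodule.iSup_induction' with
  | mem n f hf => exact deg n f hf
  | zero => exact zero
  | add f g _ _ hf hg => exact add f g hf hg

theorem chiLin_mem (j : ℕ) {V W : VA k p} (f : V ⟶ W) :
    chiLin j f ∈ GrVect.grHom (chiObj j V) (chiObj j W) := by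
  refine hom_induction_VA (P := fun f => chiLin j f ∈ GrVect.grHom (chiObj j V) (chiObj j W)) f
    (fun n f hf => GrVect.degHom_le _ _ n (chiLin_deg j n f hf)) ?_ fun f g hf hg => ?_
  · have : chiLin j (0 : V ⟶ W) = 0 := by
      have := chiLin_smul j (0 : k) (0 : V ⟶ W)
      rwa [zero_smul, zero_smul] at this
    rw [this]; exact Submodule.zero_mem _
  · rw [chiLin_add]; exact Submodule.add_mem _ hf hg

/-- The functor `V ⊗ A ↦ x^j (V ⊗ A) / x^(j+1) (V ⊗ A)` on `V_A`. -/
def chiFun (j : ℕ) : VA k p ⥤ GrVect k where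
  obj V := chiObj j V
  map f := ⟨chiLin j f, chiLin_mem j f⟩
  map_id V := GrVect.hom_ext <| chi_ext fun t => by
    refine congrArg (chiMk j V) (Subtype.ext ?_)
    exact LinearMap.congr_fun (VA.act_id V) t.1
  map_comp {U V W} f g := GrVect.hom_ext <| chi_ext fun t => by
    refine congrArg (chiMk j W) (Subtype.ext ?_)
    exact LinearMap.congr_fun (VA.act_comp U V W (VA.toTen f) (VA.toTen g)) t.1

theorem chiFun_isGraded (j : ℕ) : IsGraded k (chiFun (k := k) (p := p) j) where
  map_add f g := chiLin_add j f g
  map_smul a f := chiLin_smul j a f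
  map_deg n f hf := chiLin_deg j n f hf

variable (k p)

/-- The affine functor `χ_j` of degree one, `χ_j(V ⊗ A) = x^j (V ⊗ A) / x^(j+1) (V ⊗ A)`. -/
def chi (j : ℕ) : GrFun k 1 (VA k p) := ofLinear (chiFun j) (chiFun_isGraded j)

end

/-! ### The functors `z^*`, `t^*`, `h^*` and the dualities -/

section

variable (k : Type u) [Field k] (p d : ℕ)

/-- `z^*(F) = F^gr ∘ Γ^d(z)`, so that `z^*(F)(V ⊗ A) = F^gr(V ⊗ A)`. -/
def zStar : GrFun k d (FGModuleCat.{u} k) ⥤ GrFun k d (VA k p) :=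
  grExtFunctor k d (FGModuleCat.{u} k) ⋙ pullback d (zFun k p) (zFun_isGradedLinear k p)

/-- `t^*(F) = F ∘ Γ^d(t)`, so that `t^*(F)(V) = F(V ⊗ A)`. -/
def tStar : GrFun k d (VA k p) ⥤ GrFun k d (FGModuleCat.{u} k) :=
  pullback d (tFun k p) (tFun_isGradedLinear k p)

/-- The functor `F ↦ (V ↦ F(V ⊗ A^*))`, where `F(V ⊗ A^*)` is `F^gr((V ⊗ A)[2(p-1)])`. -/
def tDualStar : GrFun k d (VA k p) ⥤ GrFun k d (FGModuleCat.{u} k) :=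
  grExtFunctor k d (VA k p) ⋙ pullback d (tDualFun k p) (tDualFun_isGradedLinear k p)

/-- The Kuhn duality `F^#(V) = F(V^*)^*`. -/
def kuhn : (GrFun k d (FGModuleCat.{u} k))ᵒᵖ ⥤ GrFun k d (FGModuleCat.{u} k) :=
  dualAlong d (dualV k) (dualV_isGradedContra k)

/-- The affine Kuhn duality `F^#(V ⊗ A) = F^gr((V^* ⊗ A)[2(p-1)])^*`. -/
def affineKuhn : (GrFun k d (VA k p))ᵒᵖ ⥤ GrFun k d (VA k p) :=
  (grExtFunctor k d (VA k p)).op ⋙ dualAlong d (dualVAgr k p) (dualVAgr_isGradedContra k p)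

/-- `h^* = # ∘ t^* ∘ #`. -/
def hStar : GrFun k d (VA k p) ⥤ GrFun k d (FGModuleCat.{u} k) :=
  (affineKuhn k p d).rightOp ⋙ (tStar k p d).op ⋙ kuhn k d

/-- The co-representable functor `V ⊗ A ↦ Hom_{Γ^d}(V ⊗ A, X)^*` labelled by a graded object `X`
of `V_A`; here `V ⊗ A` is placed in degree `0` and `Hom_{Γ^d}` is taken in `Γ^d` of the category of
graded objects of `V_A`. For `X` the graded object `(U^* ⊗ A)[2(p-1)]`, that is `U^* ⊗ A^*`, this is
`c^*_{U^* ⊗ A^*}`. -/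
def corepGr (X : GrObj k (VA k p)) : GrFun k d (VA k p) :=
  (pullback d (GrObj.singleFunctor k (VA k p) 0)
    (GrObj.singleFunctor_isGradedLinear 0)).obj (corep d X)

/-- The restriction of `z^*` to bounded below functors. -/
def zStarPlus : GrFunPlus k d (FGModuleCat.{u} k) ⥤ GrFunPlus k d (VA k p) :=
  ObjectProperty.lift _ (inclPlus k d (FGModuleCat.{u} k) ⋙ zStar k p d ⋙ (grFun k d (VA k p)).ι)
    fun F => ⟨((zStar k p d).obj ((inclPlus k d _).obj F)).property,
      fun _ => grExt_bddBelow F.property.1 F.property.2 _⟩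

/-- The restriction of `h^*` to bounded below functors. -/
def hStarPlus : GrFunPlus k d (VA k p) ⥤ GrFunPlus k d (FGModuleCat.{u} k) :=
  ObjectProperty.lift _ (inclPlus k d (VA k p) ⋙ hStar k p d ⋙ (grFun k d (FGModuleCat.{u} k)).ι)
    fun F => ⟨((hStar k p d).obj ((inclPlus k d _).obj F)).property,
      fun _ => dual_bddBelow (dual_bddAbove (grExt_bddBelow F.property.1 F.property.2 _))⟩

end

end AffineStrict

end

open AffineStrict

/-!
The reason for all five statements is that `A = k[x]/x^p` is a graded Frobenius algebra: the form
`(a, b) ↦` (coefficient of `x^(p-1)` in `a b`) is perfect, makes multiplication adjoint to itself,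
and pairs degree `m` with degree `2(p-1) - m`. It gives a natural perfect pairing of `V^* ⊗ A` with
`V ⊗ A`, called `pairEquiv`, for which `f ⊗ a` is adjoint to `f^* ⊗ a` (`pairEquiv_act`).

*Representable functors.* `Hom(U, V^*) ⊗ A` is symmetric in `U` and `V` (`flipVA`), so the dual of
`h^(U ⊗ A)` is `c^*_(U^* ⊗ A^*)`; placing an object in degree `-2(p-1)` shifts the morphisms to it,
in `Γ^d`, by `2(p-1)d` (`mem_gr_single`, `mem_deg_gam_single`).

*The functors `χ_j`.* The pairing of `V^* ⊗ A` with `V ⊗ A` vanishes on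
`x^j (V^* ⊗ A) × x^i (V ⊗ A)` for `i + j ≥ p`, so for `i + j = p - 1` it descends to the quotients
`χ_j` and `χ_i`; it remains perfect since the kernel of `x^j` on `V ⊗ A` is `x^(p-j) (V ⊗ A)`
(`layerPair_isPerfPair`).

*Duality and `z^*`.* The two functors `z^*(F^#)` and `z^*(F)^#` are, without their gradings, duals
of `F((V ⊗ A)^*)` and `F(V^* ⊗ A)`, which `pairEquiv` identifies. The part of weight `m` of one
corresponds to the part of weight `2(p-1)d - m` of the other (`pairIso_weight`), so the gradings
agree (`kuhnZApp_degree`).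

*The adjunction.* Without the gradings, `z^*` is precomposition with the forgetful functor
`V ⊗ A ↦ V ⊗ A` to spaces, and `h^*` is precomposition with induction `V ↦ V ⊗ A`. Induction is
also right adjoint to the forgetful functor: the counit is the coefficient of `x^(p-1)` and the
unit comes from the element `∑ x^i ⊗ x^(p-1-i)` of `A ⊗ A`, on which the two multiplications by
elements of `A` agree (`mul_casimir`). As `Γ^d` is functorial, this gives an adjunction on `Γ^d`
(`gamAdj`), and precomposition turns it into `h^* ⊣ z^*` (`hzAdj`). The unit has degree
`2(p-1)d - m` in weight `m` and the counit is concentrated in weight `2(p-1)d`, which is why the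
bijections preserve degrees once `h^*` carries the shift by `2(p-1)d` (`hzAdj_hasDegree_iff`).

*The form of `h^*`.* A graded space that is finite dimensional in each degree is its own double
dual (`bidualIso`), so unfolding the two dualities in `h^*(F)(V)` leaves `F^gr` at `V^** ⊗ A`
shifted by `2(p-1)`.
-/

noncomputable section

namespace AffineStrict

/-! ### Isomorphisms of graded spaces -/

namespace GrVect

variable {k : Type u} [Field k]

/-- A map of degree `j` carries the component of degree `m` to the component of degree `m + j`. -/
theorem map_proj {M N : GrVect k} {j : ℤ} {f : M.carrier →ₗ[k] N.carrier} (hf : f ∈ degHom M N j)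
    (m : ℤ) (x : M.carrier) :
    f (proj M.internal m x) = proj N.internal (m + j) (f x) := by
  obtain ⟨T, hT⟩ := proj_sum' M.internal x
  conv_lhs => rw [hT]
  conv_rhs => rw [hT]
  simp only [map_sum]
  refine Finset.sum_congr rfl fun n _ => ?_
  have hn := proj_mem M.internal n x
  by_cases h : m = n
  · subst h
    rw [proj_same M.internal m _ hn, proj_same N.internal _ _ (hf _ _ hn)]
  · rw [proj_ne M.internal m n h _ hn, proj_ne N.internal _ (n + j) (by omega) _ (hf _ _ hn),
      map_zero]

/-- The inverse of a homogeneous bijection is homogeneous. -/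
theorem symm_mem_degHom {M N : GrVect k} {j : ℤ} (e : M.carrier ≃ₗ[k] N.carrier)
    (he : e.toLinearMap ∈ degHom M N j) : e.symm.toLinearMap ∈ degHom N M (-j) := by
  intro n y hy
  have h : e (proj M.internal (n + -j) (e.symm y)) = y := by
    refine (map_proj he _ _).trans ?_
    change proj N.internal (n + -j + j) (e (e.symm y)) = y
    rw [e.apply_symm_apply, neg_add_cancel_right]
    exact proj_same _ _ _ hy
  have h' : e.symm y = proj M.internal (n + -j) (e.symm y) := e.symm_apply_eq.2 h.symm
  change e.symm y ∈ _
  rw [h']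
  exact proj_mem _ _ _

/-- The isomorphism of graded spaces given by a homogeneous bijection. -/
def isoOfDeg {M N : GrVect k} (j : ℤ) (e : M.carrier ≃ₗ[k] N.carrier)
    (he : e.toLinearMap ∈ degHom M N j) : M ≅ N where
  hom := ⟨e.toLinearMap, degHom_le _ _ _ he⟩
  inv := ⟨e.symm.toLinearMap, degHom_le _ _ _ (symm_mem_degHom e he)⟩
  hom_inv_id := hom_ext (LinearMap.ext e.symm_apply_apply)
  inv_hom_id := hom_ext (LinearMap.ext e.apply_symm_apply)

/-- The identity of the underlying spaces, as an isomorphism `M ≅ M[s]` of degree `-s`. -/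
def shiftIso (s : ℤ) (M : GrVect k) : M ≅ shiftObj s M :=
  isoOfDeg (N := shiftObj s M) (-s) (LinearEquiv.refl k M.carrier) fun n x hx => by
    change x ∈ M.gr (n + -s + s)
    rwa [neg_add_cancel_right]

theorem shiftIso_degree (s : ℤ) (M : GrVect k) :
    (shiftIso s M).hom.lin ∈ degHom M (shiftObj s M) (-s) := fun n x hx => by
  change x ∈ M.gr (n + -s + s)
  rwa [neg_add_cancel_right]

/-- The isomorphism of graded duals given by an isomorphism of graded spaces. -/
def dualIso {M N : GrVect k} (e : M ≅ N) : dualObj N ≅ dualObj M where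
  hom := dualMap e.hom
  inv := dualMap e.inv
  hom_inv_id := by rw [← dualMap_comp, e.inv_hom_id, dualMap_id]
  inv_hom_id := by rw [← dualMap_comp, e.hom_inv_id, dualMap_id]

/-- The canonical map from a graded space to its double dual. -/
def toBidual (M : GrVect k) : M.carrier →ₗ[k] GrDual (dualObj M) where
  toFun x := ⟨(evalDual M).flip x, by
    obtain ⟨T, hT⟩ := proj_sum' M.internal x
    refine ⟨T.map (Equiv.neg ℤ).toEmbedding, fun n hn ξ hξ => ?_⟩
    change evalDual M ξ x = 0
    rw [hT, map_sum]
    refine Finset.sum_eq_zero fun m hm => hξ m (fun h => hn ?_) _ (proj_mem _ _ _)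
    exact Finset.mem_map.2 ⟨m, hm, by simp [h]⟩⟩
  map_add' x y := evalDual_injective (dualObj M) (map_add (evalDual M).flip x y)
  map_smul' a x := evalDual_injective (dualObj M) (map_smul (evalDual M).flip a x)

theorem evalDual_toBidual (M : GrVect k) (x : M.carrier) (ξ : GrDual M) :
    evalDual (dualObj M) (toBidual M x) ξ = evalDual M ξ x := rfl

/-- The functional on `M` extending by zero a functional on the part of degree `n`. -/
def extendDual (M : GrVect k) (n : ℤ) : Module.Dual k (M.gr n) →ₗ[k] GrDual M where
  toFun g := ⟨g ∘ₗ (proj M.internal n).codRestrict (M.gr n) (proj_mem M.internal n), {n},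
    fun m hm x hx => by
      have : (proj M.internal n).codRestrict (M.gr n) (proj_mem M.internal n) x = 0 :=
        Subtype.ext (proj_ne M.internal n m (fun e => hm (by simp [e])) x hx)
      rw [LinearMap.comp_apply, this, map_zero]⟩
  map_add' f g := rfl
  map_smul' a g := rfl

theorem evalDual_extendDual (M : GrVect k) (n : ℤ) (g : Module.Dual k (M.gr n)) (x : M.carrier) :
    evalDual M (extendDual M n g) x = g ⟨proj M.internal n x, proj_mem M.internal n x⟩ := rfl

theorem extendDual_restrict (M : GrVect k) (n : ℤ) (ξ : GrDual M) (hξ : ξ ∈ dualGr M n) :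
    extendDual M (-n) (evalDual M ξ ∘ₗ (M.gr (-n)).subtype) = ξ := by
  refine dual_ext fun x => ?_
  rw [evalDual_extendDual]
  change evalDual M ξ (proj M.internal (-n) x) = _
  obtain ⟨T, hT⟩ := proj_sum M.internal x
  have hT := hT (insert (-n) T) (Finset.subset_insert _ _)
  conv_rhs => rw [hT]
  rw [map_sum, Finset.sum_eq_single_of_mem (-n) (Finset.mem_insert_self _ _)]
  exact fun m _ hm => hξ m hm _ (proj_mem _ _ _)

theorem toBidual_injective (M : GrVect k) : Function.Injective (toBidual M) := by
  refine (injective_iff_map_eq_zero _).2 fun x hx => ?_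
  obtain ⟨T, hT⟩ := proj_sum' M.internal x
  rw [hT]
  refine Finset.sum_eq_zero fun n _ => ?_
  have h : ∀ g : Module.Dual k (M.gr n), g ⟨proj M.internal n x, proj_mem M.internal n x⟩ = 0 :=
    fun g => LinearMap.congr_fun (congrArg (evalDual (dualObj M)) hx) (extendDual M n g)
  exact congrArg Subtype.val ((Module.forall_dual_apply_eq_zero_iff k _).1 h)

/-- Surjectivity rests on the finite dimension of the part of each degree. -/
theorem toBidual_surjective (M : GrVect k) : Function.Surjective (toBidual M) := by
  intro Φ
  obtain ⟨T, hT⟩ := Φ.2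
  have hy : ∀ n, ∃ y : M.gr (-n), ∀ g, evalDual (dualObj M) Φ (extendDual M (-n) g) = g y := by
    intro n
    have := M.finite (-n)
    obtain ⟨y, hy⟩ := (Module.evalEquiv k (M.gr (-n))).surjective
      (evalDual (dualObj M) Φ ∘ₗ extendDual M (-n))
    exact ⟨y, fun g => (LinearMap.congr_fun hy g).symm⟩
  choose y hy using hy
  refine ⟨∑ n ∈ T, (y n).1, dual_ext fun (ξ : GrDual M) => ?_⟩
  rw [evalDual_toBidual]
  obtain ⟨S, hS⟩ := proj_sum (dualObj M).internal ξ
  let c : ℤ → GrDual M := fun n => proj (dualObj M).internal n ξ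
  have hS : ξ = ∑ n ∈ S ∪ T, c n := hS (S ∪ T) Finset.subset_union_left
  have hc : ∀ n, c n ∈ dualGr M n := fun n => proj_mem _ _ _
  have h1 : ∀ n ∈ S ∪ T, evalDual M ξ (y n).1 = evalDual M (c n) (y n).1 := by
    intro n hn
    conv_lhs => rw [hS]
    rw [map_sum, LinearMap.sum_apply, Finset.sum_eq_single_of_mem n hn]
    exact fun m _ hm => hc m (-n) (by omega) _ (y n).2
  have h2 : ∀ n, evalDual (dualObj M) Φ (c n) = evalDual M (c n) (y n).1 := by
    intro n
    conv_lhs => rw [← extendDual_restrict M n _ (hc n)]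
    exact hy n _
  have h3 : evalDual (dualObj M) Φ ξ = ∑ n ∈ S ∪ T, evalDual (dualObj M) Φ (c n) :=
    (congrArg (evalDual (dualObj M) Φ) hS).trans (map_sum (evalDual (dualObj M) Φ) c _)
  have h4 : ∑ n ∈ T, evalDual (dualObj M) Φ (c n) = ∑ n ∈ S ∪ T, evalDual (dualObj M) Φ (c n) :=
    Finset.sum_subset Finset.subset_union_right fun n _ hn => hT n hn _ (proj_mem _ _ _)
  rw [h3, ← h4, map_sum]
  exact Finset.sum_congr rfl fun n hn => by rw [h2, h1 n (Finset.mem_union_right _ hn)]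

/-- The canonical isomorphism `M ≅ M^**`, which has degree zero. -/
def bidualIso (M : GrVect k) : M ≅ dualObj (dualObj M) :=
  isoOfDeg (N := dualObj (dualObj M)) 0
    (LinearEquiv.ofBijective (toBidual M) ⟨toBidual_injective M, toBidual_surjective M⟩)
    fun n x hx m hm ξ hξ => hξ n (by omega) x hx

theorem bidualIso_degree (M : GrVect k) :
    (bidualIso M).hom.lin ∈ degHom M (dualObj (dualObj M)) 0 :=
  fun n x hx m hm ξ hξ => hξ n (by omega) x hx

/-- On a finite dimensional space, every functional belongs to the graded dual. -/
def dualEquiv (M : GrVect k) [Module.Finite k M.carrier] :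
    GrDual M ≃ₗ[k] Module.Dual k M.carrier :=
  LinearEquiv.ofBijective (evalDual M) ⟨evalDual_injective M, fun g => by
    obtain ⟨T, hT⟩ := proj_sum_fin M.internal
    refine ⟨⟨g, T, fun n hn x hx => ?_⟩, rfl⟩
    have : x = 0 := by
      rw [hT T subset_rfl x]
      exact Finset.sum_eq_zero fun m hm =>
        proj_ne M.internal m n (fun e => hn (e ▸ hm)) x hx
    rw [this, map_zero]⟩

end GrVect

namespace Weights

variable {k : Type u} [Field k] {M : GrVect k} (W : Weights M)

theorem id_mem_grHom : (LinearMap.id : M.carrier →ₗ[k] M.carrier) ∈ GrVect.grHom M W.regrade := by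
  have e : (LinearMap.id : M.carrier →ₗ[k] M.carrier) = ∑ m ∈ W.T, W.ε m :=
    LinearMap.ext fun x => by rw [LinearMap.sum_apply, W.ε_sum]; rfl
  rw [e]
  refine Submodule.sum_mem _ fun m _ => GrVect.degHom_le _ _ m fun n x hx => W.mem_gr.2 fun l => ?_
  change W.ε l (W.ε m x) ∈ M.gr (n + m - l)
  rw [ε_ite]
  split_ifs with h
  · subst h
    simpa using W.ε_deg l n x hx
  · exact Submodule.zero_mem _

theorem id_mem_grHom' :
    (LinearMap.id : M.carrier →ₗ[k] M.carrier) ∈ GrVect.grHom W.regrade M := by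
  have e : (LinearMap.id : M.carrier →ₗ[k] M.carrier) = ∑ m ∈ W.T, W.ε m :=
    LinearMap.ext fun x => by rw [LinearMap.sum_apply, W.ε_sum]; rfl
  rw [e]
  exact Submodule.sum_mem _ fun m _ => GrVect.degHom_le W.regrade M (-m) fun n x hx =>
    W.mem_gr.1 hx m

/-- The identity of the underlying space, as an isomorphism from a graded space to the same space
with the new grading. It is not homogeneous: its restriction to the part of weight `m` has
degree `m`. -/
def regradeIso : M ≅ W.regrade where
  hom := ⟨LinearMap.id, W.id_mem_grHom⟩
  inv := ⟨LinearMap.id, W.id_mem_grHom'⟩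
  hom_inv_id := rfl
  inv_hom_id := rfl

end Weights

/-! ### Diagonal morphisms of `Γ^d C` -/

section

variable {k : Type u} [Field k] {d : ℕ}

section

variable {H H' H'' H₁ H₂ H₃ : Type u} [AddCommGroup H] [Module k H] [AddCommGroup H'] [Module k H']
  [AddCommGroup H''] [Module k H'']
  [AddCommGroup H₁] [Module k H₁] [AddCommGroup H₂] [Module k H₂] [AddCommGroup H₃] [Module k H₃]

theorem gamMap_gamMap (φ : H' →ₗ[k] H'') (ψ : H →ₗ[k] H') (t : Gam k d H) :
    gamMap φ (gamMap ψ t) = gamMap (φ ∘ₗ ψ) t := Gam.ext <| by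
  simp only [gamMap_val]
  generalize Gam.val t = t
  induction t using ten_induction with
  | tprod x => simp
  | add s t hs ht => simp only [map_add, hs, ht]
  | smul a t ht => simp only [map_smul, ht]

theorem gamMap_id (t : Gam k d H) : gamMap (LinearMap.id : H →ₗ[k] H) t = t := Gam.ext <| by
  simp only [gamMap_val]
  generalize Gam.val t = t
  induction t using ten_induction with
  | tprod x => simp
  | add s t hs ht => simp only [map_add, hs, ht]
  | smul a t ht => simp only [map_smul, ht]

/-- `Γ^d` of a linear equivalence. -/
def gamEquiv (e : H ≃ₗ[k] H') : Gam k d H ≃ₗ[k] Gam k d H' :=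
  LinearEquiv.ofLinearMap (gamMap e.toLinearMap) (gamMap e.symm.toLinearMap)
    (LinearMap.ext fun t => (gamMap_gamMap _ _ t).trans <| by
      rw [LinearEquiv.comp_symm]; exact gamMap_id t)
    (LinearMap.ext fun t => (gamMap_gamMap _ _ t).trans <| by
      rw [LinearEquiv.symm_comp]; exact gamMap_id t)

theorem gamMap_gamDiag (φ : H →ₗ[k] H') (h : H) :
    gamMap φ (gamDiag (k := k) (d := d) h) = gamDiag (φ h) := Gam.ext (tenMap_tprod _ _)

theorem gamMap₂_gamDiag (c : H₁ →ₗ[k] H₂ →ₗ[k] H₃) (x : H₁) (y : H₂) :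
    gamMap₂ c (gamDiag (k := k) (d := d) x) (gamDiag y) = gamDiag (c x y) :=
  Gam.ext (tenMap₂_tprod _ _ _)

theorem tenDeg_add (A : ℤ → Submodule k H) (s n : ℤ) :
    tenDeg (d := d) (fun i => A (i + s)) n = tenDeg A (n + s * d) := by
  refine le_antisymm (Submodule.span_le.2 ?_) (Submodule.span_le.2 ?_)
  · rintro _ ⟨m, x, hm, hx, rfl⟩
    refine tprod_mem_tenDeg (fun i => m i + s) x ?_ hx
    rw [Finset.sum_add_distrib, hm]
    simp [mul_comm]
  · rintro _ ⟨m, x, hm, hx, rfl⟩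
    refine tprod_mem_tenDeg (fun i => m i - s) x ?_ fun i => ?_
    · rw [Finset.sum_sub_distrib, hm]
      simp [mul_comm]
    · simpa using hx i

end

variable {C : Type v} [Category.{u} C] [Preadditive C] [Linear k C]

variable (k d) in
/-- The morphism `f ⊗ ⋯ ⊗ f` of `Γ^d C`. -/
def gamHom {X Y : C} (f : X ⟶ Y) : (⟨X⟩ : GamCat k d C) ⟶ (⟨Y⟩ : GamCat k d C) :=
  gamDiag (k := k) (d := d) f

theorem gamHom_id (X : C) : gamHom k d (𝟙 X) = 𝟙 (⟨X⟩ : GamCat k d C) := rfl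

theorem gamHom_comp {X Y Z : C} (f : X ⟶ Y) (g : Y ⟶ Z) :
    gamHom k d (f ≫ g) = gamHom k d f ≫ gamHom k d g :=
  (gamMap₂_gamDiag (Linear.comp X Y Z) f g).symm

variable (k d) in
/-- The isomorphism of `Γ^d C` given by an isomorphism of `C`. -/
def gamIso {X Y : C} (e : X ≅ Y) : (⟨X⟩ : GamCat k d C) ≅ (⟨Y⟩ : GamCat k d C) where
  hom := gamHom k d e.hom
  inv := gamHom k d e.inv
  hom_inv_id := by rw [← gamHom_comp, e.hom_inv_id, gamHom_id]
  inv_hom_id := by rw [← gamHom_comp, e.inv_hom_id, gamHom_id]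

/-- A natural transformation between linear constructions stays natural after applying `Γ^d`. -/
theorem gamHom_naturality {H : Type u} [AddCommGroup H] [Module k H] {X Y X' Y' : C}
    (P : H →ₗ[k] (X ⟶ Y)) (Q : H →ₗ[k] (X' ⟶ Y')) (a : X ⟶ X') (b : Y ⟶ Y')
    (h : ∀ x, P x ≫ b = a ≫ Q x) (t : Gam k d H) :
    (show (⟨X⟩ : GamCat k d C) ⟶ (⟨Y⟩ : GamCat k d C) from gamMap P t) ≫ gamHom k d b =
      gamHom k d a ≫ (show (⟨X'⟩ : GamCat k d C) ⟶ (⟨Y'⟩ : GamCat k d C) from gamMap Q t) :=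
  Gam.ext <| by
    change tenMap₂ (Linear.comp X Y Y') (tenMap P (Gam.val t))
        (PiTensorProduct.tprod k fun _ => b) =
      tenMap₂ (Linear.comp X X' Y') (PiTensorProduct.tprod k fun _ => a) (tenMap Q (Gam.val t))
    generalize Gam.val t = t
    induction t using ten_induction with
    | tprod x => simp [h]
    | add s t hs ht => simp only [map_add, LinearMap.add_apply, hs, ht]
    | smul a t ht => simp only [map_smul, LinearMap.smul_apply, ht]

variable [GradedCat k C]

theorem gamHom_deg {X Y : C} {f : X ⟶ Y} (hf : f ∈ GradedCat.deg (k := k) X Y 0) :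
    gamHom k d f ∈ GradedCat.deg (k := k) (⟨X⟩ : GamCat k d C) (⟨Y⟩ : GamCat k d C) 0 :=
  tprod_mem_tenDeg (fun _ => 0) _ (by simp) fun _ => hf

end

/-! ### Graded objects concentrated in one degree -/

section

variable {k : Type u} [Field k] {d : ℕ} {C : Type v} [Category.{u} C] [Preadditive C]
  [Linear k C] [GradedCat k C]

theorem weightHom_single (n : ℤ) (X : C) (m : ℤ) :
    weightHom (d := d) (GrObj.single (k := k) n X) m =
      if m = n * d then 𝟙 (⟨X⟩ : GamCat k d C) else 0 := by
  have hm : ∀ l, l ∈ totals d (GrObj.single (k := k) n X).labels ↔ l = n * d := by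
    intro l
    have : (GrObj.single (k := k) n X).labels = {n} := rfl
    simp [this, totals, mul_comm]
  split_ifs with h
  · have hs := weightHom_sum (d := d) (GrObj.single (k := k) n X)
    rw [Finset.sum_eq_single_of_mem m ((hm m).2 h)] at hs
    · exact hs
    · exact fun l hl hlm => absurd (((hm l).1 hl).trans h.symm) hlm
  · exact weightHom_zero _ m (mt (hm m).1 h)

theorem IsGraded.map_zero_lin {F : GamCat k d C ⥤ GrVect k} (hF : IsGraded k F)
    (X Y : GamCat k d C) : (F.map (0 : X ⟶ Y)).lin = 0 := by
  have := hF.map_smul (0 : k) (0 : X ⟶ Y)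
  rwa [zero_smul, zero_smul] at this

/-- The extension `F^gr`, on an object placed in degree `n`, shifts the grading by `n d`. -/
theorem mem_gr_single {F : GamCat k d C ⥤ GrVect k} (hF : IsGraded k F) (n : ℤ) (X : C) (i : ℤ)
    (x : (F.obj ⟨X⟩).carrier) :
    x ∈ (weights hF (GrObj.single n X)).gr i ↔ x ∈ (F.obj ⟨X⟩).gr (i - n * d) := by
  have hε : ∀ m, (weights hF (GrObj.single n X)).ε m x = if m = n * d then x else 0 := by
    intro m
    have e := congrArg (fun f => (F.map f).lin x) (weightHom_single (k := k) (d := d) n X m)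
    refine Eq.trans e ?_
    split_ifs
    · exact congrArg (fun f => GrVect.Hom.lin f x) (F.map_id _)
    · exact LinearMap.congr_fun (hF.map_zero_lin _ _) x
  refine (Weights.mem_gr (weights hF (GrObj.single n X)) (x := x)).trans
    ⟨fun h => ?_, fun h m => ?_⟩
  · have := h (n * d)
    rwa [hε, if_pos rfl] at this
  · rw [hε]
    split_ifs with hm
    · rwa [hm]
    · exact Submodule.zero_mem _

theorem deg_single (X Y : C) (m n i : ℤ) :
    GrObj.deg (GrObj.single (k := k) m X) (GrObj.single n Y) i =
      GradedCat.deg (k := k) X Y (i + (m - n)) := by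
  refine Submodule.ext fun (f : X ⟶ Y) => ?_
  change (∀ a b : ℤ, (if a = m then 𝟙 X else 0) ≫ f ≫ (if b = n then 𝟙 Y else 0) ∈
    GradedCat.deg (k := k) X Y (i + a - b)) ↔ f ∈ _
  refine ⟨fun h => ?_, fun h a b => ?_⟩
  · have := h m n
    rw [if_pos rfl, if_pos rfl, Category.comp_id, Category.id_comp] at this
    rwa [← add_sub_assoc]
  · by_cases ha : a = m
    · by_cases hb : b = n
      · rw [if_pos ha, if_pos hb, Category.comp_id, Category.id_comp, ha, hb, add_sub_assoc]
        exact h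
      · rw [if_neg hb, Limits.comp_zero, Limits.comp_zero]; exact Submodule.zero_mem _
    · rw [if_neg ha, Limits.zero_comp]; exact Submodule.zero_mem _

/-- Morphisms in `Γ^d` between objects placed in single degrees. -/
theorem mem_deg_gam_single (X Y : C) (m n i : ℤ)
    (f : (⟨GrObj.single m X⟩ : GamCat k d (GrObj k C)) ⟶ ⟨GrObj.single n Y⟩) :
    f ∈ GradedCat.deg (k := k) (⟨GrObj.single m X⟩ : GamCat k d (GrObj k C))
        ⟨GrObj.single n Y⟩ i ↔
      underHom f ∈ GradedCat.deg (k := k) (⟨X⟩ : GamCat k d C) ⟨Y⟩ (i + (m - n) * d) := by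
  change Gam.val (GamCat.ten f) ∈ tenDeg (GrObj.deg (GrObj.single m X) (GrObj.single n Y)) i ↔
    Gam.val (GamCat.ten f) ∈ tenDeg (GradedCat.deg (k := k) X Y) (i + (m - n) * d)
  rw [← tenDeg_add]
  have : GrObj.deg (GrObj.single (k := k) m X) (GrObj.single n Y) =
      fun i => GradedCat.deg (k := k) X Y (i + (m - n)) := funext fun i => deg_single X Y m n i
  rw [this]
  rfl

end

/-! ### Isomorphisms of graded functors -/

section

variable {k : Type u} [Field k] {d : ℕ} {C : Type v} [Category.{u} C] [Preadditive C]
  [Linear k C]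

theorem HasDegree.comp {F G H : GamCat k d C ⥤ GrVect k} {i j : ℤ} {α : F ⟶ G} {β : G ⟶ H}
    (hα : HasDegree i α) (hβ : HasDegree j β) : HasDegree (i + j) (α ≫ β) :=
  fun X => GrVect.comp_mem_degHom (hα X) (hβ X)

variable [GradedCat k C]

theorem inv_mem_degHom {M N : GrVect k} (e : M ≅ N) {j : ℤ}
    (he : e.hom.lin ∈ GrVect.degHom M N j) : e.inv.lin ∈ GrVect.degHom N M (-j) :=
  GrVect.symm_mem_degHom (LinearEquiv.ofLinearMap e.hom.lin e.inv.lin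
    (congrArg GrVect.Hom.lin e.inv_hom_id) (congrArg GrVect.Hom.lin e.hom_inv_id)) he

/-- An isomorphism of graded functors, from its components. -/
def grFunIso {F G : GrFun k d C} (e : ∀ X, F.obj.obj X ≅ G.obj.obj X)
    (h : ∀ {X Y} (f : X ⟶ Y), F.obj.map f ≫ (e Y).hom = (e X).hom ≫ G.obj.map f) : F ≅ G :=
  ObjectProperty.isoMk _ (NatIso.ofComponents e h)

theorem HasDegree.inv {F G : GrFun k d C} (e : F ≅ G) (h : HasDegree 0 e.hom.hom) :
    HasDegree 0 e.inv.hom := fun X => by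
  have := inv_mem_degHom (((grFun k d C).ι.mapIso e).app X) (h X)
  rwa [neg_zero] at this

theorem NatDegZeroIso.symm {D : Type*} [Category* D] {Φ Ψ : D ⥤ GrFun k d C}
    (h : NatDegZeroIso Φ Ψ) : NatDegZeroIso Ψ Φ := by
  obtain ⟨e, he⟩ := h
  exact ⟨e.symm, fun X => HasDegree.inv (e.app X) (he X)⟩

theorem NatDegZeroIso.trans {D : Type*} [Category* D] {Φ Ψ Θ : D ⥤ GrFun k d C}
    (h : NatDegZeroIso Φ Ψ) (h' : NatDegZeroIso Ψ Θ) : NatDegZeroIso Φ Θ := by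
  obtain ⟨e, he⟩ := h
  obtain ⟨e', he'⟩ := h'
  exact ⟨e ≪≫ e', fun X => HasDegree.comp (he X) (he' X)⟩

end

/-! ### The explicit form of `h^*` -/

section

variable (k : Type u) [Field k] (p : ℕ)

/-- The evaluation isomorphism `V ≅ V^**`. -/
def evalIso (V : FGModuleCat.{u} k) :
    V ≅ (dualV k).obj (Opposite.op ((dualV k).obj (Opposite.op V))) where
  hom := FGModuleCat.ofHom (Module.evalEquiv k V).toLinearMap
  inv := FGModuleCat.ofHom (Module.evalEquiv k V).symm.toLinearMap
  hom_inv_id := FGModuleCat.hom_ext (LinearMap.ext (Module.evalEquiv k V).symm_apply_apply)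
  inv_hom_id := FGModuleCat.hom_ext (LinearMap.ext (Module.evalEquiv k V).apply_symm_apply)

/-- The functor `V ↦ (V^* ⊗ A)^*`, isomorphic to `V ↦ V ⊗ A^*`. -/
def tBidualFun : FGModuleCat.{u} k ⥤ GrObj k (VA k p) :=
  (dualV k).rightOp ⋙ (tFun k p).op ⋙ dualVAgr k p

/-- The isomorphism `V ⊗ A^* ≅ (V^* ⊗ A)^*` induced by the evaluation `V ≅ V^**`. -/
def tEvalIso (V : FGModuleCat.{u} k) : (tDualFun k p).obj V ≅ (tBidualFun k p).obj V :=
  (tDualFun k p).mapIso (evalIso k V)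

theorem tEvalIso_naturality {V W : FGModuleCat.{u} k} (f : V ⟶ W) :
    (tDualFun k p).map f ≫ (tEvalIso k p W).hom =
      (tEvalIso k p V).hom ≫ (tBidualFun k p).map f :=
  ((tDualFun k p).map_comp f (evalIso k W).hom).symm.trans
      ((tDualFun k p).map_comp (evalIso k V).hom ((dualV k).map ((dualV k).map f.op).op))

variable (d : ℕ)

/-- The functor `Γ^d` of `V ↦ (V^* ⊗ A)^*`. -/
def gamTBidual : GamCat k d (FGModuleCat.{u} k) ⥤ GamCat k d (GrObj k (VA k p)) :=
  (gamFunctorOp d (dualV k) (dualV_isGradedContra k)).rightOp ⋙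
    (gamFunctor d (tFun k p) (tFun_isGradedLinear k p)).op ⋙
      gamFunctorOp d (dualVAgr k p) (dualVAgr_isGradedContra k p)

/-- The linear map on morphism spaces given by `V ↦ (V^* ⊗ A)^*`. -/
def tBidualLin (V W : FGModuleCat.{u} k) :
    (V ⟶ W) →ₗ[k] ((tBidualFun k p).obj V ⟶ (tBidualFun k p).obj W) :=
  (dualVAgr_isGradedContra k p).lin ((tFun k p).obj ((dualV k).obj (Opposite.op W)))
      ((tFun k p).obj ((dualV k).obj (Opposite.op V))) ∘ₗ
    (tFun_isGradedLinear k p).lin ((dualV k).obj (Opposite.op W)) ((dualV k).obj (Opposite.op V)) ∘ₗ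
      (dualV_isGradedContra k).lin V W

theorem gamTBidual_map {V W : GamCat k d (FGModuleCat.{u} k)} (f : V ⟶ W) :
    (gamTBidual k p d).map f = gamMap (tBidualLin k p V.obj W.obj) (GamCat.ten f) :=
  (congrArg (gamMap ((dualVAgr_isGradedContra k p).lin _ _)) (gamMap_gamMap _ _ _)).trans
    (gamMap_gamMap _ _ _)

theorem gam_tEvalIso_naturality {V W : GamCat k d (FGModuleCat.{u} k)} (f : V ⟶ W) :
    (gamFunctor d (tDualFun k p) (tDualFun_isGradedLinear k p)).map f ≫
      gamHom k d (tEvalIso k p W.obj).hom =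
    gamHom k d (tEvalIso k p V.obj).hom ≫ (gamTBidual k p d).map f := by
  rw [gamTBidual_map]
  exact gamHom_naturality ((tDualFun_isGradedLinear k p).lin V.obj W.obj)
    (tBidualLin k p V.obj W.obj) (tEvalIso k p V.obj).hom (tEvalIso k p W.obj).hom
    (fun x => tEvalIso_naturality k p x) (GamCat.ten f)

/-- The component of `F(V ⊗ A^*) ≅ h^*(F)(V)`: the evaluation `V ≅ V^**`, followed by the
identification of a graded space with its double dual. -/
def tDualToHApp (F : GrFun k d (VA k p)) (V : GamCat k d (FGModuleCat.{u} k)) :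
    ((tDualStar k p d).obj F).obj.obj V ≅ ((hStar k p d).obj F).obj.obj V :=
  (grExt F.obj F.property).mapIso (gamIso k d (tEvalIso k p V.obj)) ≪≫
    GrVect.bidualIso ((grExt F.obj F.property).obj ((gamTBidual k p d).obj V))

theorem tDualToHApp_degree (F : GrFun k d (VA k p)) (V : GamCat k d (FGModuleCat.{u} k)) :
    (tDualToHApp k p d F V).hom.lin ∈ GrVect.degHom (((tDualStar k p d).obj F).obj.obj V)
      (((hStar k p d).obj F).obj.obj V) 0 :=
  GrVect.comp_mem_degHom (i := 0) (j := 0) ((grExt_isGraded F.obj F.property).map_deg 0 _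
      (gamHom_deg ((tDualFun_isGradedLinear k p).map_deg 0 _ (mem_deg_zero k _))))
    (GrVect.bidualIso_degree _)

theorem tDualToHApp_naturality (F : GrFun k d (VA k p)) {V W : GamCat k d (FGModuleCat.{u} k)}
    (f : V ⟶ W) :
    ((tDualStar k p d).obj F).obj.map f ≫ (tDualToHApp k p d F W).hom =
      (tDualToHApp k p d F V).hom ≫ ((hStar k p d).obj F).obj.map f := by
  have h := ((grExt F.obj F.property).map_comp _ _).symm.trans
    ((congrArg (grExt F.obj F.property).map (gam_tEvalIso_naturality k p d f)).trans
      ((grExt F.obj F.property).map_comp _ _))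
  exact congrArg (fun g => g ≫ (GrVect.bidualIso ((grExt F.obj F.property).obj
      ((gamTBidual k p d).obj W))).hom) h

/-- The isomorphism `F(V ⊗ A^*) ≅ h^*(F)(V)`. -/
def tDualToH : tDualStar k p d ≅ hStar k p d :=
  NatIso.ofComponents
    (fun F => grFunIso (tDualToHApp k p d F) fun f => tDualToHApp_naturality k p d F f)
    fun {F G} α => by
      refine ObjectProperty.hom_ext _ (NatTrans.ext (funext fun V => ?_))
      have h := ((grExtFunctor k d (VA k p)).map α).hom.naturality
        (gamHom k d (tEvalIso k p V.obj).hom)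
      exact congrArg (fun g => g ≫ (GrVect.bidualIso ((grExt G.obj G.property).obj
        ((gamTBidual k p d).obj V))).hom) h.symm

/-- Placing objects in degree `-2(p-1)` shifts by `2(p-1)d`. -/
def tDualToShift : tDualStar k p d ≅
    tStar k p d ⋙ shiftFun k d (FGModuleCat.{u} k) (2 * ((p : ℤ) - 1) * d) :=
  NatIso.ofComponents
    (fun F => grFunIso (fun V => (weights F.property ((tDualFun k p).obj V.obj)).regradeIso.symm ≪≫
      GrVect.shiftIso _ (F.obj.obj ⟨(tFun k p).obj V.obj⟩)) fun _ => rfl)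
    fun _ => rfl

theorem tDualToShift_degree (F : GrFun k d (VA k p)) :
    HasDegree 0 ((tDualToShift k p d).hom.app F).hom := by
  intro V n x hx
  have h := (mem_gr_single F.property _ _ _ _).1 hx
  change x ∈ (F.obj.obj ⟨(tFun k p).obj V.obj⟩).gr (n + 0 + 2 * ((p : ℤ) - 1) * d)
  have e : n - -(2 * ((p : ℤ) - 1)) * d = n + 0 + 2 * ((p : ℤ) - 1) * d := by ring
  rwa [e] at h

theorem hStar_explicit : NatDegZeroIso (hStar k p d) (tDualStar k p d) ∧
    NatDegZeroIso (hStar k p d)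
      (tStar k p d ⋙ shiftFun k d (FGModuleCat.{u} k) (2 * ((p : ℤ) - 1) * d)) := by
  have h : NatDegZeroIso (hStar k p d) (tDualStar k p d) :=
    NatDegZeroIso.symm ⟨tDualToH k p d, fun F V => tDualToHApp_degree k p d F V⟩
  exact ⟨h, h.trans ⟨tDualToShift k p d, tDualToShift_degree k p d⟩⟩

end

/-! ### The adjunction between the forgetful functor and induction -/

namespace TruncPoly

variable (k : Type u) [Field k] (p : ℕ)

theorem linearMap_ext {M : Type*} [AddCommGroup M] [Module k M] {φ ψ : TruncPoly k p →ₗ[k] M}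
    (h : ∀ i < p, φ (x k p ^ i) = ψ (x k p ^ i)) : φ = ψ :=
  (basis k p).ext fun i => by
    rw [basis_apply]
    exact h i (lt_of_lt_of_eq i.2 (dim_eq k p))

/-- The element `∑ x^i ⊗ x^(p-1-i)` of `A ⊗ A`, dual to the form `(a, b) ↦ top (a b)`. -/
def casimir : TruncPoly k p ⊗[k] TruncPoly k p :=
  ∑ i ∈ Finset.range p, (x k p ^ i) ⊗ₜ[k] (x k p ^ (p - 1 - i))

theorem x_mul_casimir :
    LinearMap.rTensor (TruncPoly k p) (LinearMap.mulLeft k (x k p)) (casimir k p) =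
      LinearMap.lTensor (TruncPoly k p) (LinearMap.mulLeft k (x k p)) (casimir k p) := by
  obtain _ | n := p
  · simp [casimir]
  simp only [casimir, map_sum, LinearMap.rTensor_tmul, LinearMap.lTensor_tmul,
    LinearMap.mulLeft_apply, ← pow_succ']
  -- the two sums differ by a shift of the index, as `x^p = 0`
  rw [Finset.sum_range_succ, Finset.sum_range_succ', x_pow_eq_zero k (n + 1) (n + 1) le_rfl,
    TensorProduct.zero_tmul, add_zero, add_tsub_cancel_right, tsub_zero,
    x_pow_eq_zero k (n + 1) (n + 1) le_rfl, TensorProduct.tmul_zero, add_zero]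
  refine Finset.sum_congr rfl fun i hi => ?_
  have : n - i = n - (i + 1) + 1 := by have := Finset.mem_range.1 hi; omega
  rw [← this]

theorem mul_casimir (a : TruncPoly k p) :
    LinearMap.rTensor (TruncPoly k p) (LinearMap.mulLeft k a) (casimir k p) =
      LinearMap.lTensor (TruncPoly k p) (LinearMap.mulLeft k a) (casimir k p) := by
  have hpow : ∀ i, LinearMap.rTensor (TruncPoly k p) (LinearMap.mulLeft k (x k p ^ i))
      (casimir k p) =
      LinearMap.lTensor (TruncPoly k p) (LinearMap.mulLeft k (x k p ^ i)) (casimir k p) := by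
    intro i
    induction i with
    | zero => simp
    | succ i ih =>
      have hc := LinearMap.congr_fun ((LinearMap.rTensor_comp_lTensor
        (g := LinearMap.mulLeft k (x k p ^ i)) (f := LinearMap.mulLeft k (x k p))).trans
        (LinearMap.lTensor_comp_rTensor ..).symm) (casimir k p)
      conv_lhs => rw [pow_succ', LinearMap.mulLeft_mul, LinearMap.rTensor_comp_apply, ih]
      conv_rhs => rw [pow_succ, LinearMap.mulLeft_mul, LinearMap.lTensor_comp_apply,
        ← x_mul_casimir]
      exact hc
  let φ : TruncPoly k p →ₗ[k] TruncPoly k p ⊗[k] TruncPoly k p :=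
    LinearMap.applyₗ (casimir k p) ∘ₗ LinearMap.rTensorHom (TruncPoly k p) ∘ₗ
      LinearMap.mul k (TruncPoly k p)
  let ψ : TruncPoly k p →ₗ[k] TruncPoly k p ⊗[k] TruncPoly k p :=
    LinearMap.applyₗ (casimir k p) ∘ₗ LinearMap.lTensorHom (TruncPoly k p) ∘ₗ
      LinearMap.mul k (TruncPoly k p)
  have h : φ = ψ := linearMap_ext k p fun i _ => hpow i
  exact LinearMap.congr_fun h a

variable (hp : 0 < p)

/-- Expansion of an element of `A` in the monomial basis. -/
theorem sum_top (b : TruncPoly k p) :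
    ∑ i ∈ Finset.range p, top k p hp (x k p ^ (p - 1 - i) * b) • x k p ^ i = b := by
  let φ : TruncPoly k p →ₗ[k] TruncPoly k p := ∑ i ∈ Finset.range p,
    (top k p hp ∘ₗ LinearMap.mulLeft k (x k p ^ (p - 1 - i))).smulRight (x k p ^ i)
  have h : φ = LinearMap.id := linearMap_ext k p fun j hj => by
    simp only [φ, LinearMap.sum_apply, LinearMap.smulRight_apply, LinearMap.comp_apply,
      LinearMap.mulLeft_apply, ← pow_add, top_pow, LinearMap.id_apply]
    rw [Finset.sum_eq_single_of_mem j (Finset.mem_range.2 hj), if_pos (by omega), one_smul]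
    intro i hi hij
    have := Finset.mem_range.1 hi
    rw [if_neg (by omega), zero_smul]
  have := LinearMap.congr_fun h b
  simpa [φ, LinearMap.sum_apply] using this

theorem top_proj (n : ℤ) (hn : n ≠ 2 * ((p : ℤ) - 1)) (a : TruncPoly k p) :
    top k p hp (proj (deg_internal k p) n a) = 0 := by
  have h := proj_mem (deg_internal k p) n a
  generalize proj (deg_internal k p) n a = b at h
  induction h using Submodule.span_induction with
  | mem t h =>
    obtain ⟨i, h, rfl⟩ := h
    rw [top_pow, if_neg (by omega)]
  | zero => exact map_zero _
  | add s t _ _ hs ht => rw [map_add, hs, ht, add_zero]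
  | smul a t _ ht => rw [map_smul, ht, smul_zero]

theorem proj_pow (n : ℤ) (i : ℕ) :
    proj (deg_internal k p) n (x k p ^ i) = if n = 2 * (i : ℤ) then x k p ^ i else 0 := by
  have h : x k p ^ i ∈ deg k p (2 * (i : ℤ)) := Submodule.subset_span ⟨i, rfl, rfl⟩
  split_ifs with hn
  · rw [hn]; exact proj_same _ _ _ h
  · exact proj_ne _ _ _ hn _ h

end TruncPoly

section

variable {k : Type u} [Field k] {p : ℕ} (V W : Type u) [AddCommGroup V] [Module k V]
  [AddCommGroup W] [Module k W]

variable (k p) in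
/-- The element `∑ (v ↦ v ⊗ x^i) ⊗ x^(p-1-i)` of `Hom(V, V ⊗ A) ⊗ A`. -/
def unitTen : (V →ₗ[k] V ⊗[k] TruncPoly k p) ⊗[k] TruncPoly k p :=
  LinearMap.rTensor (TruncPoly k p) (TensorProduct.mk k V (TruncPoly k p)).flip
    (TruncPoly.casimir k p)

theorem unitTen_eq : unitTen k p V = ∑ i ∈ Finset.range p,
    ((TensorProduct.mk k V (TruncPoly k p)).flip (TruncPoly.x k p ^ i)) ⊗ₜ[k]
      (TruncPoly.x k p ^ (p - 1 - i)) := by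
  rw [unitTen, TruncPoly.casimir, map_sum]
  rfl

variable {V W}

/-- Naturality of `unitTen` under `g ⊗ a`: the two sides come from the two ways to multiply
the element `casimir` by `a`. -/
theorem unitTen_naturality (g : V →ₗ[k] W) (a : TruncPoly k p) :
    TensorProduct.map₂ (LinearMap.llcomp k V W (W ⊗[k] TruncPoly k p)).flip
        (LinearMap.mul k (TruncPoly k p)) (g ⊗ₜ[k] a) (unitTen k p W) =
      TensorProduct.map₂ (LinearMap.llcomp k V (V ⊗[k] TruncPoly k p)
        (W ⊗[k] TruncPoly k p)).flip (LinearMap.mul k (TruncPoly k p)) (unitTen k p V)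
        (TensorProduct.map g (LinearMap.mulLeft k a) ⊗ₜ[k] 1) := by
  let Ψ : TruncPoly k p ⊗[k] TruncPoly k p →ₗ[k]
      (V →ₗ[k] W ⊗[k] TruncPoly k p) ⊗[k] TruncPoly k p := LinearMap.rTensor (TruncPoly k p)
    ((LinearMap.llcomp k V W (W ⊗[k] TruncPoly k p)).flip g ∘ₗ
      (TensorProduct.mk k W (TruncPoly k p)).flip)
  have h1 : ∀ c, TensorProduct.map₂ (LinearMap.llcomp k V W (W ⊗[k] TruncPoly k p)).flip
      (LinearMap.mul k (TruncPoly k p)) (g ⊗ₜ[k] a) (LinearMap.rTensor (TruncPoly k p)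
        (TensorProduct.mk k W (TruncPoly k p)).flip c) =
      Ψ (LinearMap.lTensor (TruncPoly k p) (LinearMap.mulLeft k a) c) := by
    intro c
    induction c using TensorProduct.induction_on with
    | zero => simp only [map_zero]
    | tmul b b' => rfl
    | add s t hs ht => simp only [map_add, hs, ht]
  have h2 : ∀ c, TensorProduct.map₂ (LinearMap.llcomp k V (V ⊗[k] TruncPoly k p)
      (W ⊗[k] TruncPoly k p)).flip (LinearMap.mul k (TruncPoly k p))
        (LinearMap.rTensor (TruncPoly k p) (TensorProduct.mk k V (TruncPoly k p)).flip c)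
        (TensorProduct.map g (LinearMap.mulLeft k a) ⊗ₜ[k] 1) =
      Ψ (LinearMap.rTensor (TruncPoly k p) (LinearMap.mulLeft k a) c) := by
    intro c
    induction c using TensorProduct.induction_on with
    | zero => simp only [map_zero, LinearMap.zero_apply]
    | tmul b b' =>
      change (TensorProduct.map g (LinearMap.mulLeft k a) ∘ₗ
        (TensorProduct.mk k V (TruncPoly k p)).flip b) ⊗ₜ[k] (b' * 1) = _
      rw [mul_one]
      rfl
    | add s t hs ht => simp only [map_add, LinearMap.add_apply, hs, ht]
  exact (h1 _).trans ((congrArg Ψ (TruncPoly.mul_casimir k p a).symm).trans (h2 _).symm)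

end

theorem VA.induction_on {k : Type u} [Field k] {p : ℕ} {V W : VA k p} {P : (V ⟶ W) → Prop}
    (f : V ⟶ W) (tmul : ∀ g a, P (VA.tmul g a)) (add : ∀ f g, P f → P g → P (f + g)) : P f :=
  TensorProduct.induction_on (motive := P) (VA.toTen f)
    (by rw [← TensorProduct.zero_tmul (V.obj →ₗ[k] W.obj) (0 : TruncPoly k p)]; exact tmul 0 0)
    tmul add

section

variable (k : Type u) [Field k] (p : ℕ)

/-- The unit `V ⊗ A → (V ⊗ A) ⊗ A` of the adjunction between the forgetful functor and
induction. -/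
def coindUnit (V : VA k p) : V ⟶ (tFun k p).obj ((zFun k p).obj V).obj :=
  unitTen k p V.obj

theorem coindUnit_eq (V : VA k p) : coindUnit k p V = ∑ i ∈ Finset.range p,
    VA.tmul (V := V) (W := (tFun k p).obj ((zFun k p).obj V).obj)
      ((TensorProduct.mk k V.obj (TruncPoly k p)).flip (TruncPoly.x k p ^ i))
      (TruncPoly.x k p ^ (p - 1 - i)) :=
  unitTen_eq V.obj

theorem coindUnit_naturality {V W : VA k p} (f : V ⟶ W) :
    f ≫ coindUnit k p W = coindUnit k p V ≫ (tFun k p).map ((zFun k p).map f) := by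
  induction f using VA.induction_on with
  | tmul g a => exact unitTen_naturality g a
  | add s t hs ht =>
    have h := congrArg (fun g => coindUnit k p V ≫ g)
      ((congrArg (tFun k p).map ((zFun_isGradedLinear k p).map_add s t)).trans
        ((tFun_isGradedLinear k p).map_add _ _))
    exact (Preadditive.add_comp _ _ _ _ _ _).trans
      ((congrArg₂ (· + ·) hs ht).trans ((Preadditive.comp_add _ _ _ _ _ _).symm.trans h.symm))

/-- The part of the unit in degree `j` of `V ⊗ A` has degree `2(p-1) - j` in `V_A`. -/
theorem coindUnit_deg (V : VA k p) (j : ℤ) :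
    coindUnit k p V ≫ (tFun k p).map (((zFun k p).obj V).π j) ∈
      GradedCat.deg (k := k) V ((tFun k p).obj ((zFun k p).obj V).obj)
        (2 * ((p : ℤ) - 1) - j) := by
  rw [coindUnit_eq, Preadditive.sum_comp]
  refine Submodule.sum_mem _ fun i hi => ?_
  change (TruncPoly.tensorProj k p V.obj j ∘ₗ
    (TensorProduct.mk k V.obj (TruncPoly k p)).flip (TruncPoly.x k p ^ i)) ⊗ₜ[k]
      (TruncPoly.x k p ^ (p - 1 - i) * 1) ∈ TruncPoly.tensorDeg k p (V.obj →ₗ[k] _) _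
  by_cases h : j = 2 * (i : ℤ)
  · refine TruncPoly.tmul_mem _ ?_
    rw [mul_one]
    have := Finset.mem_range.1 hi
    exact Submodule.subset_span ⟨p - 1 - i, by omega, rfl⟩
  · have e : TruncPoly.tensorProj k p V.obj j ∘ₗ
        (TensorProduct.mk k V.obj (TruncPoly k p)).flip (TruncPoly.x k p ^ i) = 0 :=
      LinearMap.ext fun v => by
        change v ⊗ₜ[k] (proj (TruncPoly.deg_internal k p) j (TruncPoly.x k p ^ i)) = 0
        rw [TruncPoly.proj_pow, if_neg h, TensorProduct.tmul_zero]
    rw [e, TensorProduct.zero_tmul]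
    exact Submodule.zero_mem _

variable (hp : 0 < p)

/-- The counit `V ⊗ A → V` of the adjunction between the forgetful functor and induction: the
coefficient of `x^(p-1)`. -/
def coindCounit (V : FGModuleCat.{u} k) : ((zFun k p).obj ((tFun k p).obj V)).obj ⟶ V :=
  FGModuleCat.ofHom ((TensorProduct.rid k V).toLinearMap ∘ₗ
    LinearMap.lTensor V (TruncPoly.top k p hp))

theorem coindCounit_naturality {V W : FGModuleCat.{u} k} (f : V ⟶ W) :
    CategoryStruct.comp (X := ((zFun k p).obj ((tFun k p).obj V)).obj)
      ((zFun k p).map ((tFun k p).map f)) (coindCounit k p hp W) = coindCounit k p hp V ≫ f :=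
  FGModuleCat.hom_ext <| TensorProduct.ext' fun (v : V) a => by
    change TruncPoly.top k p hp (1 * a) • f.hom.hom v = f.hom.hom (TruncPoly.top k p hp a • v)
    rw [one_mul, map_smul]

theorem coindCounit_deg (V : FGModuleCat.{u} k) (j : ℤ) (hj : j ≠ 2 * ((p : ℤ) - 1)) :
    ((zFun k p).obj ((tFun k p).obj V)).π j ≫ coindCounit k p hp V = 0 :=
  FGModuleCat.hom_ext <| TensorProduct.ext' fun v a => by
    change TruncPoly.top k p hp (proj (TruncPoly.deg_internal k p) j a) • v = 0
    rw [TruncPoly.top_proj k p hp j hj, zero_smul]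

theorem coind_left_triangle (V : VA k p) :
    CategoryStruct.comp (X := ((zFun k p).obj V).obj) ((zFun k p).map (coindUnit k p V))
      (coindCounit k p hp ((zFun k p).obj V).obj) =
      𝟙 ((zFun k p).obj V).obj :=
  FGModuleCat.hom_ext <| TensorProduct.ext' fun v b => by
    let V' : VA k p := (tFun k p).obj ((zFun k p).obj V).obj
    let Φ : VA.HomA V V' →ₗ[k] V.obj ⊗[k] TruncPoly k p :=
      (TensorProduct.rid k (V.obj ⊗[k] TruncPoly k p)).toLinearMap ∘ₗ
        LinearMap.lTensor _ (TruncPoly.top k p hp) ∘ₗ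
          LinearMap.applyₗ (v ⊗ₜ[k] b) ∘ₗ VA.act V V'
    change Φ (coindUnit k p V) = v ⊗ₜ[k] b
    rw [coindUnit_eq, map_sum]
    conv_rhs => rw [← TruncPoly.sum_top k p hp b, TensorProduct.tmul_sum]
    refine Finset.sum_congr rfl fun i _ => ?_
    rw [TensorProduct.tmul_smul]
    rfl

theorem coind_right_triangle (V : FGModuleCat.{u} k) :
    coindUnit k p ((tFun k p).obj V) ≫ (tFun k p).map (coindCounit k p hp V) =
      𝟙 ((tFun k p).obj V) := by
  rw [coindUnit_eq, Preadditive.sum_comp]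
  have h : ∀ i ∈ Finset.range p,
      VA.tmul (V := (tFun k p).obj V) (W := (tFun k p).obj ((zFun k p).obj ((tFun k p).obj V)).obj)
        ((TensorProduct.mk k V (TruncPoly k p)).flip (TruncPoly.x k p ^ i))
        (TruncPoly.x k p ^ (p - 1 - i)) ≫ (tFun k p).map (coindCounit k p hp V) =
      if i = p - 1 then 𝟙 ((tFun k p).obj V) else 0 := by
    intro i hi
    have e : (coindCounit k p hp V).hom.hom ∘ₗ
        (TensorProduct.mk k V (TruncPoly k p)).flip (TruncPoly.x k p ^ i) =
        if i = p - 1 then LinearMap.id else 0 := LinearMap.ext fun v => by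
      change TruncPoly.top k p hp (TruncPoly.x k p ^ i) • v = _
      rw [TruncPoly.top_pow]
      split_ifs
      · exact one_smul k v
      · exact zero_smul k v
    change ((coindCounit k p hp V).hom.hom ∘ₗ
        (TensorProduct.mk k V (TruncPoly k p)).flip (TruncPoly.x k p ^ i)) ⊗ₜ[k]
      (TruncPoly.x k p ^ (p - 1 - i) * 1) = _
    rw [e, mul_one]
    split_ifs with hi'
    · rw [hi', Nat.sub_self, pow_zero]; rfl
    · exact TensorProduct.zero_tmul _ _
  refine (Finset.sum_congr rfl h).trans ?_
  rw [Finset.sum_ite_eq' (Finset.range p) (p - 1),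
    if_pos (Finset.mem_range.2 (by omega))]

end

/-! ### The adjunction between `h^*` and `z^*` -/

section

variable (k : Type u) [Field k] (p d : ℕ)

/-- `Γ^d` of the forgetful functor `V ⊗ A ↦ V ⊗ A`, without the gradings. -/
def gamForget : GamCat k d (VA k p) ⥤ GamCat k d (FGModuleCat.{u} k) where
  obj V := ⟨((zFun k p).obj V.obj).obj⟩
  map f := underHom ((gamFunctor d (zFun k p) (zFun_isGradedLinear k p)).map f)
  map_id V := congrArg underHom ((gamFunctor d (zFun k p) (zFun_isGradedLinear k p)).map_id V)
  map_comp f g :=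
    congrArg underHom ((gamFunctor d (zFun k p) (zFun_isGradedLinear k p)).map_comp f g)

/-- `Γ^d` of the induction functor `V ↦ V ⊗ A`. -/
abbrev gamInd : GamCat k d (FGModuleCat.{u} k) ⥤ GamCat k d (VA k p) :=
  gamFunctor d (tFun k p) (tFun_isGradedLinear k p)

/-- The linear map on morphism spaces given by the forgetful functor. -/
def forgetLin (V W : VA k p) :
    (V ⟶ W) →ₗ[k] (((zFun k p).obj V).obj ⟶ ((zFun k p).obj W).obj) :=
  (zFun_isGradedLinear k p).lin V W

theorem gamInd_gamForget_map {V W : GamCat k d (VA k p)} (f : V ⟶ W) :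
    (gamInd k p d).map ((gamForget k p d).map f) =
      gamMap ((tFun_isGradedLinear k p).lin _ _ ∘ₗ forgetLin k p V.obj W.obj) (GamCat.ten f) :=
  gamMap_gamMap _ _ _

theorem gamForget_gamInd_map {V W : GamCat k d (FGModuleCat.{u} k)} (f : V ⟶ W) :
    (gamForget k p d).map ((gamInd k p d).map f) =
      gamMap (forgetLin k p _ _ ∘ₗ (tFun_isGradedLinear k p).lin V.obj W.obj) (GamCat.ten f) :=
  gamMap_gamMap _ _ _

variable (hp : 0 < p)

theorem gam_coindUnit_naturality {V W : GamCat k d (VA k p)} (f : V ⟶ W) :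
    f ≫ gamHom k d (coindUnit k p W.obj) =
      gamHom k d (coindUnit k p V.obj) ≫ (gamInd k p d).map ((gamForget k p d).map f) := by
  have h := gamHom_naturality LinearMap.id
    ((tFun_isGradedLinear k p).lin _ _ ∘ₗ forgetLin k p V.obj W.obj)
    (coindUnit k p V.obj) (coindUnit k p W.obj) (fun x => coindUnit_naturality k p x)
    (GamCat.ten f)
  have h' : gamMap LinearMap.id (GamCat.ten f) = f := gamMap_id (GamCat.ten f)
  exact (congrArg (fun g : V ⟶ W => g ≫ gamHom k d (coindUnit k p W.obj)) h'.symm).trans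
    (h.trans (congrArg (fun g => gamHom k d (coindUnit k p V.obj) ≫ g)
      (gamInd_gamForget_map k p d f).symm))

theorem gam_coindCounit_naturality {V W : GamCat k d (FGModuleCat.{u} k)} (f : V ⟶ W) :
    (gamForget k p d).map ((gamInd k p d).map f) ≫ gamHom k d (coindCounit k p hp W.obj) =
      gamHom k d (coindCounit k p hp V.obj) ≫ f := by
  have h := gamHom_naturality
    (forgetLin k p _ _ ∘ₗ (tFun_isGradedLinear k p).lin V.obj W.obj) LinearMap.id
    (coindCounit k p hp V.obj) (coindCounit k p hp W.obj)
    (fun x => coindCounit_naturality k p hp x) (GamCat.ten f)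
  have h' : gamMap LinearMap.id (GamCat.ten f) = f := gamMap_id (GamCat.ten f)
  exact (congrArg (fun g => g ≫ gamHom k d (coindCounit k p hp W.obj))
    (gamForget_gamInd_map k p d f)).trans
      (h.trans (congrArg (fun g : V ⟶ W => gamHom k d (coindCounit k p hp V.obj) ≫ g) h'))

theorem gamForget_map_gamHom {V W : VA k p} (f : V ⟶ W) :
    (gamForget k p d).map (gamHom k d f) = gamHom k d (forgetLin k p V W f) :=
  gamMap_gamDiag (forgetLin k p V W) f

theorem gamInd_map_gamHom {V W : FGModuleCat.{u} k} (f : V ⟶ W) :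
    (gamInd k p d).map (gamHom k d f) = gamHom k d ((tFun k p).map f) :=
  gamMap_gamDiag ((tFun_isGradedLinear k p).lin V W) f

theorem gam_coind_left_triangle (V : VA k p) :
    (gamForget k p d).map (gamHom k d (coindUnit k p V)) ≫
      gamHom k d (coindCounit k p hp ((zFun k p).obj V).obj) =
        𝟙 (⟨((zFun k p).obj V).obj⟩ : GamCat k d (FGModuleCat.{u} k)) := by
  rw [gamForget_map_gamHom]
  exact (gamHom_comp (forgetLin k p _ _ (coindUnit k p V))
    (coindCounit k p hp ((zFun k p).obj V).obj)).symm.trans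
      (congrArg (gamHom k d) (coind_left_triangle k p hp V))

theorem gam_coind_right_triangle (V : FGModuleCat.{u} k) :
    gamHom k d (coindUnit k p ((tFun k p).obj V)) ≫
      (gamInd k p d).map (gamHom k d (coindCounit k p hp V)) =
        𝟙 (⟨(tFun k p).obj V⟩ : GamCat k d (VA k p)) := by
  exact (congrArg (fun g => gamHom k d (coindUnit k p ((tFun k p).obj V)) ≫ g)
    (gamInd_map_gamHom k p d (coindCounit k p hp V))).trans
      ((gamHom_comp (coindUnit k p ((tFun k p).obj V))
        ((tFun k p).map (coindCounit k p hp V))).symm.trans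
          (congrArg (gamHom k d) (coind_right_triangle k p hp V)))

/-- On `Γ^d`, the forgetful functor is left adjoint to induction: as `A` is a Frobenius algebra,
induction is also coinduction. -/
def gamAdj : gamForget k p d ⊣ gamInd k p d where
  unit :=
    { app := fun V => gamHom k d (coindUnit k p V.obj)
      naturality := fun _ _ f => gam_coindUnit_naturality k p d f }
  counit :=
    { app := fun V => gamHom k d (coindCounit k p hp V.obj)
      naturality := fun _ _ f => gam_coindCounit_naturality k p d hp f }
  left_triangle_components V := gam_coind_left_triangle k p d hp V.obj
  right_triangle_components V := gam_coind_right_triangle k p d hp V.obj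

/-- In degree `m` of `V ⊗ A`, the unit has degree `2(p-1)d - m`. -/
theorem gamAdj_unit_deg (V : VA k p) (m : ℤ) :
    gamHom k d (coindUnit k p V) ≫ (gamInd k p d).map (weightHom (d := d) ((zFun k p).obj V) m) ∈
      GradedCat.deg (k := k) (⟨V⟩ : GamCat k d (VA k p))
        ⟨(tFun k p).obj ((zFun k p).obj V).obj⟩ (2 * ((p : ℤ) - 1) * d - m) := by
  change tenMap₂ (Linear.comp V ((tFun k p).obj ((zFun k p).obj V).obj)
      ((tFun k p).obj ((zFun k p).obj V).obj))
    (PiTensorProduct.tprod k fun _ => coindUnit k p V)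
    (tenMap ((tFun_isGradedLinear k p).lin _ _) (weightTen d ((zFun k p).obj V) m)) ∈ tenDeg _ _
  rw [weightTen, map_sum, map_sum]
  refine Submodule.sum_mem _ fun a ha => ?_
  rw [tenMap_tprod, tenMap₂_tprod]
  refine tprod_mem_tenDeg (fun i => 2 * ((p : ℤ) - 1) - a i) _ ?_ fun i =>
    coindUnit_deg k p V (a i)
  rw [Finset.sum_sub_distrib, (mem_multiIdx.1 ha).2]
  simp [mul_comm]

/-- The counit is concentrated in degree `2(p-1)d`. -/
theorem gamAdj_counit_deg (V : FGModuleCat.{u} k) (m : ℤ) (hm : m ≠ 2 * ((p : ℤ) - 1) * d) :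
    weightHom (d := d) ((zFun k p).obj ((tFun k p).obj V)) m ≫
      gamHom k d (coindCounit k p hp V) = 0 := Gam.ext <| by
  change tenMap₂ (Linear.comp ((zFun k p).obj ((tFun k p).obj V)).obj _ V)
    (weightTen d ((zFun k p).obj ((tFun k p).obj V)) m)
    (PiTensorProduct.tprod k fun _ => coindCounit k p hp V) = 0
  rw [weightTen, map_sum, LinearMap.sum_apply]
  refine Finset.sum_eq_zero fun a ha => ?_
  rw [tenMap₂_tprod]
  obtain ⟨i, hi⟩ : ∃ i, a i ≠ 2 * ((p : ℤ) - 1) := by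
    by_contra! h
    refine hm ((mem_multiIdx.1 ha).2.symm.trans ?_)
    simp [h, mul_comm]
  exact MultilinearMap.map_coord_zero _ i (coindCounit_deg k p hp V (a i) hi)

/-- `F(V ⊗ A) ≅ F(V ⊗ A^*)`, naturally in `F` and `V`; the two sides have the same underlying
space. -/
def indIsoTDual :
    (grFunPlus k d (VA k p)).ι ⋙ (Functor.whiskeringLeft _ _ _).obj (gamInd k p d) ≅
      inclPlus k d (VA k p) ⋙ tDualStar k p d ⋙ (grFun k d (FGModuleCat.{u} k)).ι :=
  NatIso.ofComponents (fun F => NatIso.ofComponents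
      (fun V => (weights F.property.1 ((tDualFun k p).obj V.obj)).regradeIso) fun _ => rfl)
      (fun _ => rfl)

/-- `F(V ⊗ A) ≅ h^*(F)(V)`, an isomorphism of degree `-2(p-1)d`, naturally in `F` and `V`. -/
def indIsoH : (grFunPlus k d (VA k p)).ι ⋙ (Functor.whiskeringLeft _ _ _).obj (gamInd k p d) ≅
    hStarPlus k p d ⋙ (grFunPlus k d (FGModuleCat.{u} k)).ι :=
  indIsoTDual k p d ≪≫ Functor.isoWhiskerLeft (inclPlus k d (VA k p))
      (Functor.isoWhiskerRight (tDualToH k p d) (grFun k d (FGModuleCat.{u} k)).ι)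

/-- `F(V ⊗ A) ≅ F^gr(V ⊗ A)`, naturally in `F` and `V`. -/
def forgetIsoZ : (grFunPlus k d (FGModuleCat.{u} k)).ι ⋙
      (Functor.whiskeringLeft _ _ _).obj (gamForget k p d) ≅
    zStarPlus k p d ⋙ (grFunPlus k d (VA k p)).ι :=
  NatIso.ofComponents (fun F => NatIso.ofComponents
      (fun V => (weights F.property.1 ((zFun k p).obj V.obj)).regradeIso) fun _ => rfl)
      (fun _ => rfl)

theorem indIsoH_degree (F : GrFunPlus k d (VA k p)) (V : GamCat k d (FGModuleCat.{u} k)) :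
    (((indIsoH k p d).hom.app F).app V).lin ∈
      GrVect.degHom (F.obj.obj ((gamInd k p d).obj V)) (((hStarPlus k p d).obj F).obj.obj V)
        (-(2 * ((p : ℤ) - 1) * d)) := by
  have h : ((weights F.property.1 ((tDualFun k p).obj V.obj)).regradeIso.hom).lin ∈
      GrVect.degHom (F.obj.obj ((gamInd k p d).obj V))
        (weights F.property.1 ((tDualFun k p).obj V.obj)).regrade (-(2 * ((p : ℤ) - 1) * d)) := by
    intro n x hx
    refine (mem_gr_single F.property.1 _ _ _ _).2 ?_
    have e : n + -(2 * ((p : ℤ) - 1) * d) - -(2 * ((p : ℤ) - 1)) * d = n := by ring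
    rw [e]
    exact hx
  have h' := GrVect.comp_mem_degHom h
    (tDualToHApp_degree k p d ((inclPlus k d (VA k p)).obj F) V)
  rw [add_zero] at h'
  exact h'

/-- The adjunction between `h^*` and `z^*`. -/
def hzAdj : hStarPlus k p d ⊣ zStarPlus k p d :=
  ((gamAdj k p d hp).whiskerLeft (GrVect k)).restrictFullyFaithful
    (grFunPlus k d (VA k p)).fullyFaithfulι (grFunPlus k d (FGModuleCat.{u} k)).fullyFaithfulι
    (indIsoH k p d) (forgetIsoZ k p d)

theorem hzAdj_homEquiv_lin {F : GrFunPlus k d (VA k p)} {G : GrFunPlus k d (FGModuleCat.{u} k)}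
    (α : (hStarPlus k p d).obj F ⟶ G) (V : GamCat k d (VA k p)) :
    ((((hzAdj k p d hp).homEquiv F G α).hom.app V).lin :
        (F.obj.obj V).carrier →ₗ[k] (G.obj.obj ((gamForget k p d).obj V)).carrier) =
      (α.hom.app ((gamForget k p d).obj V)).lin ∘ₗ
        (((indIsoH k p d).hom.app F).app ((gamForget k p d).obj V)).lin ∘ₗ
          (F.obj.map (gamHom k d (coindUnit k p V.obj))).lin := by
  have h := Adjunction.restrictFullyFaithful_homEquiv_apply
    ((gamAdj k p d hp).whiskerLeft (GrVect k)) (grFunPlus k d (VA k p)).fullyFaithfulι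
    (grFunPlus k d (FGModuleCat.{u} k)).fullyFaithfulι (indIsoH k p d) (forgetIsoZ k p d) α
  exact congrArg (fun β => (β.hom.app V).lin) h

end

section

variable (k : Type u) [Field k] (p d : ℕ)

/-- The transposition `F(V ⊗ A) → G(V) ↦ F(V ⊗ A) → G^gr(V ⊗ A)` along the adjunction between
induction and the forgetful functor raises degrees by `2(p-1)d`. -/
theorem transpose_hasDegree_iff (hp : 0 < p) {F : GamCat k d (VA k p) ⥤ GrVect k}
    (hF : IsGraded k F)
    {G : GamCat k d (FGModuleCat.{u} k) ⥤ GrVect k} (hG : IsGraded k G)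
    (γ : gamInd k p d ⋙ F ⟶ G) (j : ℤ) :
    HasDegree (-(2 * ((p : ℤ) - 1) * d) + j) γ ↔ ∀ V : GamCat k d (VA k p),
      (γ.app ((gamForget k p d).obj V)).lin ∘ₗ (F.map (gamHom k d (coindUnit k p V.obj))).lin ∈
        GrVect.degHom (F.obj V) (weights hG ((zFun k p).obj V.obj)).regrade j := by
  constructor
  · intro h V n x hx
    refine (weights hG ((zFun k p).obj V.obj)).mem_gr.2 fun m => ?_
    let w : (gamForget k p d).obj V ⟶ (gamForget k p d).obj V :=
      weightHom ((zFun k p).obj V.obj) m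
    have h1 : (F.map (gamHom k d (coindUnit k p V.obj) ≫ (gamInd k p d).map w)).lin x ∈
        (F.obj ((gamInd k p d).obj ((gamForget k p d).obj V))).gr
          (n + (2 * ((p : ℤ) - 1) * d - m)) :=
      hF.map_deg _ _ (gamAdj_unit_deg k p d V.obj m) n x hx
    have h2 := h ((gamForget k p d).obj V) _ _ h1
    have h3 : (γ.app ((gamForget k p d).obj V)).lin
        ((F.map (gamHom k d (coindUnit k p V.obj) ≫ (gamInd k p d).map w)).lin x) =
        (G.map w).lin ((γ.app ((gamForget k p d).obj V)).lin
          ((F.map (gamHom k d (coindUnit k p V.obj))).lin x)) := by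
      have e := congrArg (fun f => GrVect.Hom.lin f x)
        (F.map_comp (gamHom k d (coindUnit k p V.obj)) ((gamInd k p d).map w))
      have e' := congrArg (fun f => GrVect.Hom.lin f
        ((F.map (gamHom k d (coindUnit k p V.obj))).lin x)) (γ.naturality w)
      exact (congrArg _ e).trans e'
    have e : n + (2 * ((p : ℤ) - 1) * d - m) + (-(2 * ((p : ℤ) - 1) * d) + j) = n + j - m := by
      ring
    rw [e, h3] at h2
    exact h2
  · intro h W n x hx
    let V : GamCat k d (VA k p) := (gamInd k p d).obj W
    let ε : (gamForget k p d).obj V ⟶ W := gamHom k d (coindCounit k p hp W.obj)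
    let y : (G.obj ((gamForget k p d).obj V)).carrier :=
      (γ.app ((gamForget k p d).obj V)).lin ((F.map (gamHom k d (coindUnit k p V.obj))).lin x)
    have hy : ∀ m, (G.map (weightHom ((zFun k p).obj V.obj) m)).lin y ∈
        (G.obj ((gamForget k p d).obj V)).gr (n + j - m) :=
      (weights hG ((zFun k p).obj V.obj)).mem_gr.1 (h V n x hx)
    -- `γ` is recovered from its transpose `y` by the counit
    have h1 : (γ.app W).lin x = (G.map ε).lin y := by
      have e := congrArg (fun f => GrVect.Hom.lin f
        ((F.map (gamHom k d (coindUnit k p V.obj))).lin x)) (γ.naturality ε)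
      have e' : (F.map ((gamInd k p d).map ε)).lin
          ((F.map (gamHom k d (coindUnit k p V.obj))).lin x) = x :=
        (congrArg (fun f => GrVect.Hom.lin f x) (F.map_comp (gamHom k d (coindUnit k p V.obj))
          ((gamInd k p d).map ε))).symm.trans
        ((congrArg (fun f => (F.map f).lin x) (gam_coind_right_triangle k p d hp W.obj)).trans
          (congrArg (fun f => GrVect.Hom.lin f x) (F.map_id V)))
      exact (congrArg (γ.app W).lin e').symm.trans e
    -- and the counit only sees the part of weight `2(p-1)d`
    have h2 : (G.map ε).lin y = (G.map ε).lin
        ((G.map (weightHom ((zFun k p).obj V.obj) (2 * ((p : ℤ) - 1) * d))).lin y) := by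
      have hs := (weights hG ((zFun k p).obj V.obj)).ε_sum y
      have hne : ∀ m, m ≠ 2 * ((p : ℤ) - 1) * d →
          (G.map ε).lin ((weights hG ((zFun k p).obj V.obj)).ε m y) = 0 := fun m hm =>
        (congrArg (fun f => GrVect.Hom.lin f y)
          (G.map_comp (weightHom ((zFun k p).obj V.obj) m) ε)).symm.trans
        ((congrArg (fun f => (G.map f).lin y) (gamAdj_counit_deg k p d hp W.obj m hm)).trans
          (LinearMap.congr_fun (hG.map_zero_lin _ _) y))
      refine (congrArg (G.map ε).lin hs).symm.trans ((map_sum (G.map ε).lin _ _).trans ?_)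
      refine Finset.sum_eq_single _ (fun m _ hm => hne m hm) fun hm => ?_
      exact (congrArg (fun f => (G.map ε).lin (f y))
        ((weights hG ((zFun k p).obj V.obj)).ε_zero _ hm)).trans (map_zero (G.map ε).lin)
    have h3 := hG.map_deg 0 ε (gamHom_deg (mem_deg_zero k _)) _ _ (hy (2 * ((p : ℤ) - 1) * d))
    have e : n + j - 2 * ((p : ℤ) - 1) * d + 0 = n + (-(2 * ((p : ℤ) - 1) * d) + j) := by ring
    rw [e, ← h2, ← h1] at h3
    exact h3

theorem hzAdj_hasDegree_iff (hp : 0 < p) (F : GrFunPlus k d (VA k p))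
    (G : GrFunPlus k d (FGModuleCat.{u} k))
    (j : ℤ) (α : (hStarPlus k p d).obj F ⟶ G) :
    HasDegree j α.hom ↔ HasDegree j ((hzAdj k p d hp).homEquiv F G α).hom := by
  let c := (indIsoH k p d).app F
  have h1 : HasDegree j α.hom ↔ HasDegree (-(2 * ((p : ℤ) - 1) * d) + j) (c.hom ≫ α.hom) := by
    refine ⟨fun h => HasDegree.comp (fun V => indIsoH_degree k p d F V) h, fun h V => ?_⟩
    have hc := inv_mem_degHom (c.app V) (indIsoH_degree k p d F V)
    have h' := GrVect.comp_mem_degHom hc (h V)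
    have e : - -(2 * ((p : ℤ) - 1) * d) + (-(2 * ((p : ℤ) - 1) * d) + j) = j := by ring
    rw [e] at h'
    have e' := congrArg (fun f => (NatTrans.app f V ≫ α.hom.app V).lin) c.inv_hom_id
    exact Eq.mp (congrArg (fun l => l ∈ GrVect.degHom _ _ j) e') h'
  refine h1.trans ((transpose_hasDegree_iff k p d hp F.property.1 G.property.1
    (c.hom ≫ α.hom) j).trans (forall_congr' fun V => ?_))
  exact iff_of_eq (congrArg (fun l => l ∈ GrVect.degHom _ _ j)
    (hzAdj_homEquiv_lin k p d hp α V).symm)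

/-- The adjunction matches degrees: the shift by `-2(p-1)d` in `F(V ⊗ A) ≅ h^*(F)(V)` makes up for
the one in `transpose_hasDegree_iff`. -/
theorem hStarPlus_gradedLeftAdjoint (hp : 0 < p) :
    GradedLeftAdjoint (hStarPlus k p d) (zStarPlus k p d) :=
  ⟨hzAdj k p d hp, hzAdj_hasDegree_iff k p d hp⟩

end

/-! ### Duals of representable functors -/

section

variable {k : Type u} [Field k]

/-- The symmetry `Hom(U, V^*) ≅ Hom(V, U^*)`. -/
def flipEquiv (U V : Type u) [AddCommGroup U] [Module k U] [AddCommGroup V] [Module k V] :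
    (U →ₗ[k] Module.Dual k V) ≃ₗ[k] (V →ₗ[k] Module.Dual k U) where
  toFun f := LinearMap.flip (show U →ₗ[k] V →ₗ[k] k from f)
  invFun f := LinearMap.flip (show V →ₗ[k] U →ₗ[k] k from f)
  map_add' _ _ := rfl
  map_smul' _ _ := rfl
  left_inv _ := rfl
  right_inv _ := rfl

variable {p : ℕ}

/-- The symmetry `Hom(U ⊗ A, V^* ⊗ A) ≅ Hom(V ⊗ A, U^* ⊗ A)`. -/
def flipVA (U V : VA k p) : (U ⟶ (dualVA k p).obj (Opposite.op V)) ≃ₗ[k]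
    (V ⟶ (dualVA k p).obj (Opposite.op U)) :=
  LinearEquiv.rTensor (TruncPoly k p) (flipEquiv (k := k) U.obj V.obj)

theorem flipVA_deg {U V : VA k p} {n : ℤ} (f : U ⟶ (dualVA k p).obj (Opposite.op V))
    (hf : f ∈ GradedCat.deg (k := k) U ((dualVA k p).obj (Opposite.op V)) n) :
    flipVA U V f ∈ GradedCat.deg (k := k) V ((dualVA k p).obj (Opposite.op U)) n := by
  refine TruncPoly.tensorDeg_induction (P := fun f => flipVA U V f ∈
      TruncPoly.tensorDeg k p (V.obj →ₗ[k] Module.Dual k U.obj) n)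
    (fun f a ha => TruncPoly.tmul_mem _ ha) ?_ ?_ f hf
  · exact (map_zero (flipVA U V)).symm ▸ Submodule.zero_mem _
  · intro s t hs ht
    exact (map_add (flipVA U V) s t).symm ▸ Submodule.add_mem _ hs ht

theorem flip_comp_transpose {U V W : Type u} [AddCommGroup U] [Module k U] [AddCommGroup V]
    [Module k V] [AddCommGroup W] [Module k W] (f : (V →ₗ[k] W) ⊗[k] TruncPoly k p)
    (g : (W →ₗ[k] Module.Dual k U) ⊗[k] TruncPoly k p) :
    LinearMap.rTensor (TruncPoly k p) (flipEquiv V U).toLinearMap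
      (TensorProduct.map₂ (LinearMap.llcomp k V W (Module.Dual k U)).flip
        (LinearMap.mul k (TruncPoly k p)) f g) =
    TensorProduct.map₂ (LinearMap.llcomp k U (Module.Dual k W) (Module.Dual k V)).flip
      (LinearMap.mul k (TruncPoly k p))
      (LinearMap.rTensor (TruncPoly k p) (flipEquiv W U).toLinearMap g)
      (LinearMap.rTensor (TruncPoly k p) Module.Dual.transpose f) := by
  induction f using TensorProduct.induction_on with
  | zero => simp only [map_zero, LinearMap.zero_apply]
  | tmul f a =>
    induction g using TensorProduct.induction_on with
    | zero => simp only [map_zero, LinearMap.zero_apply]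
    | tmul g b =>
      change _ ⊗ₜ[k] (a * b) = _ ⊗ₜ[k] (b * a)
      rw [mul_comm b a]
      rfl
    | add s t hs ht => simp only [map_add, LinearMap.add_apply, hs, ht]
  | add s t hs ht => simp only [map_add, LinearMap.add_apply, hs, ht]

theorem flipVA_naturality {U V W : VA k p} (f : V ⟶ W)
    (g : W ⟶ (dualVA k p).obj (Opposite.op U)) :
    flipVA V U (f ≫ g) = flipVA W U g ≫ (dualVA k p).map f.op :=
  flip_comp_transpose (VA.toTen f) (VA.toTen g)

theorem gamMap_gamMap₂ {d : ℕ} {H₁ H₂ H₃ K₁ K₂ K₃ : Type u} [AddCommGroup H₁] [Module k H₁]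
    [AddCommGroup H₂] [Module k H₂] [AddCommGroup H₃] [Module k H₃] [AddCommGroup K₁]
    [Module k K₁] [AddCommGroup K₂] [Module k K₂] [AddCommGroup K₃] [Module k K₃]
    (c : H₁ →ₗ[k] H₂ →ₗ[k] H₃) (c' : K₂ →ₗ[k] K₁ →ₗ[k] K₃) (a : H₁ →ₗ[k] K₁) (b : H₂ →ₗ[k] K₂)
    (φ : H₃ →ₗ[k] K₃) (h : ∀ x y, φ (c x y) = c' (b y) (a x)) (s : Gam k d H₁) (t : Gam k d H₂) :
    gamMap φ (gamMap₂ c s t) = gamMap₂ c' (gamMap b t) (gamMap a s) := Gam.ext <| by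
  simp only [gamMap_val, gamMap₂_val]
  generalize Gam.val s = s
  generalize Gam.val t = t
  induction s using ten_induction with
  | tprod x =>
    induction t using ten_induction with
    | tprod y => simp [h]
    | add s t hs ht => simp only [map_add, LinearMap.add_apply, hs, ht]
    | smul a t ht => simp only [map_smul, LinearMap.smul_apply, ht]
  | add s t hs ht => simp only [map_add, LinearMap.add_apply, hs, ht]
  | smul a t ht => simp only [map_smul, LinearMap.smul_apply, ht]

/-- The linear map on morphism spaces given by the duality of `V_A`. -/
def dualVALin (V W : VA k p) : (V ⟶ W) →ₗ[k]
    ((dualVA k p).obj (Opposite.op W) ⟶ (dualVA k p).obj (Opposite.op V)) :=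
  (dualVAgr_isGradedContra k p).lin V W

variable (d : ℕ)

theorem gamFlip_deg (U : VA k p) (X : GamCat k d (VA k p)) :
    (gamEquiv (d := d) (flipVA X.obj U)).toLinearMap ∈ GrVect.degHom
      (homObj (⟨GrObj.single 0 X.obj⟩ : GamCat k d (GrObj k (VA k p)))
        ⟨(dualVAgr k p).obj (Opposite.op U)⟩)
      ((grExt (rep d U).obj (rep d U).property).obj ⟨(dualVAgr k p).obj (Opposite.op X.obj)⟩)
      0 := by
  intro n f hf
  refine (mem_gr_single (rep d U).property _ _ _ _).2 ?_
  have h := (mem_deg_gam_single X.obj ((dualVA k p).obj (Opposite.op U)) 0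
        (-(2 * ((p : ℤ) - 1))) n f).1 hf
  have e : n + 0 - -(2 * ((p : ℤ) - 1)) * d = n + (0 - -(2 * ((p : ℤ) - 1))) * d := by ring
  rw [e]
  exact gamMap_mem (φ := (flipVA X.obj U).toLinearMap) (fun m x hx => flipVA_deg x hx) _ _ h

/-- The symmetry `Hom(U ⊗ A, V^* ⊗ A) ≅ Hom(V ⊗ A, U^* ⊗ A)` in `Γ^d V_A`, as an isomorphism of
degree zero from the morphisms to the graded object `U^* ⊗ A^*`. -/
def gamFlipIso (U : VA k p) (X : GamCat k d (VA k p)) :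
    homObj (k := k) (⟨GrObj.single 0 X.obj⟩ : GamCat k d (GrObj k (VA k p)))
        ⟨(dualVAgr k p).obj (Opposite.op U)⟩ ≅
      (grExt (rep d U).obj (rep d U).property).obj ⟨(dualVAgr k p).obj (Opposite.op X.obj)⟩ :=
  GrVect.isoOfDeg (M := homObj (⟨GrObj.single 0 X.obj⟩ : GamCat k d (GrObj k (VA k p)))
      ⟨(dualVAgr k p).obj (Opposite.op U)⟩)
    (N := (grExt (rep d U).obj (rep d U).property).obj ⟨(dualVAgr k p).obj (Opposite.op X.obj)⟩) 0
    (gamEquiv (d := d) (flipVA X.obj U)) (gamFlip_deg d U X)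

theorem gamFlipIso_degree (U : VA k p) (X : GamCat k d (VA k p)) :
    (gamFlipIso d U X).hom.lin ∈ GrVect.degHom _ _ 0 := gamFlip_deg d U X

theorem gamFlipIso_naturality (U : VA k p) {X Y : GamCat k d (VA k p)} (f : X ⟶ Y) :
    precomp (k := k) (⟨(dualVAgr k p).obj (Opposite.op U)⟩ : GamCat k d (GrObj k (VA k p)))
        ((gamFunctor d (GrObj.singleFunctor k (VA k p) 0)
          (GrObj.singleFunctor_isGradedLinear 0)).map f) ≫ (gamFlipIso d U X).hom =
      (gamFlipIso d U Y).hom ≫ (grExt (rep d U).obj (rep d U).property).map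
        ((gamFunctorOp d (dualVAgr k p) (dualVAgr_isGradedContra k p)).map f.op) :=
  GrVect.hom_ext <| LinearMap.ext fun (s : Gam k d (Y.obj ⟶ (dualVA k p).obj (Opposite.op U))) =>
    (congrArg (fun t => gamMap (flipVA X.obj U).toLinearMap (gamMap₂ (Linear.comp X.obj Y.obj
      ((dualVA k p).obj (Opposite.op U))) t s)) (gamMap_id (GamCat.ten f))).trans
    (gamMap_gamMap₂ (Linear.comp X.obj Y.obj ((dualVA k p).obj (Opposite.op U)))
      (Linear.comp U ((dualVA k p).obj (Opposite.op Y.obj))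
        ((dualVA k p).obj (Opposite.op X.obj))) (dualVALin X.obj Y.obj)
      (flipVA Y.obj U).toLinearMap (flipVA X.obj U).toLinearMap
      (fun x y => flipVA_naturality x y) (GamCat.ten f) s)

/-- The dual of a representable functor: `Hom(U ⊗ A, V^* ⊗ A)` is symmetric in `U` and `V`, and the
shift of `V^* ⊗ A` in the affine duality becomes that of `U^* ⊗ A` in `U^* ⊗ A^*`. -/
theorem affineKuhn_rep (U : VA k p) :
    DegZeroIso ((affineKuhn k p d).obj (Opposite.op (rep d U)))
      (corepGr k p d ((dualVAgr k p).obj (Opposite.op U))) := by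
  refine ⟨grFunIso (fun X => GrVect.dualIso (gamFlipIso d U X)) fun f =>
    congrArg GrVect.dualMap (gamFlipIso_naturality d U f).symm, fun X => ?_⟩
  exact GrVect.dualLin_mem_degHom (f := (gamFlipIso d U X).hom)
    (gamFlipIso_degree d U X)

theorem hom_single_deg (U : VA k p) (X : GamCat k d (VA k p)) :
    (LinearEquiv.refl k (Gam k d (X.obj ⟶ (dualVA k p).obj (Opposite.op U)))).toLinearMap ∈
      GrVect.degHom (homObj (⟨GrObj.single 0 X.obj⟩ : GamCat k d (GrObj k (VA k p)))
        ⟨(dualVAgr k p).obj (Opposite.op U)⟩)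
        (homObj X ⟨(dualVA k p).obj (Opposite.op U)⟩) (2 * ((p : ℤ) - 1) * d) := by
  intro n f hf
  have h := (mem_deg_gam_single X.obj ((dualVA k p).obj (Opposite.op U)) 0
    (-(2 * ((p : ℤ) - 1))) n f).1 hf
  rw [zero_sub, neg_neg] at h
  exact h

/-- The morphisms to `U^* ⊗ A^*` are those to `U^* ⊗ A`, with the grading shifted by
`2(p-1)d`. -/
def homSingleIso (U : VA k p) (X : GamCat k d (VA k p)) :
    homObj (k := k) (⟨GrObj.single 0 X.obj⟩ : GamCat k d (GrObj k (VA k p)))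
        ⟨(dualVAgr k p).obj (Opposite.op U)⟩ ≅
      homObj (k := k) X ⟨(dualVA k p).obj (Opposite.op U)⟩ :=
  GrVect.isoOfDeg (M := homObj (⟨GrObj.single 0 X.obj⟩ : GamCat k d (GrObj k (VA k p)))
      ⟨(dualVAgr k p).obj (Opposite.op U)⟩)
    (N := homObj X ⟨(dualVA k p).obj (Opposite.op U)⟩) (2 * ((p : ℤ) - 1) * d)
    (LinearEquiv.refl k (Gam k d (X.obj ⟶ (dualVA k p).obj (Opposite.op U))))
    (hom_single_deg d U X)

theorem homSingleIso_degree (U : VA k p) (X : GamCat k d (VA k p)) :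
    (homSingleIso d U X).hom.lin ∈ GrVect.degHom _ _ (2 * ((p : ℤ) - 1) * d) :=
  hom_single_deg d U X

theorem homSingleIso_naturality (U : VA k p) {X Y : GamCat k d (VA k p)} (f : X ⟶ Y) :
    (homSingleIso d U Y).inv ≫
      precomp (k := k) (⟨(dualVAgr k p).obj (Opposite.op U)⟩ : GamCat k d (GrObj k (VA k p)))
        ((gamFunctor d (GrObj.singleFunctor k (VA k p) 0)
          (GrObj.singleFunctor_isGradedLinear 0)).map f) =
      precomp (k := k) ⟨(dualVA k p).obj (Opposite.op U)⟩ f ≫ (homSingleIso d U X).inv :=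
  GrVect.hom_ext <| LinearMap.ext fun (s : Gam k d (Y.obj ⟶ (dualVA k p).obj (Opposite.op U))) =>
    congrArg (fun t => gamMap₂ (Linear.comp X.obj Y.obj
      ((dualVA k p).obj (Opposite.op U))) t s) (gamMap_id (GamCat.ten f))

theorem GrVect.dualIso_shiftIso_naturality {M N M' N' : GrVect k} (s : ℤ) (e : M ≅ M')
    (e' : N ≅ N') (g : N ⟶ M) (g' : N' ⟶ M') (h : e'.inv ≫ g = g' ≫ e.inv) :
    dualMap g ≫ ((dualIso e').symm ≪≫ shiftIso s (dualObj N')).hom =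
      ((dualIso e).symm ≪≫ shiftIso s (dualObj M')).hom ≫ (shift s).map (dualMap g') := by
  have h' : dualMap g ≫ dualMap e'.inv = dualMap e.inv ≫ dualMap g' := by
    rw [← dualMap_comp, h, dualMap_comp]
  exact congrArg (fun φ => φ ≫ (shiftIso s (dualObj N')).hom) h'

theorem corepGr_dual (U : VA k p) :
    DegZeroIso (corepGr k p d ((dualVAgr k p).obj (Opposite.op U)))
      ((shiftFun k d (VA k p) (-(2 * ((p : ℤ) - 1) * d))).obj
        (corep d ((dualVA k p).obj (Opposite.op U)))) := by
  refine ⟨grFunIso (fun X => (GrVect.dualIso (homSingleIso d U X)).symm ≪≫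
    GrVect.shiftIso (-(2 * ((p : ℤ) - 1) * d))
      (GrVect.dualObj (homObj X ⟨(dualVA k p).obj (Opposite.op U)⟩))) fun {X Y} f => ?_,
    fun X => ?_⟩
  · exact GrVect.dualIso_shiftIso_naturality _ (homSingleIso d U X) (homSingleIso d U Y) _ _
      (homSingleIso_naturality d U f)
  · have h := inv_mem_degHom (GrVect.dualIso (homSingleIso d U X))
      (GrVect.dualLin_mem_degHom (f := (homSingleIso d U X).hom) (homSingleIso_degree d U X))
    have h' := GrVect.comp_mem_degHom h (GrVect.shiftIso_degree (-(2 * ((p : ℤ) - 1) * d))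
      (GrVect.dualObj (homObj X ⟨(dualVA k p).obj (Opposite.op U)⟩)))
    rw [neg_neg, neg_add_cancel] at h'
    exact h'

end

/-! ### The perfect pairing of `V^* ⊗ A` and `V ⊗ A` -/

section

variable (k : Type u) [Field k] (p : ℕ)

theorem TruncPoly.exact_mulLeft_pow (i j : ℕ) (h : i + j = p) :
    Function.Exact (LinearMap.mulLeft k (TruncPoly.x k p ^ i))
      (LinearMap.mulLeft k (TruncPoly.x k p ^ j)) := by
  refine fun b => ⟨fun hb => ?_, ?_⟩
  · obtain ⟨q, rfl⟩ := AdjoinRoot.mk_surjective b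
    have e : (Polynomial.X : Polynomial k) ^ p ∣ Polynomial.X ^ j * q := by
      rw [← AdjoinRoot.mk_eq_zero, map_mul, map_pow]
      exact hb
    rw [← h, add_comm, pow_add] at e
    obtain ⟨r, rfl⟩ := (mul_dvd_mul_iff_left (pow_ne_zero j Polynomial.X_ne_zero)).1 e
    refine ⟨AdjoinRoot.mk _ r, ?_⟩
    rw [map_mul, map_pow]
    rfl
  · rintro ⟨c, rfl⟩
    change TruncPoly.x k p ^ j * (TruncPoly.x k p ^ i * c) = 0
    rw [← mul_assoc, ← pow_add, TruncPoly.x_pow_eq_zero k p (j + i) (by omega), zero_mul]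

variable {k p} in
/-- As `H ⊗ A` is free over `A`, the kernel of `x^j` is the image of `x^(p-j)`. -/
theorem mem_xPow_of_mulXPow_eq_zero {H : Type u} [AddCommGroup H] [Module k H] {i j : ℕ}
    (h : i + j = p) {t : H ⊗[k] TruncPoly k p} (ht : mulXPow k p H j t = 0) : t ∈ xPow k p H i :=
  (Module.Flat.lTensor_exact H (TruncPoly.exact_mulLeft_pow k p i j h) t).1 ht

variable {k p} in
theorem pair_ext {M : Type*} [AddCommMonoid M] [Module k M] {V W : Type u}
    [AddCommGroup V] [Module k V] [AddCommGroup W] [Module k W]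
    {φ ψ : W ⊗[k] TruncPoly k p →ₗ[k] V ⊗[k] TruncPoly k p →ₗ[k] M}
    (h : ∀ w b v a, φ (w ⊗ₜ b) (v ⊗ₜ a) = ψ (w ⊗ₜ b) (v ⊗ₜ a)) : φ = ψ :=
  TensorProduct.ext' fun w b => TensorProduct.ext' fun v a => h w b v a

variable (hp : 0 < p)

/-- An isomorphism `A ≅ A^*` of graded `A`-modules, up to the shift by `2(p-1)`. Any one will do:
only `frobEquiv_mul` and `frobEquiv_deg` are used. -/
def frobEquiv : TruncPoly k p ≃ₗ[k] Module.Dual k (TruncPoly k p) :=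
  (TruncPoly.exists_dual_equiv k p hp).choose

theorem frobEquiv_mul (a b c : TruncPoly k p) :
    frobEquiv k p hp (a * b) c = frobEquiv k p hp b (a * c) :=
  (TruncPoly.exists_dual_equiv k p hp).choose_spec.1 a b c

theorem frobEquiv_deg {m n : ℤ} {a b : TruncPoly k p} (ha : a ∈ TruncPoly.deg k p m)
    (hb : b ∈ TruncPoly.deg k p n) (h : m + n ≠ 2 * ((p : ℤ) - 1)) : frobEquiv k p hp a b = 0 :=
  (TruncPoly.exists_dual_equiv k p hp).choose_spec.2 m n a ha b hb h

variable (V : Type u) [AddCommGroup V] [Module k V] [Module.Finite k V]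

/-- The isomorphism `V^* ⊗ A ≅ (V ⊗ A)^*`, given by the pairing
`(ξ ⊗ b, v ⊗ a) ↦ ξ(v) ⟨b, a⟩`, where `⟨b, a⟩` is the pairing of `A` given by `frobEquiv`. -/
def pairEquiv : Module.Dual k V ⊗[k] TruncPoly k p ≃ₗ[k] Module.Dual k (V ⊗[k] TruncPoly k p) :=
  LinearEquiv.lTensor (Module.Dual k V) (frobEquiv k p hp) ≪≫ₗ
    TensorProduct.dualDistribEquiv k V (TruncPoly k p)

theorem pairEquiv_tmul (ξ : Module.Dual k V) (b : TruncPoly k p) (v : V) (a : TruncPoly k p) :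
    pairEquiv k p hp V (ξ ⊗ₜ b) (v ⊗ₜ a) = ξ v * frobEquiv k p hp b a := rfl

variable {k p V}

theorem pairEquiv_mulXPow (j : ℕ) (t : Module.Dual k V ⊗[k] TruncPoly k p)
    (s : V ⊗[k] TruncPoly k p) :
    pairEquiv k p hp V (mulXPow k p _ j t) s = pairEquiv k p hp V t (mulXPow k p V j s) := by
  have h : (pairEquiv k p hp V).toLinearMap ∘ₗ mulXPow k p _ j =
      (pairEquiv k p hp V).toLinearMap.compl₂ (mulXPow k p V j) := pair_ext fun ξ b v a => by
    change ξ v * frobEquiv k p hp (_ * b) a = ξ v * frobEquiv k p hp b (_ * a)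
    rw [frobEquiv_mul]
  exact LinearMap.congr_fun (LinearMap.congr_fun h t) s

theorem pairEquiv_map {W : Type u} [AddCommGroup W] [Module k W] [Module.Finite k W] (f : V →ₗ[k] W)
    (c : TruncPoly k p) (t : Module.Dual k W ⊗[k] TruncPoly k p) (s : V ⊗[k] TruncPoly k p) :
    pairEquiv k p hp V (TensorProduct.map (Module.Dual.transpose f) (LinearMap.mulLeft k c) t) s =
      pairEquiv k p hp W t (TensorProduct.map f (LinearMap.mulLeft k c) s) := by
  have h : (pairEquiv k p hp V).toLinearMap ∘ₗ
      TensorProduct.map (Module.Dual.transpose f) (LinearMap.mulLeft k c) =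
      (pairEquiv k p hp W).toLinearMap.compl₂ (TensorProduct.map f (LinearMap.mulLeft k c)) :=
    pair_ext fun ξ b v a => by
      change ξ (f v) * frobEquiv k p hp (c * b) a = ξ (f v) * frobEquiv k p hp b (c * a)
      rw [frobEquiv_mul]
  exact LinearMap.congr_fun (LinearMap.congr_fun h t) s

theorem adjoint_of_tmul {H E M M' N N' : Type*} [AddCommGroup H] [Module k H] [AddCommGroup E]
    [Module k E] [AddCommGroup M] [Module k M] [AddCommGroup M'] [Module k M'] [AddCommGroup N]
    [Module k N] [AddCommGroup N'] [Module k N'] (P : M' →ₗ[k] M →ₗ[k] k) (Q : N' →ₗ[k] N →ₗ[k] k)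
    (α : H ⊗[k] E →ₗ[k] N' →ₗ[k] M') (β : H ⊗[k] E →ₗ[k] M →ₗ[k] N)
    (h : ∀ f a t s, P (α (f ⊗ₜ a) t) s = Q t (β (f ⊗ₜ a) s)) (f : H ⊗[k] E) (t : N') (s : M) :
    P (α f t) s = Q t (β f s) := by
  induction f using TensorProduct.induction_on with
  | zero => simp only [map_zero, LinearMap.zero_apply]
  | tmul f a => exact h f a t s
  | add f g hf hg => simp only [map_add, LinearMap.add_apply, hf, hg]

/-- The action of `f ⊗ a` on `V ⊗ A` is adjoint to that of `f^* ⊗ a`. -/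
theorem pairEquiv_act {V W : VA k p} (f : V ⟶ W) (t : Module.Dual k W.obj ⊗[k] TruncPoly k p)
    (s : V.obj ⊗[k] TruncPoly k p) :
    pairEquiv k p hp V.obj (VA.act ((dualVA k p).obj (Opposite.op W))
        ((dualVA k p).obj (Opposite.op V)) (VA.transpose V W (VA.toTen f)) t) s =
      pairEquiv k p hp W.obj t (VA.act V W (VA.toTen f) s) :=
  adjoint_of_tmul (pairEquiv k p hp V.obj).toLinearMap (pairEquiv k p hp W.obj).toLinearMap
    (VA.act ((dualVA k p).obj (Opposite.op W)) ((dualVA k p).obj (Opposite.op V)) ∘ₗ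
      VA.transpose V W) (VA.act V W) (fun g a t s => pairEquiv_map hp g a t s) (VA.toTen f) t s

theorem pairEquiv_deg {m n : ℤ} {t : Module.Dual k V ⊗[k] TruncPoly k p}
    {s : V ⊗[k] TruncPoly k p} (ht : t ∈ TruncPoly.tensorDeg k p (Module.Dual k V) m)
    (hs : s ∈ TruncPoly.tensorDeg k p V n) (h : m + n ≠ 2 * ((p : ℤ) - 1)) :
    pairEquiv k p hp V t s = 0 := by
  refine TruncPoly.tensorDeg_induction (P := fun t => pairEquiv k p hp V t s = 0)
    (fun ξ b hb => ?_) ?_ ?_ t ht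
  · refine TruncPoly.tensorDeg_induction (P := fun s => pairEquiv k p hp V (ξ ⊗ₜ b) s = 0)
      (fun v a ha => ?_) (map_zero _) ?_ s hs
    · rw [pairEquiv_tmul, frobEquiv_deg k p hp hb ha h, mul_zero]
    · intro s t hs ht; rw [map_add, hs, ht, add_zero]
  · rw [map_zero, LinearMap.zero_apply]
  · intro s t hs ht; rw [map_add, LinearMap.add_apply, hs, ht, add_zero]

end

/-! ### Duals of the functors `χ_j` -/

section

variable {k : Type u} [Field k] {p : ℕ} (hp : 0 < p)

/-- The space `x^j (H ⊗ A) / x^(j+1) (H ⊗ A)`. -/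
abbrev Layer (k : Type u) [Field k] (p : ℕ) (H : Type u) [AddCommGroup H] [Module k H] (j : ℕ) :
    Type u := xPow k p H j ⧸ (xPow k p H (j + 1)).submoduleOf (xPow k p H j)

instance (H : Type u) [AddCommGroup H] [Module k H] [Module.Finite k H] (j : ℕ) :
    Module.Finite k (Layer k p H j) := inferInstance

section

variable {V W : Type u} [AddCommGroup V] [Module k V] [AddCommGroup W] [Module k W]
  (P : W ⊗[k] TruncPoly k p →ₗ[k] V ⊗[k] TruncPoly k p →ₗ[k] k)

theorem pair_xPow (hP : ∀ j t s, P (mulXPow k p W j t) s = P t (mulXPow k p V j s)) {i j : ℕ}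
    (h : p ≤ i + j) {t : W ⊗[k] TruncPoly k p}
    {s : V ⊗[k] TruncPoly k p} (ht : t ∈ xPow k p W j) (hs : s ∈ xPow k p V i) :
    P t s = 0 := by
  obtain ⟨t, rfl⟩ := ht
  obtain ⟨s, rfl⟩ := hs
  rw [hP]
  have : mulXPow k p V j ∘ₗ mulXPow k p V i = 0 := TensorProduct.ext' fun v a => by
    change v ⊗ₜ[k] (_ * (_ * a)) = 0
    rw [← mul_assoc, ← pow_add, TruncPoly.x_pow_eq_zero k p (j + i) (by omega), zero_mul,
      TensorProduct.tmul_zero]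
  exact (congrArg _ (LinearMap.congr_fun this s)).trans (map_zero _)

/-- A pairing of `W ⊗ A` with `V ⊗ A` for which multiplication by `x` is adjoint to itself induces,
for `i + j = p - 1`, a pairing of `x^i (V ⊗ A) / x^(i+1) (V ⊗ A)` with
`x^j (W ⊗ A) / x^(j+1) (W ⊗ A)`. -/
def layerPair (hP : ∀ j t s, P (mulXPow k p W j t) s = P t (mulXPow k p V j s)) (i j : ℕ)
    (h : i + j + 1 = p) : Layer k p V i →ₗ[k] Layer k p W j →ₗ[k] k :=
  Submodule.liftQ _ (LinearMap.flip <| Submodule.liftQ _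
      (P.domRestrict₁₂ (xPow k p W j) (xPow k p V i))
      fun t ht => LinearMap.ext fun s => pair_xPow P hP (by omega) ht s.2)
    fun s hs => LinearMap.ext fun t => by
      obtain ⟨t, rfl⟩ := Submodule.mkQ_surjective _ t
      exact pair_xPow P hP (by omega) t.2 hs

theorem layerPair_isPerfPair (hP : ∀ j t s, P (mulXPow k p W j t) s = P t (mulXPow k p V j s))
    [Module.Finite k V] (hl : ∀ t, P t = 0 → t = 0)
    (hr : ∀ s, P.flip s = 0 → s = 0) (i j : ℕ) (h : i + j + 1 = p) :
    (layerPair P hP i j h).IsPerfPair := by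
  refine LinearMap.IsPerfPair.of_injective ?_ ?_
  · refine (injective_iff_map_eq_zero _).2 fun s hs => ?_
    obtain ⟨s, rfl⟩ := Submodule.mkQ_surjective _ s
    refine (Submodule.Quotient.mk_eq_zero _).2 ?_
    refine mem_xPow_of_mulXPow_eq_zero (j := j) (by omega) (hr _ (LinearMap.ext fun t => ?_))
    exact (hP j t s).symm.trans
      (LinearMap.congr_fun hs (Submodule.Quotient.mk ⟨mulXPow k p W j t, t, rfl⟩))
  · refine (injective_iff_map_eq_zero _).2 fun t ht => ?_
    obtain ⟨t, rfl⟩ := Submodule.mkQ_surjective _ t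
    refine (Submodule.Quotient.mk_eq_zero _).2 ?_
    refine mem_xPow_of_mulXPow_eq_zero (j := i) (by omega) (hl _ (LinearMap.ext fun s => ?_))
    exact (hP i t s).trans
      (LinearMap.congr_fun ht (Submodule.Quotient.mk ⟨mulXPow k p V i s, s, rfl⟩))

end

/-- The perfect pairing of `x^i (V ⊗ A) / x^(i+1) (V ⊗ A)` with
`x^j (V^* ⊗ A) / x^(j+1) (V^* ⊗ A)`, for `i + j = p - 1`. -/
def dualLayerPair (V : Type u) [AddCommGroup V] [Module k V] [Module.Finite k V] (i j : ℕ)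
    (h : i + j + 1 = p) : Layer k p V i →ₗ[k] Layer k p (Module.Dual k V) j →ₗ[k] k :=
  layerPair (pairEquiv k p hp V).toLinearMap (pairEquiv_mulXPow hp) i j h

theorem dualLayerPair_isPerfPair (V : Type u) [AddCommGroup V] [Module k V] [Module.Finite k V]
    (i j : ℕ) (h : i + j + 1 = p) : (dualLayerPair (k := k) hp V i j h).IsPerfPair :=
  layerPair_isPerfPair (pairEquiv k p hp V).toLinearMap (pairEquiv_mulXPow hp)
    (fun _ ht => (LinearEquiv.map_eq_zero_iff (pairEquiv k p hp V)).1 ht)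
    (fun s hs => (Module.forall_dual_apply_eq_zero_iff k s).1 fun ξ => by
      obtain ⟨t, rfl⟩ := (pairEquiv k p hp V).surjective ξ
      exact LinearMap.congr_fun hs t) i j h

end

section

variable {k : Type u} [Field k] {p : ℕ} (hp : 0 < p) {i j : ℕ} (h : i + j + 1 = p)

/-- On `Γ^1`, the functors induced by linear functors agree with the original ones. -/
theorem gamOne_gamMap {C : Type v} [Category.{u} C] [Preadditive C] [Linear k C]
    [GradedCat k C] {E : Type w} [Category.{u} E] [Preadditive E] [Linear k E] [GradedCat k E]
    {X Y : C} {X' Y' : E} (φ : (X ⟶ Y) →ₗ[k] (X' ⟶ Y')) (f : Gam k 1 (X ⟶ Y)) :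
    (gamOne k E).map (show (⟨X'⟩ : GamCat k 1 E) ⟶ ⟨Y'⟩ from gamMap φ f) =
      φ ((gamOne k C).map (show (⟨X⟩ : GamCat k 1 C) ⟶ ⟨Y⟩ from f)) := by
  change PiTensorProduct.subsingletonEquiv (0 : Fin 1) (tenMap φ (Gam.val f)) =
    φ (PiTensorProduct.subsingletonEquiv (0 : Fin 1) (Gam.val f))
  generalize Gam.val f = s
  induction s using ten_induction with
  | tprod x => simp
  | add s t hs ht => simp only [map_add, hs, ht]
  | smul a t ht => simp only [map_smul, ht]

/-- The graded space `x^j (V^* ⊗ A) / x^(j+1) (V^* ⊗ A)`, with `V^* ⊗ A` shifted by `2(p-1)`. -/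
abbrev chiDualObj (j : ℕ) (X : GamCat k 1 (VA k p)) : GrVect k :=
  (grExt (chi k p j).obj (chi k p j).property).obj
    ((gamFunctorOp 1 (dualVAgr k p) (dualVAgr_isGradedContra k p)).obj (Opposite.op X))

instance (j : ℕ) (X : GamCat k 1 (VA k p)) : Module.Finite k (chiDualObj j X).carrier :=
  inferInstanceAs (Module.Finite k (Layer k p ((dualVA k p).obj (Opposite.op X.obj)).obj j))

/-- The isomorphism of `χ_i(V ⊗ A)` with the dual of `χ_j(V^* ⊗ A)`, for `i + j = p - 1`. -/
def chiEquiv (X : GamCat k 1 (VA k p)) :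
    (chiObj i X.obj).carrier ≃ₗ[k] GrVect.GrDual (chiDualObj j X) :=
  have := dualLayerPair_isPerfPair (k := k) hp X.obj.obj i j h
  (dualLayerPair (k := k) hp X.obj.obj i j h).toPerfPair ≪≫ₗ
    (GrVect.dualEquiv (chiDualObj j X)).symm

theorem evalDual_chiEquiv (X : GamCat k 1 (VA k p)) (s : xPow k p X.obj.obj i)
    (t : xPow k p (Module.Dual k X.obj.obj) j) :
    GrVect.evalDual (chiDualObj j X) (chiEquiv hp h X (chiMk i X.obj s))
        (chiMk j ((dualVA k p).obj (Opposite.op X.obj)) t) =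
      pairEquiv k p hp X.obj.obj t.1 s.1 :=
  LinearMap.congr_fun ((GrVect.dualEquiv (chiDualObj j X)).apply_symm_apply
    (dualLayerPair hp X.obj.obj i j h (chiMk i X.obj s))) _

theorem chiEquiv_deg (X : GamCat k 1 (VA k p)) :
    (chiEquiv hp h X).toLinearMap ∈ GrVect.degHom (chiObj i X.obj)
      (GrVect.dualObj (chiDualObj j X)) 0 := by
  rintro n _ ⟨s, hs, rfl⟩ m hm y hy
  obtain ⟨t, ht, rfl⟩ := (mem_gr_single (chi k p j).property _ _ _ _).1 hy
  refine (evalDual_chiEquiv hp h X s t).trans (pairEquiv_deg hp ht hs ?_)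
  push_cast
  omega

theorem chiEquiv_naturality {X Y : GamCat k 1 (VA k p)} (g : X.obj ⟶ Y.obj)
    (s : xPow k p X.obj.obj i) (t : xPow k p ((dualVA k p).obj (Opposite.op Y.obj)).obj j) :
    GrVect.evalDual (chiDualObj j Y) (chiEquiv hp h Y (chiLin i g (chiMk i X.obj s)))
        (chiMk j ((dualVA k p).obj (Opposite.op Y.obj)) t) =
      GrVect.evalDual (chiDualObj j X) (chiEquiv hp h X (chiMk i X.obj s))
        (chiLin j ((dualVA k p).map g.op)
          (chiMk j ((dualVA k p).obj (Opposite.op Y.obj)) t)) := by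
  have h1 := evalDual_chiEquiv hp h Y
    ⟨VA.act X.obj Y.obj (VA.toTen g) s.1, act_xPow (VA.toTen g) i s.1 s.2⟩ t
  have h2 := evalDual_chiEquiv hp h X s ⟨VA.act ((dualVA k p).obj (Opposite.op Y.obj))
      ((dualVA k p).obj (Opposite.op X.obj)) (VA.transpose X.obj Y.obj (VA.toTen g)) t.1,
    act_xPow (VA.transpose X.obj Y.obj (VA.toTen g)) j t.1 t.2⟩
  have h3 := pairEquiv_act hp g t.1 s.1
  exact h1.trans (h3.symm.trans h2.symm)

theorem chi_dual_map {X Y : GamCat k 1 (VA k p)} (f : X ⟶ Y) :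
    ((chi k p j).obj.map (underHom
      ((gamFunctorOp 1 (dualVAgr k p) (dualVAgr_isGradedContra k p)).map f.op))).lin =
      chiLin j ((dualVA k p).map ((gamOne k (VA k p)).map f).op) :=
  congrArg (chiLin j) (gamOne_gamMap (E := VA k p) (dualVALin X.obj Y.obj) (GamCat.ten f))

theorem affineKuhn_chi (hp : 0 < p) {i j : ℕ} (h : i + j + 1 = p) :
    DegZeroIso ((affineKuhn k p 1).obj (Opposite.op (chi k p j))) (chi k p i) := by
  let e : chi k p i ≅ (affineKuhn k p 1).obj (Opposite.op (chi k p j)) :=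
    grFunIso (fun X => GrVect.isoOfDeg (M := chiObj i X.obj)
      (N := GrVect.dualObj (chiDualObj j X)) 0 (chiEquiv hp h X) (chiEquiv_deg hp h X))
      fun {X Y} f => GrVect.hom_ext <| LinearMap.ext fun s => GrVect.dual_ext fun t => by
        obtain ⟨s, rfl⟩ := Submodule.mkQ_surjective _ s
        obtain ⟨t, rfl⟩ := Submodule.mkQ_surjective _ t
        exact (chiEquiv_naturality hp h ((gamOne k (VA k p)).map f) s t).trans
          (congrArg (fun φ => GrVect.evalDual (chiDualObj j X) (chiEquiv hp h X (chiMk i X.obj s))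
            (φ (chiMk j ((dualVA k p).obj (Opposite.op Y.obj)) t))) (chi_dual_map f).symm)
  exact ⟨e.symm, HasDegree.inv e fun X => chiEquiv_deg hp h X⟩

end

/-! ### Duality commutes with `z^*` -/

section

variable {k : Type u} [Field k] {p : ℕ} (hp : 0 < p)

theorem frobEquiv_proj (n : ℤ) (b c : TruncPoly k p) :
    frobEquiv k p hp (proj (TruncPoly.deg_internal k p) n b) c =
      frobEquiv k p hp b (proj (TruncPoly.deg_internal k p) (2 * ((p : ℤ) - 1) - n) c) := by
  have key : ∀ l m, ∀ b ∈ TruncPoly.deg k p l, ∀ c ∈ TruncPoly.deg k p m,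
      frobEquiv k p hp (proj (TruncPoly.deg_internal k p) n b) c =
      frobEquiv k p hp b (proj (TruncPoly.deg_internal k p) (2 * ((p : ℤ) - 1) - n) c) := by
    intro l m b hb c hc
    have hl : n ≠ l → proj (TruncPoly.deg_internal k p) n b = 0 :=
      fun h => proj_ne _ _ _ h _ hb
    have hm : 2 * ((p : ℤ) - 1) - n ≠ m →
        proj (TruncPoly.deg_internal k p) (2 * ((p : ℤ) - 1) - n) c = 0 :=
      fun h => proj_ne _ _ _ h _ hc
    by_cases h : n = l
    · rw [h, proj_same _ _ _ hb, ← h]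
      by_cases h' : 2 * ((p : ℤ) - 1) - n = m
      · rw [h', proj_same _ _ _ hc]
      · rw [hm h', frobEquiv_deg k p hp hb hc (by omega), map_zero]
    · rw [hl h, map_zero, LinearMap.zero_apply]
      by_cases h' : 2 * ((p : ℤ) - 1) - n = m
      · rw [h', proj_same _ _ _ hc, frobEquiv_deg k p hp hb hc (by omega)]
      · rw [hm h', map_zero]
  obtain ⟨S, hS⟩ := proj_sum' (TruncPoly.deg_internal k p) b
  obtain ⟨T, hT⟩ := proj_sum' (TruncPoly.deg_internal k p) c
  rw [hS, hT]
  simp only [map_sum, LinearMap.sum_apply]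
  exact Finset.sum_congr rfl fun m _ => Finset.sum_congr rfl fun l _ =>
    key l m _ (proj_mem _ _ _) _ (proj_mem _ _ _)

theorem pairEquiv_tensorProj (V : Type u) [AddCommGroup V] [Module k V] [Module.Finite k V] (n : ℤ)
    (t : Module.Dual k V ⊗[k] TruncPoly k p) (s : V ⊗[k] TruncPoly k p) :
    pairEquiv k p hp V (TruncPoly.tensorProj k p _ n t) s =
      pairEquiv k p hp V t (TruncPoly.tensorProj k p V (2 * ((p : ℤ) - 1) - n) s) := by
  have h : (pairEquiv k p hp V).toLinearMap ∘ₗ TruncPoly.tensorProj k p _ n =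
      (pairEquiv k p hp V).toLinearMap.compl₂
        (TruncPoly.tensorProj k p V (2 * ((p : ℤ) - 1) - n)) := pair_ext fun ξ b v a => by
    change ξ v * frobEquiv k p hp (proj _ n b) a = ξ v * frobEquiv k p hp b (proj _ _ a)
    rw [frobEquiv_proj]
  exact LinearMap.congr_fun (LinearMap.congr_fun h t) s

theorem TruncPoly.sub_mem_degrees {n : ℤ} (hn : n ∈ TruncPoly.degrees p) :
    2 * ((p : ℤ) - 1) - n ∈ TruncPoly.degrees p := by
  obtain ⟨i, hi, rfl⟩ := Finset.mem_image.1 hn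
  have := Finset.mem_range.1 hi
  exact Finset.mem_image.2 ⟨p - 1 - i, Finset.mem_range.2 (by omega), by omega⟩

/-- The isomorphism `V^* ⊗ A ≅ (V ⊗ A)^*` of spaces without grading. -/
def pairIso (V : VA k p) : ((zFun k p).obj ((dualVA k p).obj (Opposite.op V))).obj ≅
    (dualV k).obj (Opposite.op ((zFun k p).obj V).obj) where
  hom := FGModuleCat.ofHom (pairEquiv k p hp V.obj).toLinearMap
  inv := FGModuleCat.ofHom (pairEquiv k p hp V.obj).symm.toLinearMap
  hom_inv_id := FGModuleCat.hom_ext (LinearMap.ext (pairEquiv k p hp V.obj).symm_apply_apply)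
  inv_hom_id := FGModuleCat.hom_ext (LinearMap.ext (pairEquiv k p hp V.obj).apply_symm_apply)

theorem pairIso_naturality {V W : VA k p} (f : V ⟶ W) :
    forgetLin k p ((dualVA k p).obj (Opposite.op W)) ((dualVA k p).obj (Opposite.op V))
        ((dualVA k p).map f.op) ≫ (pairIso hp V).hom =
      (pairIso hp W).hom ≫ (dualV k).map (forgetLin k p V W f).op :=
  FGModuleCat.hom_ext <| LinearMap.ext fun t => LinearMap.ext fun s => pairEquiv_act hp f t s

theorem pairIso_π (V : VA k p) (n : ℤ) :
    CategoryStruct.comp (Z := (dualV k).obj (Opposite.op ((zFun k p).obj V).obj))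
      (((zFun k p).obj ((dualVA k p).obj (Opposite.op V))).π n) (pairIso hp V).hom =
    (pairIso hp V).hom ≫ (dualV k).map (((zFun k p).obj V).π (2 * ((p : ℤ) - 1) - n)).op :=
  FGModuleCat.hom_ext <| LinearMap.ext fun t => LinearMap.ext fun s =>
    pairEquiv_tensorProj hp V.obj n t s

variable (d : ℕ)

/-- The part of weight `m` of `V^* ⊗ A` is dual to the part of weight `2(p-1)d - m` of `V ⊗ A`. -/
theorem pairIso_weight (V : VA k p) (m : ℤ) :
    weightHom (d := d) ((zFun k p).obj ((dualVA k p).obj (Opposite.op V))) m ≫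
        gamHom k d (pairIso hp V).hom =
      gamHom k d (pairIso hp V).hom ≫ (gamFunctorOp d (dualV k) (dualV_isGradedContra k)).map
        (weightHom (d := d) ((zFun k p).obj V) (2 * ((p : ℤ) - 1) * d - m)).op := Gam.ext <| by
  let X := ((zFun k p).obj ((dualVA k p).obj (Opposite.op V))).obj
  let Y := (dualV k).obj (Opposite.op ((zFun k p).obj V).obj)
  change tenMap₂ (Linear.comp X X Y) (weightTen d _ m)
      (PiTensorProduct.tprod k fun _ => (pairIso hp V).hom) =
    tenMap₂ (Linear.comp X Y Y) (PiTensorProduct.tprod k fun _ => (pairIso hp V).hom)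
      (tenMap ((dualV_isGradedContra k).lin _ _) (weightTen d ((zFun k p).obj V) _))
  simp only [weightTen, map_sum, LinearMap.sum_apply, tenMap₂_tprod, tenMap_tprod]
  refine Finset.sum_nbij' (fun a i => 2 * ((p : ℤ) - 1) - a i)
    (fun a i => 2 * ((p : ℤ) - 1) - a i) ?_ ?_ ?_ ?_ ?_
  · intro a ha
    obtain ⟨h1, h2⟩ := mem_multiIdx.1 ha
    refine mem_multiIdx.2 ⟨fun i => TruncPoly.sub_mem_degrees (h1 i), ?_⟩
    rw [Finset.sum_sub_distrib, h2]
    simp [mul_comm]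
  · intro a ha
    obtain ⟨h1, h2⟩ := mem_multiIdx.1 ha
    refine mem_multiIdx.2 ⟨fun i => TruncPoly.sub_mem_degrees (h1 i), ?_⟩
    rw [Finset.sum_sub_distrib, h2]
    simp [mul_comm]
  · intro a _
    exact funext fun i => sub_sub_cancel _ _
  · intro a _
    exact funext fun i => sub_sub_cancel _ _
  · intro a _
    exact congrArg (PiTensorProduct.tprod k) (funext fun i => pairIso_π hp V (a i))

theorem gam_pairIso_naturality {X Y : GamCat k d (VA k p)} (f : X ⟶ Y) :
    underHom ((gamFunctor d (zFun k p) (zFun_isGradedLinear k p)).map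
      (underHom ((gamFunctorOp d (dualVAgr k p) (dualVAgr_isGradedContra k p)).map f.op))) ≫
        gamHom k d (pairIso hp X.obj).hom =
    gamHom k d (pairIso hp Y.obj).hom ≫ (gamFunctorOp d (dualV k) (dualV_isGradedContra k)).map
      (underHom ((gamFunctor d (zFun k p) (zFun_isGradedLinear k p)).map f)).op := by
  have h1 := gamMap_gamMap (d := d) (forgetLin k p ((dualVA k p).obj (Opposite.op Y.obj))
    ((dualVA k p).obj (Opposite.op X.obj))) (dualVALin X.obj Y.obj) (GamCat.ten f)
  have h2 := gamMap_gamMap (d := d) ((dualV_isGradedContra k).lin ((zFun k p).obj X.obj).obj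
    ((zFun k p).obj Y.obj).obj) (forgetLin k p X.obj Y.obj) (GamCat.ten f)
  have h := gamHom_naturality (forgetLin k p ((dualVA k p).obj (Opposite.op Y.obj))
      ((dualVA k p).obj (Opposite.op X.obj)) ∘ₗ dualVALin X.obj Y.obj)
    ((dualV_isGradedContra k).lin ((zFun k p).obj X.obj).obj ((zFun k p).obj Y.obj).obj ∘ₗ
      forgetLin k p X.obj Y.obj) (pairIso hp Y.obj).hom (pairIso hp X.obj).hom
    (fun x => pairIso_naturality hp x) (GamCat.ten f)
  rw [← h1, ← h2] at h
  exact h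

end

theorem GrVect.dualMap_comm {k : Type u} [Field k] {M N N' L : GrVect k} {f : M ⟶ N} {g : N ⟶ L}
    {f' : M ⟶ N'} {g' : N' ⟶ L} (h : f ≫ g = f' ≫ g') :
    dualMap g ≫ dualMap f = dualMap g' ≫ dualMap f' := by
  rw [← dualMap_comp, h, dualMap_comp]

section

variable {k : Type u} [Field k] {p : ℕ} (hp : 0 < p) (d : ℕ)

/-- The graded space `z^*(F)` at `V^* ⊗ A`, with `V^* ⊗ A` shifted by `2(p-1)`. -/
abbrev zDualObj (F : GrFun k d (FGModuleCat.{u} k)) (X : GamCat k d (VA k p)) : GrVect k :=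
  (grExt ((zStar k p d).obj F).obj ((zStar k p d).obj F).property).obj
    ((gamFunctorOp d (dualVAgr k p) (dualVAgr_isGradedContra k p)).obj (Opposite.op X))

/-- The graded space `F` at the dual of the space underlying `V ⊗ A`. -/
abbrev dualZObj (F : GrFun k d (FGModuleCat.{u} k)) (X : GamCat k d (VA k p)) : GrVect k :=
  F.obj.obj ((gamFunctorOp d (dualV k) (dualV_isGradedContra k)).obj
    (Opposite.op ⟨((zFun k p).obj X.obj).obj⟩))

/-- The isomorphism `z^*(F)((V ⊗ A)^*) ≅ F((V ⊗ A)^*)` induced by `pairIso`. It is not homogeneous,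
as the right-hand side does not see the grading of `A`. -/
def pairMap (F : GrFun k d (FGModuleCat.{u} k)) (X : GamCat k d (VA k p)) :
    zDualObj d F X ≅ dualZObj d F X :=
  (weights ((zStar k p d).obj F).property
      ((dualVAgr k p).obj (Opposite.op X.obj))).regradeIso.symm ≪≫
    (weights F.property ((zFun k p).obj ((dualVA k p).obj
      (Opposite.op X.obj)))).regradeIso.symm ≪≫
      F.obj.mapIso (gamIso k d (pairIso hp X.obj))

theorem pairMap_naturality (F : GrFun k d (FGModuleCat.{u} k)) {X Y : GamCat k d (VA k p)}
    (f : X ⟶ Y) :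
    (grExt ((zStar k p d).obj F).obj ((zStar k p d).obj F).property).map
        ((gamFunctorOp d (dualVAgr k p) (dualVAgr_isGradedContra k p)).map f.op) ≫
      (pairMap hp d F X).hom =
    (pairMap hp d F Y).hom ≫ F.obj.map ((gamFunctorOp d (dualV k) (dualV_isGradedContra k)).map
      (underHom ((gamFunctor d (zFun k p) (zFun_isGradedLinear k p)).map f)).op) := by
  have h := congrArg GrVect.Hom.lin ((F.obj.map_comp _ _).symm.trans
    ((congrArg F.obj.map (gam_pairIso_naturality hp d f)).trans (F.obj.map_comp _ _)))
  exact GrVect.hom_ext h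

/-- The component of `z^*(F^#) ≅ z^*(F)^#`. -/
def kuhnZApp (F : GrFun k d (FGModuleCat.{u} k)) (X : GamCat k d (VA k p)) :
    ((kuhn k d ⋙ zStar k p d).obj (Opposite.op F)).obj.obj X ≅
      (((zStar k p d).op ⋙ affineKuhn k p d).obj (Opposite.op F)).obj.obj X :=
  (weights ((kuhn k d).obj (Opposite.op F)).property
      ((zFun k p).obj X.obj)).regradeIso.symm ≪≫ GrVect.dualIso (pairMap hp d F X)

theorem kuhnZApp_naturality (F : GrFun k d (FGModuleCat.{u} k)) {X Y : GamCat k d (VA k p)}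
    (f : X ⟶ Y) :
    ((kuhn k d ⋙ zStar k p d).obj (Opposite.op F)).obj.map f ≫ (kuhnZApp hp d F Y).hom =
      (kuhnZApp hp d F X).hom ≫
        (((zStar k p d).op ⋙ affineKuhn k p d).obj (Opposite.op F)).obj.map f := by
  have h := congrArg GrVect.Hom.lin (GrVect.dualMap_comm (pairMap_naturality hp d F f)).symm
  exact GrVect.hom_ext h

/-- `pairIso_weight` after applying `F`. -/
theorem mapIso_pair_weight (F : GrFun k d (FGModuleCat.{u} k)) (X : GamCat k d (VA k p)) (m : ℤ)
    (x : (F.obj.obj ⟨((zFun k p).obj ((dualVA k p).obj (Opposite.op X.obj))).obj⟩).carrier) :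
    (F.obj.map (gamHom k d (pairIso hp X.obj).hom)).lin
        ((weights F.property ((zFun k p).obj ((dualVA k p).obj (Opposite.op X.obj)))).ε m x) =
      (F.obj.map ((gamFunctorOp d (dualV k) (dualV_isGradedContra k)).map
        (weightHom (d := d) ((zFun k p).obj X.obj) (2 * ((p : ℤ) - 1) * d - m)).op)).lin
        ((F.obj.map (gamHom k d (pairIso hp X.obj).hom)).lin x) := by
  have h := congrArg GrVect.Hom.lin ((F.obj.map_comp _ _).symm.trans
    ((congrArg F.obj.map (pairIso_weight hp d X.obj m)).trans (F.obj.map_comp _ _)))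
  exact LinearMap.congr_fun h x

/-- The part of weight `m` is raised by `m` on the left. On the right it is dual to the part of
weight `l = 2(p-1)d - m`, which is raised by `l` and lowered by `2(p-1)d`, that is, lowered by `m`. -/
theorem kuhnZApp_degree (F : GrFun k d (FGModuleCat.{u} k)) (X : GamCat k d (VA k p)) :
    (kuhnZApp hp d F X).hom.lin ∈ GrVect.degHom
      (((kuhn k d ⋙ zStar k p d).obj (Opposite.op F)).obj.obj X)
      ((((zStar k p d).op ⋙ affineKuhn k p d).obj (Opposite.op F)).obj.obj X) 0 := by
  intro n (ξ : GrVect.GrDual (dualZObj d F X)) hξ m hm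
    (x : (F.obj.obj ⟨((zFun k p).obj ((dualVA k p).obj (Opposite.op X.obj))).obj⟩).carrier) hx
  let W := weights F.property ((zFun k p).obj ((dualVA k p).obj (Opposite.op X.obj)))
  let φ := (F.obj.map (gamHom k d (pairIso hp X.obj).hom)).lin
  have hξ := (Weights.mem_gr (weights ((kuhn k d).obj (Opposite.op F)).property
    ((zFun k p).obj X.obj))).1 hξ
  have hx := W.mem_gr.1 ((mem_gr_single ((zStar k p d).obj F).property _ _ _ _).1 hx)
  change GrVect.evalDual (dualZObj d F X) ξ (φ x) = 0
  have hsum : φ x = ∑ l ∈ W.T, φ (W.ε l (W.ε l x)) := by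
    rw [← map_sum]
    refine congrArg φ ?_
    conv_lhs => rw [← W.ε_sum x]
    exact Finset.sum_congr rfl fun l _ => (W.ε_same l x).symm
  refine (congrArg (GrVect.evalDual (dualZObj d F X) ξ) hsum).trans ((map_sum _ _ _).trans ?_)
  refine Finset.sum_eq_zero fun l _ => ?_
  refine (congrArg (GrVect.evalDual (dualZObj d F X) ξ)
    (mapIso_pair_weight hp d F X l (W.ε l x))).trans ?_
  -- the component of weight `2(p-1)d - l` of `ξ` meets the component of weight `l` of `x`
  refine hξ (2 * ((p : ℤ) - 1) * d - l) (m - -(2 * ((p : ℤ) - 1)) * d - l) ?_ _ ?_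
  · intro h
    apply hm
    linarith
  · have h := F.property.map_deg 0 _ (gamHom_deg (d := d) (mem_deg_zero k (pairIso hp X.obj).hom))
      _ _ (hx l)
    rwa [add_zero] at h

theorem pairMap_naturality_left {F G : GrFun k d (FGModuleCat.{u} k)} (α : F ⟶ G)
    (X : GamCat k d (VA k p)) :
    (pairMap hp d F X).hom ≫ α.hom.app ((gamFunctorOp d (dualV k) (dualV_isGradedContra k)).obj
        (Opposite.op ⟨((zFun k p).obj X.obj).obj⟩)) =
      ((grExtFunctor k d (VA k p)).map ((zStar k p d).map α)).hom.app
        ((gamFunctorOp d (dualVAgr k p) (dualVAgr_isGradedContra k p)).obj (Opposite.op X)) ≫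
      (pairMap hp d G X).hom := by
  have h := congrArg GrVect.Hom.lin (α.hom.naturality (gamHom k d (pairIso hp X.obj).hom))
  exact GrVect.hom_ext h

theorem kuhnZApp_naturality_left {F G : (GrFun k d (FGModuleCat.{u} k))ᵒᵖ} (α : F ⟶ G)
    (X : GamCat k d (VA k p)) :
    ((kuhn k d ⋙ zStar k p d).map α).hom.app X ≫ (kuhnZApp hp d G.unop X).hom =
      (kuhnZApp hp d F.unop X).hom ≫ (((zStar k p d).op ⋙ affineKuhn k p d).map α).hom.app X := by
  have h := congrArg GrVect.Hom.lin
    (GrVect.dualMap_comm (pairMap_naturality_left hp d α.unop X))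
  exact GrVect.hom_ext h

/-- The isomorphism `z^*(F^#) ≅ z^*(F)^#`. -/
def kuhnZIso : kuhn k d ⋙ zStar k p d ≅ (zStar k p d).op ⋙ affineKuhn k p d :=
  NatIso.ofComponents
    (fun F => grFunIso (kuhnZApp hp d F.unop) fun f => kuhnZApp_naturality hp d F.unop f)
    fun α => ObjectProperty.hom_ext _ (NatTrans.ext (funext fun X =>
      kuhnZApp_naturality_left hp d α X))

theorem kuhn_zStar (hp : 0 < p) :
    NatDegZeroIso (kuhn k d ⋙ zStar k p d) ((zStar k p d).op ⋙ affineKuhn k p d) :=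
  ⟨kuhnZIso hp d, fun F X => kuhnZApp_degree hp d F.unop X⟩

end

end AffineStrict

end

theorem proposition2p4 (k : Type u) [Field k] (p : ℕ) [Fact p.Prime] [CharP k p] :
    -- duals of representable functors
    (∀ (d : ℕ) (U : VA k p),
      DegZeroIso ((affineKuhn k p d).obj (Opposite.op (rep d U)))
        (corepGr k p d ((dualVAgr k p).obj (Opposite.op U))) ∧
      DegZeroIso (corepGr k p d ((dualVAgr k p).obj (Opposite.op U)))
        ((shiftFun k d (VA k p) (-(2 * ((p : ℤ) - 1) * d))).obj
          (corep d ((dualVA k p).obj (Opposite.op U))))) ∧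
    -- duals of the functors `χ_j`
    (∀ j < p, DegZeroIso ((affineKuhn k p 1).obj (Opposite.op (chi k p j))) (chi k p (p - 1 - j))) ∧
    -- duality commutes with `z^*`
    (∀ d : ℕ, NatDegZeroIso (kuhn k d ⋙ zStar k p d) ((zStar k p d).op ⋙ affineKuhn k p d)) ∧
    -- `h^*` is left adjoint to `z^*`
    (∀ d : ℕ, GradedLeftAdjoint (hStarPlus k p d) (zStarPlus k p d)) ∧
    -- the explicit form of `h^*`
    (∀ d : ℕ, NatDegZeroIso (hStar k p d) (tDualStar k p d) ∧
      NatDegZeroIso (hStar k p d)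
        (tStar k p d ⋙ shiftFun k d (FGModuleCat.{u} k) (2 * ((p : ℤ) - 1) * d))) := by
  have hp : 0 < p := (Fact.out : p.Prime).pos
  exact ⟨fun d U => ⟨affineKuhn_rep d U, corepGr_dual d U⟩,
    fun j hj => affineKuhn_chi hp (by omega), fun d => kuhn_zStar d hp,
    fun d => hStarPlus_gradedLeftAdjoint k p d hp, fun d => hStar_explicit k p d⟩
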